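/- **Setting.** Let $\Lambda<0$, $U>0$, $v_{\mathcal I}>0$ and $\mathcal U=\{0\le u<U\}\cap\{u<v<u+v_{\mathcal I}\}$. Let $(r,\Omega^2,f)$ be a smooth solution on $\mathcal U$ of the spherically symmetric Einstein–massless Vlasov system with cosmological constant $\Lambda$, for the metric $g=-\Omega^2\,du\,dv+r^2g_{\mathbb S^2}$ ($r,\Omega^2>0$) and $f=\bar f(u,v;p^u,p^v,l)\,\delta(\Omega^2p^up^v-l^2/r^2)$, where $\bar f\ge0$ is smooth and, over each point of $\mathcal U$, compactly supported in the momenta; that is, $$\partial_u\partial_v(r^2)=-\tfrac12(1-\Lambda r^2)\Omega^2+8\pi r^2T_{uv},\qquad \partial_u\partial_v\log\Omega^2=\tfrac{\Omega^2}{2r^2}\big(1+4\Omega^{-2}\partial_ur\,\partial_vr\big)-16\pi T_{uv},$$ $$\partial_u(\Omega^{-2}\partial_ur)=-4\pi rT_{uu}\Omega^{-2},\qquad \partial_v(\Omega^{-2}\partial_vr)=-4\pi rT_{vv}\Omega^{-2},$$ $f$ is constant along the null geodesic flow, and $T_{uu},T_{uv},T_{vv}$ equal $\frac{\pi}{2}r^{-2}\int_0^\infty\!\int_0^\infty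 X\,\bar f\,\frac{dp^u}{p^u}\,l\,dl$ on the shell $\Omega^2p^up^v=l^2/r^2$, with $X=(\Omega^2p^v)^2$, $(\Omega^2p^u)(\Omega^2p^v)$, $(\Omega^2p^u)^2$ respectively. Assume that the axis $\{u=v\}$ is smooth ($r$ and $\Omega^2$ extend smoothly to it with $r=0<\Omega^2$, and the metric and the Vlasov field of the $3+1$ dimensional spacetime extend smoothly across it in Cartesian coordinates) and that conformal infinity $\mathcal I=\{u=v-v_{\mathcal I}\}$ is smooth ($1/r$, $\Omega^2/r^2$, and $\bar f$ as a function of $(u,v,\Omega^2p^u,\Omega^2p^v,l)$, extend smoothly to it, with $1/r=0\neq\Omega^2/r^2$ there). Put $\tilde m=\frac r2\big(1+4\Omega^{-2}\partial_ur\,\partial_vr\big)-\frac16\Lambda r^3$. A future directed, affinely parametrised *null geodesic* of angular momentum $l\ge0$ in $\mathcal U$ is a curve $\gamma=(u,v)$ with $\dot\gamma^u,\dot\gamma^v\ge0$, $\Omega^2\dot\gamma^u\dot\gamma^v=l^2/r^2$, $\frac{d}{ds}(\Omega^2\dot\gamma^u)=\big(\partial_v\log\Omega^2-2\frac{\partial_vr}{r}\big)\frac{l^2}{r^2}$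 and $\frac{d}{ds}(\Omega^2\dot\gamma^v)=\big(\partial_u\log\Omega^2-2\frac{\partial_ur}{r}\big)\frac{l^2}{r^2}$. **Statement.** There is an absolute constant $\delta_1>0$ such that the following holds for every $0<\delta_0\le\delta_1$. Let $C_0>100$ and suppose that $\partial_ur<0<\partial_vr$ on $\mathcal U$ and $$\sup_{\mathcal U}\Big(\Big|\log\frac{\partial_vr}{1-\frac13\Lambda r^2}\Big|+\Big|\log\frac{-\partial_ur}{1-\frac13\Lambda r^2}\Big|\Big)\le C_0,\qquad \sup_{\mathcal U}\Big(\frac{2\tilde m}{r}+\sqrt{-\Lambda}\,\tilde m\Big)\le\delta_0 .$$ **(A) One passage.** Let $\gamma:[0,a)\to\mathcal U$, $a\in(0,\infty]$, be a future inextendible null geodesic with angular momentum $l$, let $(u_0,v_0)=\gamma(0)$ and $E_0=\frac12(\Omega^2\dot\gamma^u+\Omega^2\dot\gamma^v)(0)$, and suppose that $$\dot\gamma^u(0)>\dot\gamma^v(0),\qquad 0<\frac{l}{E_0}\sqrt{-\Lambda}\le e^{-50C_0},\qquad r(\gamma(0))\ge e^{50C_0}\frac{l}{E_0}.$$ 1.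 With $w=e^{150C_0}\frac l{E_0}$, $\mathcal V_{\nwarrow}=[u_0,v_0+w]\times[v_0-w,v_0+w]$ and $\mathcal V_{\nearrow}=[v_0-w,v_0+w]\times[v_0-w,v_0+v_{\mathcal I}+w]$, the curve $\gamma$ is contained in $\{r\ge e^{-6C_0}\frac l{E_0}\}\cap(\mathcal V_{\nwarrow}\cup\mathcal V_{\nearrow})\cap\mathcal U$. 2. $e^{-100C_0}E_0\le\frac12(\Omega^2\dot\gamma^u+\Omega^2\dot\gamma^v)(s)\le e^{e^{200C_0}}E_0$ for all $s\in[0,a)$. 3. Let $s_c=\sup\{s\in(0,a):u(\gamma(s))+v(\gamma(s))\le 2v_0\}$. Then $$\frac{\dot\gamma^v}{\dot\gamma^u}(s)\le e^{e^{200C_0}}\frac{l^2}{E_0^2}\,\frac{1-\frac13\Lambda r^2}{r^2}\Big|_{\gamma(s)}\ (0\le s<s_c),\qquad \frac{\dot\gamma^u}{\dot\gamma^v}(s)\le e^{e^{200C_0}}\frac{l^2}{E_0^2}\,\frac{1-\frac13\Lambda r^2}{r^2}\Big|_{\gamma(s)}\ (s_c<s<a).$$ **(B) Successive reflections.** Let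 $N\in\mathbb N\cup\{\infty\}$ and let $\gamma_n$, $0\le n<N+1$, be null geodesics in $\mathcal U$ with angular momentum $l$, where $\gamma_0$ is defined on $[0,b_0)$ with $\gamma_0(0)\in\{u=0\}$ and $\gamma_n$ ($n\ge1$) on $(a_n,b_n)$, such that $\gamma_n$ is the reflection of $\gamma_{n-1}$ off $\mathcal I$ (that is, $b_{n-1}=+\infty$, $a_n=-\infty$, $\gamma_{n-1}(+\infty)=\gamma_n(-\infty)\in\mathcal I\cap\{u<U\}$, and the limits of $\Omega^2\dot\gamma^u$ and $\Omega^2\dot\gamma^v$ exist and are interchanged there), and such that $\gamma=\bigcup_n\gamma_n$ is maximally extended (if $N<\infty$, then $\gamma_N$ is future inextendible and has no reflection off $\mathcal I$). Let $v_0=v(\gamma_0(0))$, let $E_0$ be defined from $\gamma_0$ as in (A), and suppose that $$\dot\gamma_0^u(0)>\dot\gamma_0^v(0),\qquad 0<\frac l{E_0}\sqrt{-\Lambda}\le e^{-400(1+\lceil U/v_{\mathcal I}\rceil)C_0},\qquad r(\gamma_0(0))\ge e^{50C_0}\frac l{E_0}.$$ For $k\in\mathbb N$ put $w_k=e^{300(k+1)C_0}\frac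 l{E_0}$ and $$\mathcal V^{(k)}_{\nwarrow}=[v_0+(k-1)v_{\mathcal I}-w_k,\;v_0+kv_{\mathcal I}+w_k]\times[v_0+kv_{\mathcal I}-w_k,\;v_0+kv_{\mathcal I}+w_k],$$ $$\mathcal V^{(k)}_{\nearrow}=[v_0+kv_{\mathcal I}-w_k,\;v_0+kv_{\mathcal I}+w_k]\times[v_0+kv_{\mathcal I}-w_k,\;v_0+(k+1)v_{\mathcal I}+w_k].$$ Then: 1. $\displaystyle\gamma\subset\Big\{r\ge e^{-e^{400C_0}(1+U/v_{\mathcal I})}\frac l{E_0}\Big\}\cap\bigcup_{k=0}^{\lceil U/v_{\mathcal I}\rceil}\big(\mathcal V^{(k)}_{\nwarrow}\cup\mathcal V^{(k)}_{\nearrow}\big)\cap\mathcal U$. 2. $e^{-300C_0(1+U/v_{\mathcal I})}E_0\le\Omega^2(\dot\gamma^u+\dot\gamma^v)\le e^{e^{300C_0}(1+U/v_{\mathcal I})}E_0$ along $\gamma$. 3. At every point of every component $\gamma_n$, $$\frac{\dot\gamma^v}{\dot\gamma^u}\le e^{e^{300C_0}(1+U/v_{\mathcal I})}\frac{l^2}{E_0^2}\,\frac{1-\frac13\Lambda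 r^2}{r^2}\ \text{ if the point lies in }\mathcal V^{(n)}_{\nwarrow},\qquad \frac{\dot\gamma^u}{\dot\gamma^v}\le e^{e^{300C_0}(1+U/v_{\mathcal I})}\frac{l^2}{E_0^2}\,\frac{1-\frac13\Lambda r^2}{r^2}\ \text{ if it lies in }\mathcal V^{(n)}_{\nearrow}.$$ -/

import Mathlib

open Set Filter Topology
open scoped ContDiff

namespace EinsteinVlasov

noncomputable section

/-! ### Domains in the `(u,v)`-plane -/

/-- The domain `{0 ≤ u < U} ∩ {u < v < u + v_I}`. -/
def dom (U vI : ℝ) : Set (ℝ × ℝ) :=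
  {p | 0 ≤ p.1 ∧ p.1 < U ∧ p.1 < p.2 ∧ p.2 < p.1 + vI}

/-- The domain together with the axis `{u = v}`. -/
def domAxis (U vI : ℝ) : Set (ℝ × ℝ) :=
  {p | 0 ≤ p.1 ∧ p.1 < U ∧ p.1 ≤ p.2 ∧ p.2 < p.1 + vI}

/-- The domain together with conformal infinity `{u = v - v_I}`. -/
def domInfinity (U vI : ℝ) : Set (ℝ × ℝ) :=
  {p | 0 ≤ p.1 ∧ p.1 < U ∧ p.1 < p.2 ∧ p.2 ≤ p.1 + vI}

/-- `∂_u F` on `D` (one-sided at the boundary points `u = 0` of `D`). -/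
def dU (D : Set (ℝ × ℝ)) (F : ℝ × ℝ → ℝ) (p : ℝ × ℝ) : ℝ :=
  fderivWithin ℝ F D p (1, 0)

/-- `∂_v F` on `D`. -/
def dV (D : Set (ℝ × ℝ)) (F : ℝ × ℝ → ℝ) (p : ℝ × ℝ) : ℝ :=
  fderivWithin ℝ F D p (0, 1)

/-! ### The unknowns and the energy-momentum tensor -/

/-- The unknowns of the reduced system: `r`, `Om2 = Ω²` as functions of `(u,v)`, and a
representative `fbar` of the smooth spherically symmetric massless Vlasov field
`f = fbar(u,v;p^u,p^v,l) · δ(Ω² p^u p^v - l²/r²)`, as a function of `((u,v),(p^u,p^v,l))`.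
The metric is `g = -Ω² du dv + r² g_{S²}`. -/
structure Fields where
  r : ℝ × ℝ → ℝ
  Om2 : ℝ × ℝ → ℝ
  fbar : (ℝ × ℝ) × (ℝ × ℝ × ℝ) → ℝ

/-- The range `p^u ≥ 0`, `p^v ≥ 0`, `l ≥ 0` of the momentum variables `(p^u,p^v,l)`. -/
def octant : Set (ℝ × ℝ × ℝ) := {q | 0 ≤ q.1 ∧ 0 ≤ q.2.1 ∧ 0 ≤ q.2.2}

namespace Fields

variable (S : Fields)

/-- The null shell relation `Ω² p^u p^v = l²/r²`. -/
def OnShell (p : ℝ × ℝ) (q : ℝ × ℝ × ℝ) : Prop :=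
  S.Om2 p * q.1 * q.2.1 = q.2.2 ^ 2 / S.r p ^ 2

/-- The value of `p^v` determined by `p^u` and `l` through the null shell relation. -/
def shellPv (p : ℝ × ℝ) (pu l : ℝ) : ℝ := l ^ 2 / (S.Om2 p * S.r p ^ 2 * pu)

def Tuu (p : ℝ × ℝ) : ℝ :=
  Real.pi / 2 * (S.r p ^ 2)⁻¹ * ∫ l in Ioi (0 : ℝ), ∫ pu in Ioi (0 : ℝ),
    (S.Om2 p * S.shellPv p pu l) ^ 2 * S.fbar (p, (pu, S.shellPv p pu l, l)) / pu * l

def Tvv (p : ℝ × ℝ) : ℝ :=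
  Real.pi / 2 * (S.r p ^ 2)⁻¹ * ∫ l in Ioi (0 : ℝ), ∫ pu in Ioi (0 : ℝ),
    (S.Om2 p * pu) ^ 2 * S.fbar (p, (pu, S.shellPv p pu l, l)) / pu * l

def Tuv (p : ℝ × ℝ) : ℝ :=
  Real.pi / 2 * (S.r p ^ 2)⁻¹ * ∫ l in Ioi (0 : ℝ), ∫ pu in Ioi (0 : ℝ),
    (S.Om2 p * pu) * (S.Om2 p * S.shellPv p pu l) *
      S.fbar (p, (pu, S.shellPv p pu l, l)) / pu * l

/-- The angular trace `g^{AB} T_{AB}`. -/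
def TAB (p : ℝ × ℝ) : ℝ := 4 * (S.Om2 p)⁻¹ * S.Tuv p

/-- The Hawking mass `m = (r/2)(1 + 4 Ω⁻² ∂_u r ∂_v r)`. -/
def hawkingMass (D : Set (ℝ × ℝ)) (p : ℝ × ℝ) : ℝ :=
  S.r p / 2 * (1 + 4 * (S.Om2 p)⁻¹ * dU D S.r p * dV D S.r p)

/-- The renormalised Hawking mass `m - Λ r³ / 6`. -/
def renMass (Λ : ℝ) (D : Set (ℝ × ℝ)) (p : ℝ × ℝ) : ℝ :=
  S.hawkingMass D p - Λ / 6 * S.r p ^ 3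

/-! ### The spherically symmetric Einstein--massless Vlasov system -/

/-- The massless Vlasov field: `fbar` is smooth, non-negative on the null shell, compactly supported in the
momenta over each point, and solves the Vlasov equation on the null shell. -/
structure IsMasslessVlasov (D : Set (ℝ × ℝ)) : Prop where
  smooth : ContDiffOn ℝ ∞ S.fbar (D ×ˢ octant)
  nonneg : ∀ p ∈ D, ∀ q ∈ octant, S.OnShell p q → 0 ≤ S.fbar (p, q)
  compact_support : ∀ p ∈ D, ∃ P : ℝ, ∀ q ∈ octant, S.OnShell p q →
    S.fbar (p, q) ≠ 0 → q.1 ≤ P ∧ q.2.1 ≤ P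
  vlasov : ∀ p ∈ D, ∀ q ∈ octant, S.OnShell p q →
    q.1 * fderivWithin ℝ S.fbar (D ×ˢ octant) (p, q) ((1, 0), 0) +
      q.2.1 * fderivWithin ℝ S.fbar (D ×ˢ octant) (p, q) ((0, 1), 0) =
    (dU D (fun x => Real.log (S.Om2 x)) p * q.1 ^ 2 +
        2 / S.r p * (S.Om2 p)⁻¹ * dV D S.r p * (q.2.2 ^ 2 / S.r p ^ 2)) *
      fderivWithin ℝ S.fbar (D ×ˢ octant) (p, q) (0, (1, 0, 0)) +
    (dV D (fun x => Real.log (S.Om2 x)) p * q.2.1 ^ 2 +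
        2 / S.r p * (S.Om2 p)⁻¹ * dU D S.r p * (q.2.2 ^ 2 / S.r p ^ 2)) *
      fderivWithin ℝ S.fbar (D ×ˢ octant) (p, q) (0, (0, 1, 0))

/-- The Einstein equations (wave equations and constraints) for `(r, Ω², f)` on `D`. -/
structure IsEinstein (Λ : ℝ) (D : Set (ℝ × ℝ)) : Prop where
  wave_r : ∀ p ∈ D, dU D (dV D (fun x => S.r x ^ 2)) p =
    -(1 / 2) * (1 - Λ * S.r p ^ 2) * S.Om2 p + 8 * Real.pi * S.r p ^ 2 * S.Tuv p
  wave_Om2 : ∀ p ∈ D, dU D (dV D (fun x => Real.log (S.Om2 x))) p =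
    S.Om2 p / (2 * S.r p ^ 2) * (1 + 4 * (S.Om2 p)⁻¹ * dU D S.r p * dV D S.r p)
      - 8 * Real.pi * S.Tuv p - 2 * Real.pi * S.Om2 p * S.TAB p
  constraint_u : ∀ p ∈ D, dU D (fun x => (S.Om2 x)⁻¹ * dU D S.r x) p =
    -(4 * Real.pi) * S.r p * S.Tuu p * (S.Om2 p)⁻¹
  constraint_v : ∀ p ∈ D, dV D (fun x => (S.Om2 x)⁻¹ * dV D S.r x) p =
    -(4 * Real.pi) * S.r p * S.Tvv p * (S.Om2 p)⁻¹

/-! ### Regularity at the axis and at conformal infinity -/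

/-- The region of `ℝ × ℝ³` covered by the coordinates `t = (u+v)/2`, `x = ((v-u)/2) ω`,
`ω ∈ S²`; the axis is `x = 0`. -/
def cartDom (U vI : ℝ) : Set (ℝ × EuclideanSpace ℝ (Fin 3)) :=
  {y | 0 ≤ y.1 - ‖y.2‖ ∧ y.1 - ‖y.2‖ < U ∧ 2 * ‖y.2‖ < vI}

/-- The null coordinates `(u,v) = (t - |x|, t + |x|)` of the point `(t,x)`. -/
def nullCoord (y : ℝ × EuclideanSpace ℝ (Fin 3)) : ℝ × ℝ := (y.1 - ‖y.2‖, y.1 + ‖y.2‖)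

/-- The component `g_{ij}` off the axis of the metric
`g = Ω² (-dt² + d|x|²) + r² g_{S²}` in the coordinates `(t,x)`; its other components are
`g_{00} = -Ω²` and `g_{0i} = 0`. -/
def cartMetric (i j : Fin 3) (y : ℝ × EuclideanSpace ℝ (Fin 3)) : ℝ :=
  S.r (nullCoord y) ^ 2 / ‖y.2‖ ^ 2 * ((if i = j then 1 else 0) - y.2 i * y.2 j / ‖y.2‖ ^ 2)
    + S.Om2 (nullCoord y) * (y.2 i * y.2 j / ‖y.2‖ ^ 2)

/-- The variables `(p^u, p^v, l)` of the tangent vector `(p^t, p)` at `(t,x)`, `x ≠ 0`: with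
`p^ρ = x·p/|x|` and `p_⊥ = p - p^ρ x/|x|` one has `p^u = p^t - p^ρ`, `p^v = p^t + p^ρ` and
`l = r² |p_⊥| / |x|`. -/
def cartMomentum (y : ℝ × EuclideanSpace ℝ (Fin 3)) (k : ℝ × EuclideanSpace ℝ (Fin 3)) :
    ℝ × ℝ × ℝ :=
  (k.1 - inner ℝ y.2 k.2 / ‖y.2‖,
   k.1 + inner ℝ y.2 k.2 / ‖y.2‖,
   S.r (nullCoord y) ^ 2 * ‖k.2 - (inner ℝ y.2 k.2 / ‖y.2‖ ^ 2) • y.2‖ / ‖y.2‖)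

/-- Smooth axis `{u = v}`: `r`, `Ω²` extend smoothly to the axis with `r = 0 < Ω²` there, and
the metric and the Vlasov field of the `3+1` dimensional spacetime extend smoothly across
the axis in Cartesian coordinates. -/
structure SmoothAxis (U vI : ℝ) : Prop where
  r_smooth : ContDiffOn ℝ ∞ S.r (domAxis U vI)
  Om2_smooth : ContDiffOn ℝ ∞ S.Om2 (domAxis U vI)
  r_axis : ∀ p ∈ domAxis U vI, p.1 = p.2 → S.r p = 0
  Om2_axis : ∀ p ∈ domAxis U vI, p.1 = p.2 → 0 < S.Om2 p
  lapse_smooth : ContDiffOn ℝ ∞ (fun y => S.Om2 (nullCoord y)) (cartDom U vI)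
  metric_smooth : ∀ i j : Fin 3, ∃ h : ℝ × EuclideanSpace ℝ (Fin 3) → ℝ,
    ContDiffOn ℝ ∞ h (cartDom U vI) ∧
    ∀ y ∈ cartDom U vI, y.2 ≠ 0 → h y = S.cartMetric i j y
  vlasov_smooth :
    ∃ F : (ℝ × EuclideanSpace ℝ (Fin 3)) × (ℝ × EuclideanSpace ℝ (Fin 3)) → ℝ,
      ContDiffOn ℝ ∞ F (cartDom U vI ×ˢ univ) ∧
      ∀ y ∈ cartDom U vI, y.2 ≠ 0 → ∀ k : ℝ × EuclideanSpace ℝ (Fin 3), 0 ≤ k.1 →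
        S.OnShell (nullCoord y) (S.cartMomentum y k) →
        F (y, k) = S.fbar (nullCoord y, S.cartMomentum y k)

/-- Smooth conformal infinity `I = {v = u + v_I}`: the functions `1/r` and `Ω²/r²` extend
smoothly to `I`, with `1/r = 0 ≠ Ω²/r²` there, and so does the Vlasov field as a function of
`(u, v, Ω² p^u, Ω² p^v, l)`. -/
structure SmoothInfinity (U vI : ℝ) : Prop where
  inv_r : ∃ w : ℝ × ℝ → ℝ, ContDiffOn ℝ ∞ w (domInfinity U vI) ∧
    (∀ p ∈ dom U vI, w p = (S.r p)⁻¹) ∧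
    ∀ p ∈ domInfinity U vI, p.2 = p.1 + vI → w p = 0
  conformal : ∃ w : ℝ × ℝ → ℝ, ContDiffOn ℝ ∞ w (domInfinity U vI) ∧
    (∀ p ∈ dom U vI, w p = S.Om2 p / S.r p ^ 2) ∧
    ∀ p ∈ domInfinity U vI, p.2 = p.1 + vI → w p ≠ 0
  vlasov : ∃ F : (ℝ × ℝ) × (ℝ × ℝ × ℝ) → ℝ,
    ContDiffOn ℝ ∞ F (domInfinity U vI ×ˢ octant) ∧
    ∀ p ∈ dom U vI, ∀ q ∈ octant, S.OnShell p q →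
      F (p, (S.Om2 p * q.1, S.Om2 p * q.2.1, q.2.2)) = S.fbar (p, q)

/-- A smooth asymptotically AdS solution of the spherically symmetric Einstein--massless Vlasov
system with cosmological constant `Λ` on `{0 ≤ u < U} ∩ {u < v < u + v_I}`, with smooth axis
`{u = v}` and smooth conformal infinity `{u = v - v_I}`. -/
structure IsSmoothSolution (Λ U vI : ℝ) : Prop where
  r_pos : ∀ p ∈ dom U vI, 0 < S.r p
  Om2_pos : ∀ p ∈ dom U vI, 0 < S.Om2 p
  einstein : S.IsEinstein Λ (dom U vI)
  vlasov : S.IsMasslessVlasov (dom U vI)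
  axis : S.SmoothAxis U vI
  infinity : S.SmoothInfinity U vI

end Fields

/-! ### Null geodesics -/

/-- A curve `s ↦ (u,v)(s)` together with the components `(p^u,p^v)(s)` of its velocity. -/
structure PhaseCurve where
  u : ℝ → ℝ
  v : ℝ → ℝ
  pu : ℝ → ℝ
  pv : ℝ → ℝ

/-- The point `(u,v)` of the curve at the parameter value `s`. -/
def PhaseCurve.pt (γ : PhaseCurve) (s : ℝ) : ℝ × ℝ := (γ.u s, γ.v s)

/-- The quantity `Ω² (p^u + p^v) / 2` along a curve. -/
def energy (S : Fields) (γ : PhaseCurve) (s : ℝ) : ℝ :=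
  1 / 2 * (S.Om2 (γ.pt s) * γ.pu s + S.Om2 (γ.pt s) * γ.pv s)

/-- `γ`, on the parameter interval `J`, is (the projection to the `(u,v)`-plane of) a future
directed, affinely parametrised null geodesic with angular momentum `l` in the domain. -/
structure IsNullGeodesic (S : Fields) (U vI l : ℝ) (J : Set ℝ) (γ : PhaseCurve) : Prop where
  l_nonneg : 0 ≤ l
  mem : ∀ s ∈ J, γ.pt s ∈ dom U vI
  deriv_u : ∀ s ∈ J, HasDerivWithinAt γ.u (γ.pu s) J s
  deriv_v : ∀ s ∈ J, HasDerivWithinAt γ.v (γ.pv s) J s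
  future_u : ∀ s ∈ J, 0 ≤ γ.pu s
  future_v : ∀ s ∈ J, 0 ≤ γ.pv s
  null : ∀ s ∈ J, S.Om2 (γ.pt s) * γ.pu s * γ.pv s = l ^ 2 / S.r (γ.pt s) ^ 2
  motion_u : ∀ s ∈ J, HasDerivWithinAt (fun t => S.Om2 (γ.pt t) * γ.pu t)
    ((dV (dom U vI) (fun x => Real.log (S.Om2 x)) (γ.pt s)
        - 2 * (dV (dom U vI) S.r (γ.pt s) / S.r (γ.pt s))) * (l ^ 2 / S.r (γ.pt s) ^ 2)) J s
  motion_v : ∀ s ∈ J, HasDerivWithinAt (fun t => S.Om2 (γ.pt t) * γ.pv t)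
    ((dU (dom U vI) (fun x => Real.log (S.Om2 x)) (γ.pt s)
        - 2 * (dU (dom U vI) S.r (γ.pt s) / S.r (γ.pt s))) * (l ^ 2 / S.r (γ.pt s) ^ 2)) J s

/-- There is no null geodesic in the domain that continues `γ` beyond the future end of `J`. -/
def FutureInextendible (S : Fields) (U vI l : ℝ) (J : Set ℝ) (γ : PhaseCurve) : Prop :=
  ¬ ∃ (J' : Set ℝ) (γ' : PhaseCurve), J'.OrdConnected ∧ J ⊂ J' ∧
    (∀ s ∈ J, ∀ t ∈ J' \ J, s < t) ∧ IsNullGeodesic S U vI l J' γ' ∧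
    ∀ s ∈ J, γ'.u s = γ.u s ∧ γ'.v s = γ.v s ∧ γ'.pu s = γ.pu s ∧ γ'.pv s = γ.pv s

/-- `γ'` is the reflection of `γ` off conformal infinity: `γ` ends, as `s → +∞`, at the point of
`I` from which `γ'` starts as `s → -∞`, and there the components of the rescaled momenta
`Ω² γ̇` normal to `I = {v - u = v_I}` are opposite while the tangential ones agree, that is, the
`u` and `v` components are interchanged. -/
def IsReflection (S : Fields) (U vI : ℝ) (J : Set ℝ) (γ : PhaseCurve)
    (J' : Set ℝ) (γ' : PhaseCurve) : Prop :=
  J ∈ (atTop : Filter ℝ) ∧ J' ∈ (atBot : Filter ℝ) ∧ ∃ u₁ P Q : ℝ, 0 ≤ u₁ ∧ u₁ < U ∧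
    Tendsto γ.u atTop (𝓝 u₁) ∧ Tendsto γ.v atTop (𝓝 (u₁ + vI)) ∧
    Tendsto (fun s => S.Om2 (γ.pt s) * γ.pu s) atTop (𝓝 P) ∧
    Tendsto (fun s => S.Om2 (γ.pt s) * γ.pv s) atTop (𝓝 Q) ∧
    Tendsto γ'.u atBot (𝓝 u₁) ∧ Tendsto γ'.v atBot (𝓝 (u₁ + vI)) ∧
    Tendsto (fun s => S.Om2 (γ'.pt s) * γ'.pu s) atBot (𝓝 Q) ∧
    Tendsto (fun s => S.Om2 (γ'.pt s) * γ'.pv s) atBot (𝓝 P)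

/-- The half-open interval `[0, b)`, `b ∈ (0, +∞]`. -/
def initInterval (b : EReal) : Set ℝ := {s | 0 ≤ s ∧ (s : EReal) < b}

/-- The parameter interval of the `n`-th component of a maximally extended geodesic:
`[0, b₀)` for `n = 0` and `(a_n, b_n)` for `n ≥ 1`. -/
def component (a b : ℕ → EReal) (n : ℕ) : Set ℝ :=
  if n = 0 then initInterval (b 0) else {s | a n < (s : EReal) ∧ (s : EReal) < b n}

/-- The components `γ_n`, `0 ≤ n < N + 1`, form a null geodesic with angular momentum `l`,
maximally extended to the future through reflections off conformal infinity. -/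
structure IsMaximalReflected (S : Fields) (U vI l : ℝ) (N : ℕ∞) (a b : ℕ → EReal)
    (γ : ℕ → PhaseCurve) : Prop where
  a_zero : a 0 = 0
  lt : ∀ n : ℕ, (n : ℕ∞) ≤ N → a n < b n
  geodesic : ∀ n : ℕ, (n : ℕ∞) ≤ N → IsNullGeodesic S U vI l (component a b n) (γ n)
  reflection : ∀ n : ℕ, ((n + 1 : ℕ) : ℕ∞) ≤ N →
    IsReflection S U vI (component a b n) (γ n) (component a b (n + 1)) (γ (n + 1))
  maximal : ∀ n : ℕ, (n : ℕ∞) = N →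
    FutureInextendible S U vI l (component a b n) (γ n) ∧
    ¬ ∃ (c : EReal) (γ' : PhaseCurve), ⊥ < c ∧
      IsNullGeodesic S U vI l {s : ℝ | (s : EReal) < c} γ' ∧
      IsReflection S U vI (component a b n) (γ n) {s : ℝ | (s : EReal) < c} γ'

/-! ### Rectangles -/

/-- `[u₀, v₀ + w] × [v₀ - w, v₀ + w]`. -/
def rectIn (u₀ v₀ w : ℝ) : Set (ℝ × ℝ) := Icc u₀ (v₀ + w) ×ˢ Icc (v₀ - w) (v₀ + w)

/-- `[v₀ - w, v₀ + w] × [v₀ - w, v₀ + v_I + w]`. -/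
def rectOut (v₀ vI w : ℝ) : Set (ℝ × ℝ) :=
  Icc (v₀ - w) (v₀ + w) ×ˢ Icc (v₀ - w) (v₀ + vI + w)

/-- The half-width `e^{300(k+1)C₀} l/E₀` of the rectangles of the `k`-th component. -/
def width (C₀ l E₀ : ℝ) (k : ℕ) : ℝ := Real.exp (300 * (k + 1) * C₀) * (l / E₀)

/-- The rectangle around the ingoing path from infinity to the axis after `k` reflections. -/
def rectInIter (v₀ vI C₀ l E₀ : ℝ) (k : ℕ) : Set (ℝ × ℝ) :=
  rectIn (v₀ + (k - 1) * vI - width C₀ l E₀ k) (v₀ + k * vI) (width C₀ l E₀ k)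

/-- The rectangle around the outgoing path from the axis to infinity after `k` reflections. -/
def rectOutIter (v₀ vI C₀ l E₀ : ℝ) (k : ℕ) : Set (ℝ × ℝ) :=
  rectOut (v₀ + k * vI) vI (width C₀ l E₀ k)

end

end EinsteinVlasov

/-! ### Null geodesics over an abstract background -/

namespace EinsteinVlasov

/-! Write `p = Ω² γ̇^u`, `q = Ω² γ̇^v`, `G = log (Ω²/r²)`, `X = e^{C₀}` and `ε = l/E₀`. Along a null
geodesic `p q = l² e^G` and `d log p = ∂_v G dv`. Two properties of the background suffice. (i)
`e^G` is comparable to `R⁻²` up to powers of `X`, where the tortoise radius `R` is defined by `dR =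
dr/(1 - Λr²/3)`. It is bi-Lipschitz in `u` and in `v`, comparable to `v - u`, and its distance to
the limit `RI` at infinity is comparable to `u + v_I - v`. (ii) `∂_u ∂_v G ≤ 0`. The Einstein
equations give `∂_u ∂_v G = -(Ω²/2r²)(1 - 6m̃/r) - 24π T_uv`; the mass is small and `T_uv ≥ 0`. No
quantitative bound on the matter is needed.

By (ii), the growth of `log p` is at most the increment of `G` along the initial cone `u = u(s₀)`
and at least that along the final cone `u = u(s₁)`; by (i) both increments are logarithms of ratios
of radii. Once `v` exceeds `u(s₀) + v_I` the initial cone has left the domain. There `∂_v G` is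
bounded by its value on `I`, which is at most the derivative along `I` of `log(-∂_v(1/r))`, because
`2m̃/r³` vanishes to third order on `I`; this logarithm oscillates by at most `2C₀`. Hence `p` and
`p R²` grow at most by powers of `X` (`Ray.p_mul_sq_le`).

A passage splits where `u = v₀ - X¹⁰ε`. Before (`Ray.ingoing`), `p` hardly decreases, so `q ≲ ε²
p/(v₀-u)²` and integration keeps `v` within `ε` of `v₀`. After (`Ray.outgoing_q`, `Ray.outgoing_u`),
`p R² ≲ E ε²`, so `q` is bounded below, and `du ≲ dv/R²` along the cone keeps `u` close to `v₀`. At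
the minimum of `R` the momenta satisfy `q ≲ p`, so the null relation gives `R ≳ ε` (`Ray.R_lower`).
Finally `q` grows by a fixed factor whenever `u` moves by half the distance to the axis; the number
of such moves is a power of `X`, which is the source of the double exponential (`Ray.q_le_pow`).

At a reflection the momenta are interchanged and the smallness of `ε` makes the reflected ray
ingoing, so the passage estimate applies again, from starting points tending to infinity
(`Fields.IsControlled.tracked_reflection`). Each reflection costs fixed factors in the energy and in
`ε`, and there are at most `⌈U/v_I⌉ + 1` of them (`Fields.IsControlled.stages`). -/

theorem mem_dom {U vI u v : ℝ} :
    (u, v) ∈ dom U vI ↔ 0 ≤ u ∧ u < U ∧ u < v ∧ v < u + vI := Iff.rfl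

/-- The properties of `G = log (Ω² / r²)`, of its derivative `Gv = ∂_v G` and of the
tortoise-type radius `R` which control null geodesics. The function `A` bounds the values of `Gv`
at conformal infinity, where `R = RI`. -/
structure Background (U vI X RI : ℝ) (G Gv R : ℝ × ℝ → ℝ) (A A' : ℝ → ℝ) : Prop where
  X_large : 1000 ≤ X
  RI_pos : 0 < RI
  hasDeriv : ∀ u v, (u, v) ∈ dom U vI → HasDerivAt (fun y => G (u, y)) (Gv (u, v)) v
  anti : ∀ u u' v, (u, v) ∈ dom U vI → (u', v) ∈ dom U vI → u ≤ u' → Gv (u', v) ≤ Gv (u, v)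
  hasDeriv_A : ∀ v, vI ≤ v → v < U + vI → HasDerivWithinAt A (A' v) (Ico vI (U + vI)) v
  le_A : ∀ u v, (u, v) ∈ dom U vI → vI ≤ v → Gv (u, v) ≤ A' v
  A_osc : ∀ v v', vI ≤ v → v < U + vI → vI ≤ v' → v' < U + vI → Real.exp (A v - A v') ≤ X ^ 2
  R_cont : ContinuousOn R (dom U vI)
  R_v : ∀ u v v', (u, v) ∈ dom U vI → (u, v') ∈ dom U vI → v ≤ v' →
    (v' - v) / X ≤ R (u, v') - R (u, v) ∧ R (u, v') - R (u, v) ≤ X * (v' - v)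
  R_u : ∀ u u' v, (u, v) ∈ dom U vI → (u', v) ∈ dom U vI → u ≤ u' →
    (u' - u) / X ≤ R (u, v) - R (u', v) ∧ R (u, v) - R (u', v) ≤ X * (u' - u)
  R_axis : ∀ u v, (u, v) ∈ dom U vI → (v - u) / X ≤ R (u, v) ∧ R (u, v) ≤ X * (v - u)
  R_inf : ∀ u v, (u, v) ∈ dom U vI →
    (u + vI - v) / X ≤ RI - R (u, v) ∧ RI - R (u, v) ≤ X * (u + vI - v)
  lower : ∀ p ∈ dom U vI, 4 / X ≤ Real.exp (G p) * R p ^ 2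
  upper : ∀ p ∈ dom U vI, Real.exp (G p) * R p ^ 2 ≤ 10 * X

/-- A null geodesic of angular momentum `l` in terms of the rescaled momenta `p = Ω² γ̇^u`,
`q = Ω² γ̇^v` and of `σ = Ω⁻²`. -/
structure Ray (U vI : ℝ) (G Gv : ℝ × ℝ → ℝ) (l : ℝ) (J : Set ℝ) (σ u v p q : ℝ → ℝ) : Prop where
  l_pos : 0 < l
  mem : ∀ s ∈ J, (u s, v s) ∈ dom U vI
  σ_pos : ∀ s ∈ J, 0 < σ s
  p_pos : ∀ s ∈ J, 0 < p s
  q_pos : ∀ s ∈ J, 0 < q s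
  deriv_u : ∀ s ∈ J, HasDerivWithinAt u (σ s * p s) J s
  deriv_v : ∀ s ∈ J, HasDerivWithinAt v (σ s * q s) J s
  deriv_p : ∀ s ∈ J, HasDerivWithinAt p (Gv (u s, v s) * (σ s * q s) * p s) J s
  null : ∀ s ∈ J, p s * q s = l ^ 2 * Real.exp (G (u s, v s))

theorem antitoneOn_Icc_of_hasDerivWithinAt {f f' : ℝ → ℝ} {a b : ℝ}
    (h : ∀ x ∈ Icc a b, HasDerivWithinAt f (f' x) (Icc a b) x) (h' : ∀ x ∈ Icc a b, f' x ≤ 0) :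
    AntitoneOn f (Icc a b) :=
  antitoneOn_of_hasDerivWithinAt_nonpos (convex_Icc a b) (fun x hx => (h x hx).continuousWithinAt)
    (fun x hx => (h x (interior_subset hx)).mono interior_subset)
    (fun x hx => h' x (interior_subset hx))

theorem monotoneOn_Icc_of_hasDerivWithinAt {f f' : ℝ → ℝ} {a b : ℝ}
    (h : ∀ x ∈ Icc a b, HasDerivWithinAt f (f' x) (Icc a b) x) (h' : ∀ x ∈ Icc a b, 0 ≤ f' x) :
    MonotoneOn f (Icc a b) :=
  monotoneOn_of_hasDerivWithinAt_nonneg (convex_Icc a b) (fun x hx => (h x hx).continuousWithinAt)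
    (fun x hx => (h x (interior_subset hx)).mono interior_subset)
    (fun x hx => h' x (interior_subset hx))

/-! ### Growth of the momentum `p` by comparison with null cones -/

namespace Ray

variable {U vI X RI l s₀ s₁ : ℝ} {G Gv R : ℝ × ℝ → ℝ} {A A' : ℝ → ℝ} {σ u v p q : ℝ → ℝ}
  {J : Set ℝ}

theorem mono {J' : Set ℝ} (h : Ray U vI G Gv l J σ u v p q) (hJ : J' ⊆ J) :
    Ray U vI G Gv l J' σ u v p q where
  l_pos := h.l_pos
  mem s hs := h.mem s (hJ hs)
  σ_pos s hs := h.σ_pos s (hJ hs)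
  p_pos s hs := h.p_pos s (hJ hs)
  q_pos s hs := h.q_pos s (hJ hs)
  deriv_u s hs := (h.deriv_u s (hJ hs)).mono hJ
  deriv_v s hs := (h.deriv_v s (hJ hs)).mono hJ
  deriv_p s hs := (h.deriv_p s (hJ hs)).mono hJ
  null s hs := h.null s (hJ hs)

theorem sub (h : Ray U vI G Gv l (Icc s₀ s₁) σ u v p q) {a b : ℝ} (ha : s₀ ≤ a) (hb : b ≤ s₁) :
    Ray U vI G Gv l (Icc a b) σ u v p q :=
  h.mono (Icc_subset_Icc ha hb)

theorem cont_u (h : Ray U vI G Gv l J σ u v p q) : ContinuousOn u J :=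
  fun s hs => (h.deriv_u s hs).continuousWithinAt

theorem cont_v (h : Ray U vI G Gv l J σ u v p q) : ContinuousOn v J :=
  fun s hs => (h.deriv_v s hs).continuousWithinAt

theorem cont_p (h : Ray U vI G Gv l J σ u v p q) : ContinuousOn p J :=
  fun s hs => (h.deriv_p s hs).continuousWithinAt

theorem mono_u (h : Ray U vI G Gv l (Icc s₀ s₁) σ u v p q) : MonotoneOn u (Icc s₀ s₁) :=
  monotoneOn_Icc_of_hasDerivWithinAt h.deriv_u
    (fun s hs => (mul_pos (h.σ_pos s hs) (h.p_pos s hs)).le)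

theorem mono_v (h : Ray U vI G Gv l (Icc s₀ s₁) σ u v p q) : MonotoneOn v (Icc s₀ s₁) :=
  monotoneOn_Icc_of_hasDerivWithinAt h.deriv_v
    (fun s hs => (mul_pos (h.σ_pos s hs) (h.q_pos s hs)).le)

theorem strictMono_u (h : Ray U vI G Gv l (Icc s₀ s₁) σ u v p q) :
    StrictMonoOn u (Icc s₀ s₁) :=
  strictMonoOn_of_hasDerivWithinAt_pos (convex_Icc _ _) h.cont_u
    (fun s hs => (h.deriv_u s (interior_subset hs)).mono interior_subset)
    (fun s hs => mul_pos (h.σ_pos s (interior_subset hs)) (h.p_pos s (interior_subset hs)))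

theorem strictMono_v (h : Ray U vI G Gv l (Icc s₀ s₁) σ u v p q) :
    StrictMonoOn v (Icc s₀ s₁) :=
  strictMonoOn_of_hasDerivWithinAt_pos (convex_Icc _ _) h.cont_v
    (fun s hs => (h.deriv_v s (interior_subset hs)).mono interior_subset)
    (fun s hs => mul_pos (h.σ_pos s (interior_subset hs)) (h.q_pos s (interior_subset hs)))

theorem deriv_log_p (h : Ray U vI G Gv l J σ u v p q) {s : ℝ} (hs : s ∈ J) :
    HasDerivWithinAt (fun t => Real.log (p t)) (Gv (u s, v s) * (σ s * q s)) J s := by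
  have := (h.deriv_p s hs).log (h.p_pos s hs).ne'
  rwa [mul_div_assoc, div_self (h.p_pos s hs).ne', mul_one] at this

/-- Upper bound for the growth of `p` by the values of `G` on the initial cone. -/
theorem p_le_of_slice (hB : Background U vI X RI G Gv R A A')
    (h : Ray U vI G Gv l (Icc s₀ s₁) σ u v p q) (hs : s₀ ≤ s₁) (hv : v s₁ < u s₀ + vI) :
    p s₁ ≤ p s₀ * Real.exp (G (u s₀, v s₁) - G (u s₀, v s₀)) := by
  have h0 : s₀ ∈ Icc s₀ s₁ := left_mem_Icc.2 hs
  have h1 : s₁ ∈ Icc s₀ s₁ := right_mem_Icc.2 hs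
  have hm : ∀ t ∈ Icc s₀ s₁, (u s₀, v t) ∈ dom U vI := fun t ht => by
    have a := h.mem _ h0
    have b := h.mono_v h0 ht ht.1
    have c := h.mono_v ht h1 ht.2
    rw [mem_dom] at a ⊢
    exact ⟨a.1, a.2.1, by linarith, by linarith⟩
  -- The derivative is `(Gv (u, v) - Gv (u s₀, v)) σ q`, and `Gv` decreases in `u`.
  have key := antitoneOn_Icc_of_hasDerivWithinAt (f := fun t => Real.log (p t) - G (u s₀, v t))
    (fun t ht => (h.deriv_log_p ht).sub
      ((hB.hasDeriv _ _ (hm t ht)).comp_hasDerivWithinAt t (h.deriv_v t ht)))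
    (fun t ht => by
      have a := hB.anti (u s₀) (u t) (v t) (hm t ht) (h.mem t ht) (h.mono_u h0 ht ht.1)
      have b := mul_pos (h.σ_pos t ht) (h.q_pos t ht)
      nlinarith) h0 h1 hs
  simp only at key
  rw [← Real.exp_log (h.p_pos _ h1), ← Real.exp_log (h.p_pos _ h0), ← Real.exp_add]
  exact Real.exp_le_exp.2 (by linarith)

/-- Lower bound for the growth of `p` by the values of `G` on the final cone. -/
theorem le_p_of_slice (hB : Background U vI X RI G Gv R A A')
    (h : Ray U vI G Gv l (Icc s₀ s₁) σ u v p q) (hs : s₀ ≤ s₁) (hv : u s₁ < v s₀) :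
    p s₀ * Real.exp (G (u s₁, v s₁) - G (u s₁, v s₀)) ≤ p s₁ := by
  have h0 : s₀ ∈ Icc s₀ s₁ := left_mem_Icc.2 hs
  have h1 : s₁ ∈ Icc s₀ s₁ := right_mem_Icc.2 hs
  have hm : ∀ t ∈ Icc s₀ s₁, (u s₁, v t) ∈ dom U vI := fun t ht => by
    have a := h.mem _ h1
    have b := h.mono_v h0 ht ht.1
    have c := h.mono_v ht h1 ht.2
    rw [mem_dom] at a ⊢
    exact ⟨a.1, a.2.1, by linarith, by linarith⟩
  have key := monotoneOn_Icc_of_hasDerivWithinAt (f := fun t => Real.log (p t) - G (u s₁, v t))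
    (fun t ht => (h.deriv_log_p ht).sub
      ((hB.hasDeriv _ _ (hm t ht)).comp_hasDerivWithinAt t (h.deriv_v t ht)))
    (fun t ht => by
      have a := hB.anti (u t) (u s₁) (v t) (h.mem t ht) (hm t ht) (h.mono_u ht h1 ht.2)
      have b := mul_pos (h.σ_pos t ht) (h.q_pos t ht)
      nlinarith) h0 h1 hs
  simp only at key
  rw [← Real.exp_log (h.p_pos _ h1), ← Real.exp_log (h.p_pos _ h0), ← Real.exp_add]
  exact Real.exp_le_exp.2 (by linarith)

/-- Upper bound for the growth of `p` by the behaviour of `G` at conformal infinity. -/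
theorem p_le_of_infinity (hB : Background U vI X RI G Gv R A A')
    (h : Ray U vI G Gv l (Icc s₀ s₁) σ u v p q) (hs : s₀ ≤ s₁) (hv : vI ≤ v s₀) :
    p s₁ ≤ p s₀ * X ^ 2 := by
  have h0 : s₀ ∈ Icc s₀ s₁ := left_mem_Icc.2 hs
  have h1 : s₁ ∈ Icc s₀ s₁ := right_mem_Icc.2 hs
  have hm : ∀ t ∈ Icc s₀ s₁, vI ≤ v t ∧ v t < U + vI := fun t ht => by
    have a := h.mem _ ht
    have b := h.mono_v h0 ht ht.1
    rw [mem_dom] at a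
    exact ⟨by linarith, by linarith⟩
  have key := antitoneOn_Icc_of_hasDerivWithinAt (f := fun t => Real.log (p t) - A (v t))
    (fun t ht => (h.deriv_log_p ht).sub
      ((hB.hasDeriv_A _ (hm t ht).1 (hm t ht).2).comp t (h.deriv_v t ht) (fun x hx => hm x hx)))
    (fun t ht => by
      have a := hB.le_A (u t) (v t) (h.mem t ht) (hm t ht).1
      have b := mul_pos (h.σ_pos t ht) (h.q_pos t ht)
      nlinarith) h0 h1 hs
  simp only at key
  refine le_trans ?_ (mul_le_mul_of_nonneg_left (hB.A_osc (v s₁) (v s₀) (hm _ h1).1 (hm _ h1).2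
    (hm _ h0).1 (hm _ h0).2) (h.p_pos _ h0).le)
  rw [← Real.exp_log (h.p_pos _ h1), ← Real.exp_log (h.p_pos _ h0), ← Real.exp_add]
  exact Real.exp_le_exp.2 (by linarith)

end Ray

/-! ### Comparison of `exp G` with the radius -/

namespace Background

variable {U vI X RI : ℝ} {G Gv R : ℝ × ℝ → ℝ} {A A' : ℝ → ℝ}

theorem R_pos (hB : Background U vI X RI G Gv R A A') {u v : ℝ} (h : (u, v) ∈ dom U vI) :
    0 < R (u, v) := by
  have hX := hB.X_large
  have := (hB.R_axis u v h).1
  refine lt_of_lt_of_le (div_pos ?_ (by linarith)) this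
  rw [mem_dom] at h
  linarith

theorem R_lt (hB : Background U vI X RI G Gv R A A') {u v : ℝ} (h : (u, v) ∈ dom U vI) :
    R (u, v) < RI := by
  have hX := hB.X_large
  have := (hB.R_inf u v h).1
  have h2 : 0 < (u + vI - v) / X := by
    refine div_pos ?_ (by linarith)
    rw [mem_dom] at h
    linarith
  linarith

theorem R_mono_v (hB : Background U vI X RI G Gv R A A') {u v v' : ℝ} (h : (u, v) ∈ dom U vI)
    (h' : (u, v') ∈ dom U vI) (hv : v ≤ v') : R (u, v) ≤ R (u, v') := by
  have hX := hB.X_large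
  have := (hB.R_v u v v' h h' hv).1
  have h2 : 0 ≤ (v' - v) / X := div_nonneg (by linarith) (by linarith)
  linarith

theorem R_anti_u (hB : Background U vI X RI G Gv R A A') {u u' v : ℝ} (h : (u, v) ∈ dom U vI)
    (h' : (u', v) ∈ dom U vI) (hv : u ≤ u') : R (u', v) ≤ R (u, v) := by
  have hX := hB.X_large
  have := (hB.R_u u u' v h h' hv).1
  have h2 : 0 ≤ (u' - u) / X := div_nonneg (by linarith) (by linarith)
  linarith

/-- Ratios of `exp G` are controlled by ratios of `R`. -/
theorem exp_sub_mul_le (hB : Background U vI X RI G Gv R A A') {x y : ℝ × ℝ}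
    (hx : x ∈ dom U vI) (hy : y ∈ dom U vI) :
    Real.exp (G x - G y) * R x ^ 2 ≤ 5 / 2 * X ^ 2 * R y ^ 2 := by
  have hX : 0 < X := by linarith [hB.X_large]
  have h1 := hB.upper x hx
  have h2 := hB.lower y hy
  rw [div_le_iff₀ hX] at h2
  rw [Real.exp_sub, div_mul_eq_mul_div, div_le_iff₀ (Real.exp_pos _)]
  nlinarith

end Background

namespace Ray

variable {U vI X RI l s₀ s₁ : ℝ} {G Gv R : ℝ × ℝ → ℝ} {A A' : ℝ → ℝ} {σ u v p q : ℝ → ℝ}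
  {J : Set ℝ}

/-- The radius is taken at the corner `(u s₀, v s₁)`, where it is at least as large as at both ends
of the ray; `outgoing_u_slice` needs this stronger form. -/
theorem p_mul_sq_le_slice (hB : Background U vI X RI G Gv R A A')
    (h : Ray U vI G Gv l (Icc s₀ s₁) σ u v p q) (hs : s₀ ≤ s₁) (hv : v s₁ < u s₀ + vI) :
    (u s₀, v s₁) ∈ dom U vI ∧
    p s₁ * R (u s₀, v s₁) ^ 2 ≤ 5 / 2 * X ^ 2 * (p s₀ * R (u s₀, v s₀) ^ 2) := by
  have h0 : s₀ ∈ Icc s₀ s₁ := left_mem_Icc.2 hs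
  have h1 : s₁ ∈ Icc s₀ s₁ := right_mem_Icc.2 hs
  have hm : (u s₀, v s₁) ∈ dom U vI := by
    have a := h.mem _ h0
    have b := h.mono_v h0 h1 hs
    rw [mem_dom] at a ⊢
    exact ⟨a.1, a.2.1, by linarith, by linarith⟩
  refine ⟨hm, ?_⟩
  have a := p_le_of_slice hB h hs hv
  have b := hB.exp_sub_mul_le hm (h.mem _ h0)
  calc _ ≤ p s₀ * Real.exp (G (u s₀, v s₁) - G (u s₀, v s₀)) * R (u s₀, v s₁) ^ 2 := by gcongr
    _ = p s₀ * (Real.exp (G (u s₀, v s₁) - G (u s₀, v s₀)) * R (u s₀, v s₁) ^ 2) := by ring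
    _ ≤ p s₀ * (5 / 2 * X ^ 2 * R (u s₀, v s₀) ^ 2) :=
        mul_le_mul_of_nonneg_left b (h.p_pos _ h0).le
    _ = _ := by ring

/-- The ray is split where `v` reaches the end `u s₀ + vI` of the initial cone: up to there the
slice estimate applies, in the limit `R → RI`, and afterwards the bound by `A` costs a further `X ^
2`. -/
theorem p_mul_sq_le_infinity (hB : Background U vI X RI G Gv R A A')
    (h : Ray U vI G Gv l (Icc s₀ s₁) σ u v p q) (hs : s₀ ≤ s₁) (hv : u s₀ + vI ≤ v s₁) :
    p s₁ * RI ^ 2 ≤ 5 / 2 * X ^ 4 * (p s₀ * R (u s₀, v s₀) ^ 2) := by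
  have h0 : s₀ ∈ Icc s₀ s₁ := left_mem_Icc.2 hs
  have h1 : s₁ ∈ Icc s₀ s₁ := right_mem_Icc.2 hs
  have hX := hB.X_large
  have hd := h.mem _ h0
  rw [mem_dom] at hd
  obtain ⟨t, ht, hvt⟩ := intermediate_value_Icc hs h.cont_v
    (show u s₀ + vI ∈ Icc (v s₀) (v s₁) from ⟨by linarith, hv⟩)
  have hst : s₀ < t := by
    rcases ht.1.lt_or_eq with h' | h'
    · exact h'
    · rw [← h'] at hvt; linarith
  -- At time `t` the corner lies outside the domain, so `R` is replaced by a lower bound continuous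
  -- up to `t`; `max 0` keeps the squares ordered.
  have key : ∀ x ∈ Ico s₀ t, p x * (max 0 (RI - X * (u s₀ + vI - v x))) ^ 2 ≤
      5 / 2 * X ^ 2 * (p s₀ * R (u s₀, v s₀) ^ 2) := fun x hx => by
    have hx' : x ∈ Icc s₀ s₁ := ⟨hx.1, hx.2.le.trans ht.2⟩
    have hlt : v x < u s₀ + vI := hvt ▸ h.strictMono_v hx' ht hx.2
    obtain ⟨hm, hp⟩ := p_mul_sq_le_slice hB (h.sub le_rfl hx'.2) hx.1 hlt
    refine le_trans ?_ hp
    have e := (hB.R_inf _ _ hm).2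
    have f := hB.R_pos hm
    have := h.p_pos x hx'
    gcongr
    exact max_le f.le (by linarith)
  have hc : ContinuousWithinAt (fun x => p x * (max 0 (RI - X * (u s₀ + vI - v x))) ^ 2)
      (Ico s₀ t) t := by
    have hsub : Ico s₀ t ⊆ Icc s₀ s₁ := fun x hx => ⟨hx.1, hx.2.le.trans ht.2⟩
    have c1 := (h.cont_p t ht).mono hsub
    have c2 := (h.cont_v t ht).mono hsub
    exact c1.mul ((continuousWithinAt_const.max (continuousWithinAt_const.sub
      (continuousWithinAt_const.mul (continuousWithinAt_const.sub c2)))).pow 2)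
  have hcl : t ∈ closure (Ico s₀ t) := by
    rw [closure_Ico hst.ne]; exact right_mem_Icc.2 hst.le
  have hp := hc.closure_le hcl continuousWithinAt_const key
  rw [hvt, sub_self, mul_zero, sub_zero, max_eq_right hB.RI_pos.le] at hp
  have h2 := p_le_of_infinity hB (h.sub ht.1 le_rfl) ht.2 (by linarith)
  calc p s₁ * RI ^ 2 ≤ p t * X ^ 2 * RI ^ 2 := by gcongr
    _ = X ^ 2 * (p t * RI ^ 2) := by ring
    _ ≤ X ^ 2 * (5 / 2 * X ^ 2 * (p s₀ * R (u s₀, v s₀) ^ 2)) := by gcongr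
    _ = _ := by ring

/-- Both bounds come from one radius `ρ`, the corner value or `RI`, which dominates the radii at
both ends. -/
theorem p_mul_sq_le (hB : Background U vI X RI G Gv R A A')
    (h : Ray U vI G Gv l (Icc s₀ s₁) σ u v p q) (hs : s₀ ≤ s₁) :
    p s₁ * R (u s₁, v s₁) ^ 2 ≤ 5 / 2 * X ^ 4 * (p s₀ * R (u s₀, v s₀) ^ 2) ∧
    p s₁ ≤ 5 / 2 * X ^ 4 * p s₀ := by
  have h0 : s₀ ∈ Icc s₀ s₁ := left_mem_Icc.2 hs
  have h1 : s₁ ∈ Icc s₀ s₁ := right_mem_Icc.2 hs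
  have hX := hB.X_large
  have hR1 := hB.R_pos (h.mem _ h1)
  have hR0 := hB.R_pos (h.mem _ h0)
  have hp1 := h.p_pos _ h1
  have hp0 := h.p_pos _ h0
  obtain ⟨ρ, e1, e2, e3⟩ : ∃ ρ, R (u s₁, v s₁) ≤ ρ ∧ R (u s₀, v s₀) ≤ ρ ∧
      p s₁ * ρ ^ 2 ≤ 5 / 2 * X ^ 4 * (p s₀ * R (u s₀, v s₀) ^ 2) := by
    rcases lt_or_ge (v s₁) (u s₀ + vI) with hv | hv
    · obtain ⟨hm, hp⟩ := p_mul_sq_le_slice hB h hs hv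
      refine ⟨_, hB.R_anti_u hm (h.mem _ h1) (h.mono_u h0 h1 hs),
        hB.R_mono_v (h.mem _ h0) hm (h.mono_v h0 h1 hs), hp.trans ?_⟩
      have : X ^ 2 ≤ X ^ 4 := pow_le_pow_right₀ (by linarith) (by norm_num)
      gcongr
    · exact ⟨RI, (hB.R_lt (h.mem _ h1)).le, (hB.R_lt (h.mem _ h0)).le,
        p_mul_sq_le_infinity hB h hs hv⟩
  constructor
  · refine le_trans ?_ e3
    gcongr
  · have : p s₁ * R (u s₀, v s₀) ^ 2 ≤ 5 / 2 * X ^ 4 * p s₀ * R (u s₀, v s₀) ^ 2 := by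
      refine le_trans ?_ (e3.trans (le_of_eq (by ring)))
      gcongr
    exact le_of_mul_le_mul_right this (by positivity)

/-- `q` in terms of `p` through the null relation. -/
theorem q_bounds (hB : Background U vI X RI G Gv R A A')
    (h : Ray U vI G Gv l J σ u v p q) {s : ℝ} (hs : s ∈ J) :
    4 * l ^ 2 ≤ X * (p s * q s * R (u s, v s) ^ 2) ∧
    p s * q s * R (u s, v s) ^ 2 ≤ 10 * X * l ^ 2 := by
  have hX : 0 < X := by linarith [hB.X_large]
  have h1 := hB.upper _ (h.mem s hs)
  have h2 := hB.lower _ (h.mem s hs)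
  rw [div_le_iff₀ hX] at h2
  have hl := pow_pos h.l_pos 2
  rw [h.null s hs]
  constructor <;> nlinarith

end Ray

/-! ### The ingoing and the outgoing phase -/

namespace Ray

variable {U vI X RI l s₀ s₁ E ε : ℝ} {G Gv R : ℝ × ℝ → ℝ} {A A' : ℝ → ℝ} {σ u v p q : ℝ → ℝ}
  {J : Set ℝ}

/-- Here `v s₁ ≤ v s₀ + ε` is a bootstrap assumption. On the final cone `R` then changes by at most
`X ε`, less than its size, so `exp G` changes by a bounded factor and `p` cannot drop much. The null
relation and `R ≥ (v s₀ - u)/X` turn this into the bound for `q`. -/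
theorem ingoing_of_v_le (hB : Background U vI X RI G Gv R A A')
    (h : Ray U vI G Gv l (Icc s₀ s₁) σ u v p q) (hs : s₀ ≤ s₁) (hε : 0 < ε) (hl : l = ε * E)
    (hE : 0 < E) (hp : E ≤ p s₀) (hu : u s₁ ≤ v s₀ - X ^ 10 * ε) (hv : v s₁ ≤ v s₀ + ε) :
    E ≤ 10 * X ^ 2 * p s₁ ∧ q s₁ * (v s₀ - u s₁) ^ 2 ≤ X ^ 8 * ε ^ 2 * p s₁ := by
  have h0 : s₀ ∈ Icc s₀ s₁ := left_mem_Icc.2 hs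
  have h1 : s₁ ∈ Icc s₀ s₁ := right_mem_Icc.2 hs
  have hX := hB.X_large
  have hX0 : 0 < X := by linarith
  have hv01 := h.mono_v h0 h1 hs
  have hXε : 0 < X ^ 10 * ε := by positivity
  have hd := h.mem _ h1
  have hd1 := hd
  rw [mem_dom] at hd
  have hm : (u s₁, v s₀) ∈ dom U vI := ⟨hd.1, hd.2.1, by simp only; linarith, by simp only; linarith⟩
  set ρ := R (u s₁, v s₀) with hρ
  set r := R (u s₁, v s₁) with hr
  have hρ0 : 0 < ρ := hB.R_pos hm
  have hr0 : 0 < r := hB.R_pos hd1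
  have e1 : r - ρ ≤ X * ε := (hB.R_v _ _ _ hm hd1 hv01).2.trans (by gcongr; linarith)
  have e2 : X * ε ≤ ρ := by
    refine le_trans ?_ (hB.R_axis _ _ hm).1
    rw [le_div_iff₀ hX0]
    have : X ^ 2 ≤ X ^ 10 := pow_le_pow_right₀ (by linarith) (by norm_num)
    nlinarith
  have e3 : r ≤ 2 * ρ := by linarith
  have f1 := le_p_of_slice hB h hs (by linarith)
  have f2 := hB.exp_sub_mul_le hm hd1
  have hp1 := h.p_pos _ h1
  have hq1 := h.q_pos _ h1
  have f3 : Real.exp (G (u s₁, v s₀) - G (u s₁, v s₁)) ≤ 10 * X ^ 2 := by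
    have : Real.exp (G (u s₁, v s₀) - G (u s₁, v s₁)) * ρ ^ 2 ≤ 10 * X ^ 2 * ρ ^ 2 := by
      refine f2.trans ?_
      calc 5 / 2 * X ^ 2 * r ^ 2 ≤ 5 / 2 * X ^ 2 * (2 * ρ) ^ 2 := by gcongr
        _ = _ := by ring
    exact le_of_mul_le_mul_right this (by positivity)
  have g1 : E ≤ 10 * X ^ 2 * p s₁ := by
    calc E ≤ p s₀ := hp
      _ = p s₀ * Real.exp (G (u s₁, v s₁) - G (u s₁, v s₀)) *
          Real.exp (G (u s₁, v s₀) - G (u s₁, v s₁)) := by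
          rw [mul_assoc, ← Real.exp_add]; simp
      _ ≤ p s₁ * (10 * X ^ 2) := by gcongr
      _ = _ := by ring
  refine ⟨g1, ?_⟩
  have g2 := (q_bounds hB h h1).2
  have g3 : q s₁ * r ^ 2 ≤ 1000 * X ^ 5 * ε ^ 2 * p s₁ := by
    have : q s₁ * r ^ 2 * p s₁ ≤ 1000 * X ^ 5 * ε ^ 2 * p s₁ * p s₁ := by
      calc q s₁ * r ^ 2 * p s₁ = p s₁ * q s₁ * r ^ 2 := by ring
        _ ≤ 10 * X * l ^ 2 := g2
        _ = 10 * X * ε ^ 2 * E ^ 2 := by rw [hl]; ring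
        _ ≤ 10 * X * ε ^ 2 * (10 * X ^ 2 * p s₁) ^ 2 := by gcongr
        _ = _ := by ring
    exact le_of_mul_le_mul_right this hp1
  have g4 : v s₀ - u s₁ ≤ X * r := by
    have := (hB.R_axis _ _ hd1).1
    rw [div_le_iff₀ hX0] at this
    linarith
  calc q s₁ * (v s₀ - u s₁) ^ 2 ≤ q s₁ * (X * r) ^ 2 := by
        gcongr
        linarith
    _ = X ^ 2 * (q s₁ * r ^ 2) := by ring
    _ ≤ X ^ 2 * (1000 * X ^ 5 * ε ^ 2 * p s₁) := by gcongr
    _ = 1000 * X ^ 7 * ε ^ 2 * p s₁ := by ring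
    _ ≤ X * X ^ 7 * ε ^ 2 * p s₁ := by gcongr
    _ = _ := by ring

/-- The momentum bound reads `dv ≤ X⁸ε² du/(v s₀ - u)²`. Its integral is at most `X⁸ε²/(v s₀ - u
s₁)`, and `v s₀ - u s₁ ≥ X¹⁰ε` improves the bootstrap assumption. -/
theorem ingoing_v_le_aux (hB : Background U vI X RI G Gv R A A')
    (h : Ray U vI G Gv l (Icc s₀ s₁) σ u v p q) (hs : s₀ ≤ s₁) (hε : 0 < ε) (hl : l = ε * E)
    (hE : 0 < E) (hp : E ≤ p s₀) (hu : u s₁ ≤ v s₀ - X ^ 10 * ε) (hv : v s₁ ≤ v s₀ + ε) :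
    v s₁ ≤ v s₀ + ε / X ^ 2 := by
  have h0 : s₀ ∈ Icc s₀ s₁ := left_mem_Icc.2 hs
  have h1 : s₁ ∈ Icc s₀ s₁ := right_mem_Icc.2 hs
  have hX := hB.X_large
  have hX0 : 0 < X := by linarith
  have hXε : 0 < X ^ 10 * ε := by positivity
  have hu' : ∀ t ∈ Icc s₀ s₁, X ^ 10 * ε ≤ v s₀ - u t := fun t ht => by
    have := h.mono_u ht h1 ht.2
    linarith
  have key := antitoneOn_Icc_of_hasDerivWithinAt
    (f := fun t => v t - X ^ 8 * ε ^ 2 * (v s₀ - u t)⁻¹)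
    (fun t ht => (h.deriv_v t ht).sub (((h.deriv_u t ht).const_sub (v s₀)).inv
      (by linarith [hu' t ht]) |>.const_mul (X ^ 8 * ε ^ 2)))
    (fun t ht => by
      have a := (ingoing_of_v_le hB (h.sub le_rfl ht.2) ht.1 hε hl hE hp
        (by linarith [hu' t ht]) (by linarith [h.mono_v ht h1 ht.2])).2
      have b := h.σ_pos t ht
      have d : 0 < v s₀ - u t := by linarith [hu' t ht]
      have e : σ t * q t ≤ X ^ 8 * ε ^ 2 * (σ t * p t / (v s₀ - u t) ^ 2) := by
        rw [← mul_div_assoc, le_div_iff₀ (by positivity)]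
        calc σ t * q t * (v s₀ - u t) ^ 2 = σ t * (q t * (v s₀ - u t) ^ 2) := by ring
          _ ≤ σ t * (X ^ 8 * ε ^ 2 * p t) := by gcongr
          _ = _ := by ring
      rw [neg_neg]
      linarith) h0 h1 hs
  simp only at key
  have k1 : X ^ 8 * ε ^ 2 * (v s₀ - u s₁)⁻¹ ≤ ε / X ^ 2 := by
    rw [← div_eq_mul_inv, div_le_div_iff₀ (by linarith [hu' _ h1]) (by positivity)]
    calc X ^ 8 * ε ^ 2 * X ^ 2 = ε * (X ^ 10 * ε) := by ring
      _ ≤ _ := by gcongr; exact hu' _ h1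
  have k2 : 0 ≤ X ^ 8 * ε ^ 2 * (v s₀ - u s₀)⁻¹ :=
    mul_nonneg (by positivity) (inv_nonneg.2 (by linarith [hu' _ h0]))
  linarith

/-- The ingoing phase: as long as `u` is well below its value on the axis, the geodesic
remains close to the incoming cone and its momentum does not decrease much. -/
theorem ingoing (hB : Background U vI X RI G Gv R A A')
    (h : Ray U vI G Gv l (Icc s₀ s₁) σ u v p q) (hs : s₀ ≤ s₁) (hε : 0 < ε) (hl : l = ε * E)
    (hE : 0 < E) (hp : E ≤ p s₀) (hu : u s₁ ≤ v s₀ - X ^ 10 * ε) :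
    v s₁ ≤ v s₀ + ε ∧ v s₁ - v s₀ ≤ (u s₁ - u s₀) / 2 ∧ E ≤ X ^ 3 * p s₁ ∧ q s₁ ≤ p s₁ := by
  have h0 : s₀ ∈ Icc s₀ s₁ := left_mem_Icc.2 hs
  have h1 : s₁ ∈ Icc s₀ s₁ := right_mem_Icc.2 hs
  have hX := hB.X_large
  have hX0 : 0 < X := by linarith
  have hXε : 0 < X ^ 10 * ε := by positivity
  have hv : v s₁ ≤ v s₀ + ε := by
    -- Closing the bootstrap: at a time with `v = v s₀ + ε` the improved bound `ε / X ^ 2` is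
    -- violated.
    by_contra! hcon
    obtain ⟨t, ht, hvt⟩ := intermediate_value_Icc hs h.cont_v
      (show v s₀ + ε ∈ Icc (v s₀) (v s₁) from ⟨by linarith, hcon.le⟩)
    have := ingoing_v_le_aux hB (h.sub le_rfl ht.2) ht.1 hε hl hE hp
      ((h.mono_u ht h1 ht.2).trans hu) hvt.le
    rw [hvt] at this
    have h2 : ε / X ^ 2 < ε := div_lt_self hε (one_lt_pow₀ (by linarith) (by norm_num))
    linarith
  have hq : ∀ t ∈ Icc s₀ s₁, E ≤ 10 * X ^ 2 * p t ∧ q t ≤ p t / 2 := fun t ht => by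
    have hut := h.mono_u ht h1 ht.2
    obtain ⟨a, b⟩ := ingoing_of_v_le hB (h.sub le_rfl ht.2) ht.1 hε hl hE hp
        (by linarith) (by linarith [h.mono_v ht h1 ht.2])
    refine ⟨a, ?_⟩
    have hqt := h.q_pos t ht
    have hpt := h.p_pos t ht
    have c1 : q t * (X ^ 10 * ε) ^ 2 ≤ X ^ 8 * ε ^ 2 * p t := by
      refine le_trans ?_ b
      gcongr
      linarith
    have c2 : q t * X ^ 12 ≤ p t := by
      have : q t * X ^ 12 * (X ^ 8 * ε ^ 2) ≤ p t * (X ^ 8 * ε ^ 2) := by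
        calc _ = q t * (X ^ 10 * ε) ^ 2 := by ring
          _ ≤ _ := c1
          _ = _ := by ring
      exact le_of_mul_le_mul_right this (by positivity)
    have c3 : (2 : ℝ) ≤ X ^ 12 := by
      calc (2 : ℝ) ≤ X := by linarith
        _ ≤ X ^ 12 := le_self_pow₀ (by linarith) (by norm_num)
    nlinarith
  have key := antitoneOn_Icc_of_hasDerivWithinAt (f := fun t => v t - u t / 2)
    (fun t ht => (h.deriv_v t ht).sub ((h.deriv_u t ht).div_const 2))
    (fun t ht => by
      have b := h.σ_pos t ht
      have := (hq t ht).2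
      nlinarith) h0 h1 hs
  simp only at key
  have hp1 := h.p_pos _ h1
  refine ⟨hv, by linarith, (hq _ h1).1.trans ?_, by linarith [(hq _ h1).2]⟩
  calc 10 * X ^ 2 * p s₁ ≤ X * X ^ 2 * p s₁ := by gcongr; linarith
    _ = _ := by ring

/-- After the ingoing phase the momentum `q` is bounded from below. -/
theorem outgoing_q (hB : Background U vI X RI G Gv R A A')
    (h : Ray U vI G Gv l (Icc s₀ s₁) σ u v p q) (hs : s₀ ≤ s₁) (hε : 0 < ε) (hl : l = ε * E)
    (hE : 0 < E) (hp : p s₀ ≤ 5 * X ^ 4 * E) (hR : R (u s₀, v s₀) ≤ 2 * X ^ 11 * ε) :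
    E ≤ X ^ 32 * q s₁ := by
  have h0 : s₀ ∈ Icc s₀ s₁ := left_mem_Icc.2 hs
  have h1 : s₁ ∈ Icc s₀ s₁ := right_mem_Icc.2 hs
  have hX := hB.X_large
  have hX0 : 0 < X := by linarith
  have a := (p_mul_sq_le hB h hs).1
  have b := (q_bounds hB h h1).1
  have hR0 := hB.R_pos (h.mem _ h0)
  have hp0 := h.p_pos _ h0
  have hq1 := h.q_pos _ h1
  -- Since `p R²` stays of size `E ε²`, the lower bound `4 l² ≤ X q (p R²)` leaves room only for
  -- large `q`.
  have c1 : p s₀ * R (u s₀, v s₀) ^ 2 ≤ 5 * X ^ 4 * E * (2 * X ^ 11 * ε) ^ 2 := by gcongr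
  have a' : p s₁ * R (u s₁, v s₁) ^ 2 ≤
      5 / 2 * X ^ 4 * (5 * X ^ 4 * E * (2 * X ^ 11 * ε) ^ 2) := a.trans (by gcongr)
  have c2 : E * (4 * E * ε ^ 2) ≤ X ^ 32 * q s₁ * (4 * E * ε ^ 2) := by
    calc E * (4 * E * ε ^ 2) = 4 * l ^ 2 := by rw [hl]; ring
      _ ≤ X * (p s₁ * q s₁ * R (u s₁, v s₁) ^ 2) := b
      _ = X * q s₁ * (p s₁ * R (u s₁, v s₁) ^ 2) := by ring
      _ ≤ X * q s₁ * (5 / 2 * X ^ 4 * (5 * X ^ 4 * E * (2 * X ^ 11 * ε) ^ 2)) := by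
          gcongr
      _ = 12.5 * X ^ 31 * q s₁ * (4 * E * ε ^ 2) := by ring
      _ ≤ X * X ^ 31 * q s₁ * (4 * E * ε ^ 2) := by gcongr; linarith
      _ = _ := by ring
  exact le_of_mul_le_mul_right c2 (by positivity)

/-- With `ρ = R (u s₀, v)`, the bounds `p ρ² ≲ p(s₀) S²` and `q ≳ l²/(p ρ²)` give `p ≤ K q/ρ²`, and
`ρ ≥ S + (v - v s₀)/X`. So `du ≤ K dv/(S + (v - v s₀)/X)²`, whose integral is at most `K X/S`. -/
theorem outgoing_u_slice (hB : Background U vI X RI G Gv R A A')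
    (h : Ray U vI G Gv l (Icc s₀ s₁) σ u v p q) (hs : s₀ ≤ s₁) (hε : 0 < ε) (hl : l = ε * E)
    (hE : 0 < E) (hp : p s₀ ≤ 5 * X ^ 4 * E) (hR : R (u s₀, v s₀) ≤ 2 * X ^ 11 * ε)
    (hv : v s₁ ≤ u s₀ + vI) :
    u s₁ - u s₀ ≤ X ^ 48 * ε := by
  have h0 : s₀ ∈ Icc s₀ s₁ := left_mem_Icc.2 hs
  have h1 : s₁ ∈ Icc s₀ s₁ := right_mem_Icc.2 hs
  have hX := hB.X_large
  have hX0 : 0 < X := by linarith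
  set S := R (u s₀, v s₀) with hS
  have hS0 : 0 < S := hB.R_pos (h.mem _ h0)
  have hp0 := h.p_pos _ h0
  have hl0 := h.l_pos
  set K := 25 / 16 * X ^ 5 * p s₀ ^ 2 * S ^ 4 / l ^ 2 with hK
  have hK0 : 0 < K := by positivity
  have hden : ∀ t ∈ Icc s₀ s₁, 0 < S + (v t - v s₀) / X := fun t ht => by
    have : 0 ≤ (v t - v s₀) / X := div_nonneg (sub_nonneg.2 (h.mono_v h0 ht ht.1)) hX0.le
    linarith
  -- Only interior times: at `s₁` the corner `(u s₀, v s₁)` may lie on infinity.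
  have hslope : ∀ t ∈ interior (Icc s₀ s₁), p t * (S + (v t - v s₀) / X) ^ 2 ≤ K * q t :=
    fun t ht' => by
    have ht : t ∈ Icc s₀ s₁ := interior_subset ht'
    rw [interior_Icc] at ht'
    have hvt : v t < u s₀ + vI := lt_of_lt_of_le (h.strictMono_v ht h1 ht'.2) hv
    obtain ⟨hm, hpt⟩ := p_mul_sq_le_slice hB (h.sub le_rfl ht.2) ht.1 hvt
    have e1 := (hB.R_v _ _ _ (h.mem _ h0) hm (h.mono_v h0 ht ht.1)).1
    have e2 := hB.R_anti_u hm (h.mem _ ht) (h.mono_u h0 ht ht.1)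
    set ρ := R (u s₀, v t) with hρ
    have hρ0 := hB.R_pos hm
    have hr0 := hB.R_pos (h.mem _ ht)
    have b := (q_bounds hB h ht).1
    have hq1 := h.q_pos _ ht
    have hp1 := h.p_pos _ ht
    have b' : 4 * l ^ 2 ≤ X * (p t * q t * ρ ^ 2) := b.trans (by gcongr)
    have c1 : p t * ρ ^ 2 * (4 * l ^ 2) ≤ K * q t * (4 * l ^ 2) := by
      calc p t * ρ ^ 2 * (4 * l ^ 2) ≤ p t * ρ ^ 2 * (X * (p t * q t * ρ ^ 2)) := by
            gcongr
        _ = X * q t * (p t * ρ ^ 2) ^ 2 := by ring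
        _ ≤ X * q t * (5 / 2 * X ^ 2 * (p s₀ * S ^ 2)) ^ 2 := by gcongr
        _ = _ := by rw [hK]; field_simp; ring
    have c2 := le_of_mul_le_mul_right c1 (by positivity)
    refine le_trans ?_ c2
    have := hden t ht
    gcongr
    linarith
  have key := antitoneOn_of_hasDerivWithinAt_nonpos (convex_Icc s₀ s₁)
    (f := fun t => u t + K * X * (S + (v t - v s₀) / X)⁻¹)
    (f' := fun t => σ t * p t + K * X * (-(σ t * q t / X) / (S + (v t - v s₀) / X) ^ 2))
    (h.cont_u.add (continuousOn_const.mul (((h.cont_v.sub continuousOn_const).div_const X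
      |> continuousOn_const.add).inv₀ (fun t ht => (hden t ht).ne'))))
    (fun t ht' => by
      have ht : t ∈ Icc s₀ s₁ := interior_subset ht'
      exact ((h.deriv_u t ht).add (((((h.deriv_v t ht).sub_const (v s₀)).div_const X).const_add S).inv
        (hden t ht).ne' |>.const_mul (K * X))).mono interior_subset)
    (fun t ht' => by
      have ht : t ∈ Icc s₀ s₁ := interior_subset ht'
      have a := hslope t ht'
      have b := h.σ_pos t ht
      have d := hden t ht
      have e : σ t * p t ≤ K * (σ t * q t) / (S + (v t - v s₀) / X) ^ 2 := by
        rw [le_div_iff₀ (by positivity)]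
        nlinarith
      have f : K * X * (-(σ t * q t / X) / (S + (v t - v s₀) / X) ^ 2) =
          - (K * (σ t * q t) / (S + (v t - v s₀) / X) ^ 2) := by
        field_simp
      rw [f]
      linarith) h0 h1 hs
  simp only [sub_self, zero_div, add_zero] at key
  have k2 : 0 ≤ K * X * (S + (v s₁ - v s₀) / X)⁻¹ :=
    mul_nonneg (by positivity) (inv_nonneg.2 (hden _ h1).le)
  have k3 : K * X * S⁻¹ ≤ X ^ 48 * ε := by
    calc K * X * S⁻¹ = 25 / 16 * X ^ 6 * p s₀ ^ 2 * S ^ 3 / l ^ 2 := by rw [hK]; field_simp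
      _ ≤ 25 / 16 * X ^ 6 * (5 * X ^ 4 * E) ^ 2 * (2 * X ^ 11 * ε) ^ 3 / l ^ 2 := by gcongr
      _ = 312.5 * X ^ 47 * ε := by rw [hl]; field_simp; ring
      _ ≤ X * X ^ 47 * ε := by gcongr; linarith
      _ = _ := by ring
  linarith

/-- After the ingoing phase `u` varies little. -/
theorem outgoing_u (hB : Background U vI X RI G Gv R A A')
    (h : Ray U vI G Gv l (Icc s₀ s₁) σ u v p q) (hs : s₀ ≤ s₁) (hε : 0 < ε) (hl : l = ε * E)
    (hE : 0 < E) (hp : p s₀ ≤ 5 * X ^ 4 * E) (hR : R (u s₀, v s₀) ≤ 2 * X ^ 11 * ε)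
    (hRI : X ^ 40 * ε ≤ RI) :
    u s₁ - u s₀ ≤ 2 * X ^ 48 * ε := by
  have h0 : s₀ ∈ Icc s₀ s₁ := left_mem_Icc.2 hs
  have h1 : s₁ ∈ Icc s₀ s₁ := right_mem_Icc.2 hs
  have hX := hB.X_large
  have hX0 : 0 < X := by linarith
  rcases le_total (v s₁) (u s₀ + vI) with hv | hv
  · have := outgoing_u_slice hB h hs hε hl hE hp hR hv
    have : 0 ≤ X ^ 48 * ε := by positivity
    linarith
  have hd := h.mem _ h0
  rw [mem_dom] at hd
  obtain ⟨t, ht, hvt⟩ := intermediate_value_Icc hs h.cont_v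
    (show u s₀ + vI ∈ Icc (v s₀) (v s₁) from ⟨by linarith, hv⟩)
  have k1 := outgoing_u_slice hB (h.sub le_rfl ht.2) ht.1 hε hl hE hp hR hvt.le
  set S := R (u s₀, v s₀) with hS
  have hS0 : 0 < S := hB.R_pos (h.mem _ h0)
  have hp0 := h.p_pos _ h0
  have hl0 := h.l_pos
  have hRI0 := hB.RI_pos
  -- Near infinity `p RI² ≲ E ε²`, and `RI ≥ X⁴⁰ε` makes `p` small compared with `q`.
  have hslope : ∀ x ∈ Icc t s₁, 2 * p x ≤ q x := fun x hx => by
    have hx' : x ∈ Icc s₀ s₁ := ⟨ht.1.trans hx.1, hx.2⟩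
    have a := p_mul_sq_le_infinity hB (h.sub le_rfl hx'.2) hx'.1
      (hvt.symm.le.trans (h.mono_v ht hx' hx.1))
    have b := (q_bounds hB h hx').1
    have e2 := (hB.R_lt (h.mem _ hx')).le
    have hr0 := hB.R_pos (h.mem _ hx')
    have hq1 := h.q_pos _ hx'
    have hp1 := h.p_pos _ hx'
    have a' : p x * RI ^ 2 ≤ 50 * X ^ 30 * E * ε ^ 2 := by
      refine a.trans ?_
      calc 5 / 2 * X ^ 4 * (p s₀ * S ^ 2)
          ≤ 5 / 2 * X ^ 4 * (5 * X ^ 4 * E * (2 * X ^ 11 * ε) ^ 2) := by gcongr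
        _ = _ := by ring
    have b' : 4 * l ^ 2 ≤ X * (p x * q x * RI ^ 2) := b.trans (by gcongr)
    have c1 : 2 * p x * (4 * l ^ 2 * RI ^ 2) ≤ q x * (4 * l ^ 2 * RI ^ 2) := by
      calc 2 * p x * (4 * l ^ 2 * RI ^ 2)
          ≤ 2 * p x * (X * (p x * q x * RI ^ 2) * RI ^ 2) := by
            gcongr
        _ = 2 * X * q x * (p x * RI ^ 2) ^ 2 := by ring
        _ ≤ 2 * X * q x * (50 * X ^ 30 * E * ε ^ 2) ^ 2 := by gcongr
        _ = 1250 * X ^ 61 * q x * (4 * (ε * E) ^ 2 * ε ^ 2) := by ring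
        _ ≤ (X * X) * X ^ 61 * q x * (4 * (ε * E) ^ 2 * ε ^ 2) := by gcongr; nlinarith
        _ = X ^ 63 * q x * (4 * (ε * E) ^ 2 * ε ^ 2) := by ring
        _ ≤ X ^ 80 * q x * (4 * (ε * E) ^ 2 * ε ^ 2) := by
            gcongr
            · linarith
            · norm_num
        _ = q x * (4 * l ^ 2 * (X ^ 40 * ε) ^ 2) := by rw [hl]; ring
        _ ≤ _ := by gcongr
    exact le_of_mul_le_mul_right c1 (by positivity)
  have h2 := h.sub ht.1 le_rfl
  -- From `du ≤ dv/2` and the confinement `v s₁ < u s₁ + vI`, where `v t = u s₀ + vI`, one gets `u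
  -- s₁ - u t ≤ (u s₁ - u s₀)/2`; this at most doubles the displacement up to `t`.
  have key := antitoneOn_Icc_of_hasDerivWithinAt (f := fun t => u t - v t / 2)
    (fun x hx => (h2.deriv_u x hx).sub ((h2.deriv_v x hx).div_const 2))
    (fun x hx => by
      have b := h2.σ_pos x hx
      have := hslope x hx
      nlinarith) (left_mem_Icc.2 ht.2) (right_mem_Icc.2 ht.2) ht.2
  simp only at key
  have hd1 := h.mem _ h1
  rw [mem_dom] at hd1
  linarith

end Ray

/-! ### Closest approach, growth of `q`, and the whole passage -/

namespace Ray

variable {U vI X RI l s₀ s₁ E ε : ℝ} {G Gv R : ℝ × ℝ → ℝ} {A A' : ℝ → ℝ} {σ u v p q : ℝ → ℝ}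
  {J : Set ℝ}

/-- If `q > X² p`, then `v/X - X u` increases strictly at `s₁`; by the Lipschitz bounds for `R` its
increments bound those of `R` from below, so `R` was smaller just before. No derivative of `R` is
used. -/
theorem q_le_of_isMinOn (hB : Background U vI X RI G Gv R A A')
    (h : Ray U vI G Gv l (Icc s₀ s₁) σ u v p q) (hs : s₀ < s₁)
    (hmin : ∀ t ∈ Icc s₀ s₁, R (u s₁, v s₁) ≤ R (u t, v t)) : q s₁ ≤ X ^ 2 * p s₁ := by
  have h1 : s₁ ∈ Icc s₀ s₁ := right_mem_Icc.2 hs.le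
  have hX := hB.X_large
  have hX0 : 0 < X := by linarith
  by_contra! hcon
  have hd : HasDerivWithinAt (fun x => v x / X - X * u x) (σ s₁ * q s₁ / X - X * (σ s₁ * p s₁))
      (Icc s₀ s₁) s₁ := ((h.deriv_v _ h1).div_const X).sub ((h.deriv_u _ h1).const_mul X)
  have hpos : 0 < σ s₁ * q s₁ / X - X * (σ s₁ * p s₁) := by
    have hσ := h.σ_pos _ h1
    have : X * (σ s₁ * p s₁) < σ s₁ * q s₁ / X := by
      rw [lt_div_iff₀ hX0]
      nlinarith
    linarith
  have hd' := hd.mono Ico_subset_Icc_self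
  rw [hasDerivWithinAt_iff_tendsto_slope' (by simp)] at hd'
  have e1 := hd'.eventually (lt_mem_nhds hpos)
  have hdm := h.mem _ h1
  have hdm' := mem_dom.1 hdm
  -- The earlier time must be close enough to `s₁` for the corner `(u s₁, v x)` to lie off the axis.
  have e2 := ((h.cont_v _ h1).mono Ico_subset_Icc_self).eventually (lt_mem_nhds hdm'.2.2.1)
  have hne : (𝓝[Ico s₀ s₁] s₁).NeBot := by
    rw [← mem_closure_iff_nhdsWithin_neBot, closure_Ico hs.ne]
    exact h1
  obtain ⟨x, hx1, hx2, hx⟩ := (e1.and (e2.and self_mem_nhdsWithin)).exists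
  have hx' : x ∈ Icc s₀ s₁ := Ico_subset_Icc_self hx
  have hφ : v x / X - X * u x < v s₁ / X - X * u s₁ := by
    rw [slope_def_field] at hx1
    have hxs : x - s₁ < 0 := by linarith [hx.2]
    by_contra! hge
    exact absurd hx1 (not_lt.2 (div_nonpos_of_nonneg_of_nonpos (by linarith) hxs.le))
  have hvx := h.mono_v hx' h1 hx'.2
  have hux := h.mono_u hx' h1 hx'.2
  have hm : (u s₁, v x) ∈ dom U vI := ⟨hdm'.1, hdm'.2.1, hx2, by simp only; linarith⟩
  have a := (hB.R_u _ _ _ (h.mem _ hx') hm hux).2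
  have b := (hB.R_v _ _ _ hm hdm hvx).1
  have c := hmin x hx'
  rw [sub_div] at b
  linarith

/-- The radius is bounded from below along a geodesic. -/
theorem R_lower (hB : Background U vI X RI G Gv R A A')
    (h : Ray U vI G Gv l (Icc s₀ s₁) σ u v p q) (hs : s₀ ≤ s₁) (hε : 0 < ε) (hl : l = ε * E)
    (hE : 0 < E) (hp : p s₀ ≤ 2 * E) (hR : ε ≤ X ^ 6 * R (u s₀, v s₀)) :
    ε ≤ X ^ 6 * R (u s₁, v s₁) := by
  have h0 : s₀ ∈ Icc s₀ s₁ := left_mem_Icc.2 hs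
  have h1 : s₁ ∈ Icc s₀ s₁ := right_mem_Icc.2 hs
  have hX := hB.X_large
  have hX0 : 0 < X := by linarith
  have hc : ContinuousOn (fun t => R (u t, v t)) (Icc s₀ s₁) :=
    hB.R_cont.comp (h.cont_u.prodMk h.cont_v) h.mem
  -- At a minimum after `s₀`, `q ≤ X² p` and `p ≤ 5 X⁴ E` give `4 l² ≤ X p q R² ≤ 25 X¹¹ E² R²`.
  obtain ⟨t, ht, hmin⟩ := isCompact_Icc.exists_isMinOn ⟨s₀, h0⟩ hc
  have hmin' : ∀ x ∈ Icc s₀ s₁, R (u t, v t) ≤ R (u x, v x) := fun x hx => hmin hx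
  suffices hT : ε ≤ X ^ 6 * R (u t, v t) by
    refine hT.trans ?_
    gcongr
    exact hmin' _ h1
  rcases ht.1.eq_or_lt with heq | hlt
  · rwa [← heq]
  have hq := q_le_of_isMinOn hB (h.sub le_rfl ht.2) hlt
    (fun x hx => hmin' x ⟨hx.1, hx.2.trans ht.2⟩)
  have hpt := (p_mul_sq_le hB (h.sub le_rfl ht.2) ht.1).2
  have b := (q_bounds hB h ht).1
  have hp0 := h.p_pos _ ht
  have hr := hB.R_pos (h.mem _ ht)
  have hpE : p t ≤ 5 * X ^ 4 * E := by
    refine hpt.trans ?_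
    calc 5 / 2 * X ^ 4 * p s₀ ≤ 5 / 2 * X ^ 4 * (2 * E) := by gcongr
      _ = _ := by ring
  have c1 : ε ^ 2 * (4 * E ^ 2) ≤ (X ^ 6 * R (u t, v t)) ^ 2 * (4 * E ^ 2) := by
    calc ε ^ 2 * (4 * E ^ 2) = 4 * l ^ 2 := by rw [hl]; ring
      _ ≤ X * (p t * q t * R (u t, v t) ^ 2) := b
      _ ≤ X * (p t * (X ^ 2 * p t) * R (u t, v t) ^ 2) := by gcongr
      _ = X ^ 3 * p t ^ 2 * R (u t, v t) ^ 2 := by ring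
      _ ≤ X ^ 3 * (5 * X ^ 4 * E) ^ 2 * R (u t, v t) ^ 2 := by gcongr
      _ = 25 / 4 * (X ^ 11 * R (u t, v t) ^ 2) * (4 * E ^ 2) := by ring
      _ ≤ X * (X ^ 11 * R (u t, v t) ^ 2) * (4 * E ^ 2) := by gcongr; linarith
      _ = _ := by ring
  exact (sq_le_sq₀ hε.le (by positivity)).1 (le_of_mul_le_mul_right c1 (by positivity))

/-- Dividing the null relation by the lower bound for `p` on the final cone cancels `G (u s₁, v s₁)`
and leaves `q s₁ ≤ q s₀ exp (G (u s₁, v s₀) - G (u s₀, v s₀))`. The two radii are comparable because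
`v s₀ - u` at most halves. -/
theorem q_le_of_short (hB : Background U vI X RI G Gv R A A')
    (h : Ray U vI G Gv l (Icc s₀ s₁) σ u v p q) (hs : s₀ ≤ s₁)
    (hu : u s₁ - u s₀ ≤ (v s₀ - u s₀) / 2) : q s₁ ≤ X ^ 7 * q s₀ := by
  have h0 : s₀ ∈ Icc s₀ s₁ := left_mem_Icc.2 hs
  have h1 : s₁ ∈ Icc s₀ s₁ := right_mem_Icc.2 hs
  have hX := hB.X_large
  have hX0 : 0 < X := by linarith
  have hd0 := h.mem _ h0
  have hd1 := h.mem _ h1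
  have hd0' := mem_dom.1 hd0
  have hd1' := mem_dom.1 hd1
  have hv01 := h.mono_v h0 h1 hs
  have hm : (u s₁, v s₀) ∈ dom U vI :=
    ⟨hd1'.1, hd1'.2.1, by simp only; linarith, by simp only; linarith⟩
  have a := le_p_of_slice hB h hs (by linarith)
  have b := hB.exp_sub_mul_le hm hd0
  have hp0 := h.p_pos _ h0
  have hp1 := h.p_pos _ h1
  have hq0 := h.q_pos _ h0
  have hq1 := h.q_pos _ h1
  have hρ := hB.R_pos hm
  have hr := hB.R_pos hd0
  have e1 : R (u s₀, v s₀) ≤ 2 * X ^ 2 * R (u s₁, v s₀) := by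
    have x1 := (hB.R_axis _ _ hd0).2
    have x2 := (hB.R_axis _ _ hm).1
    rw [div_le_iff₀ hX0] at x2
    nlinarith
  have e2 : Real.exp (G (u s₁, v s₀) - G (u s₀, v s₀)) ≤ X ^ 7 := by
    have : Real.exp (G (u s₁, v s₀) - G (u s₀, v s₀)) * R (u s₁, v s₀) ^ 2 ≤
        X ^ 7 * R (u s₁, v s₀) ^ 2 := by
      refine b.trans ?_
      calc 5 / 2 * X ^ 2 * R (u s₀, v s₀) ^ 2
          ≤ 5 / 2 * X ^ 2 * (2 * X ^ 2 * R (u s₁, v s₀)) ^ 2 := by gcongr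
        _ = 10 * X ^ 6 * R (u s₁, v s₀) ^ 2 := by ring
        _ ≤ X * X ^ 6 * R (u s₁, v s₀) ^ 2 := by gcongr; linarith
        _ = _ := by ring
    exact le_of_mul_le_mul_right this (by positivity)
  have n0 := h.null _ h0
  have n1 := h.null _ h1
  have c1 : q s₁ * (p s₀ * Real.exp (G (u s₁, v s₁))) ≤
      Real.exp (G (u s₁, v s₀) - G (u s₀, v s₀)) * q s₀ * (p s₀ * Real.exp (G (u s₁, v s₁))) := by
    have x : p s₀ * Real.exp (G (u s₁, v s₁)) ≤ p s₁ * Real.exp (G (u s₁, v s₀)) := by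
      rw [Real.exp_sub, ← mul_div_assoc, div_le_iff₀ (Real.exp_pos _)] at a
      exact a
    calc q s₁ * (p s₀ * Real.exp (G (u s₁, v s₁)))
        ≤ q s₁ * (p s₁ * Real.exp (G (u s₁, v s₀))) := by gcongr
      _ = p s₁ * q s₁ * Real.exp (G (u s₁, v s₀)) := by ring
      _ = l ^ 2 * Real.exp (G (u s₁, v s₁)) * Real.exp (G (u s₁, v s₀)) := by rw [n1]
      _ = Real.exp (G (u s₁, v s₀) - G (u s₀, v s₀)) * (l ^ 2 * Real.exp (G (u s₀, v s₀))) *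
          Real.exp (G (u s₁, v s₁)) := by
          rw [Real.exp_sub]; field_simp
      _ = Real.exp (G (u s₁, v s₀) - G (u s₀, v s₀)) * (p s₀ * q s₀) *
          Real.exp (G (u s₁, v s₁)) := by rw [n0]
      _ = _ := by ring
  have c2 := le_of_mul_le_mul_right c1 (by positivity)
  refine c2.trans ?_
  gcongr

/-- Iteration of `q_le_of_short` over steps of length `η` in `u`, each at most half the distance to
the axis. -/
theorem q_le_pow (hB : Background U vI X RI G Gv R A A') {η : ℝ} (hη : 0 < η) (n : ℕ) :
    ∀ s₀, s₀ ≤ s₁ → Ray U vI G Gv l (Icc s₀ s₁) σ u v p q →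
    (∀ t ∈ Icc s₀ s₁, 2 * η ≤ v t - u t) → u s₁ - u s₀ ≤ n * η →
    q s₁ ≤ X ^ (7 * (n + 1)) * q s₀ := by
  have hX := hB.X_large
  induction n with
  | zero =>
    intro s₀ hs h hd hu
    have := hd _ (left_mem_Icc.2 hs)
    refine (q_le_of_short hB h hs ?_).trans (by simp)
    simp only [Nat.cast_zero, zero_mul] at hu
    linarith
  | succ n ih =>
    intro s₀ hs h hd hu
    have hd0 := hd _ (left_mem_Icc.2 hs)
    have hq0 := h.q_pos _ (left_mem_Icc.2 hs)
    rcases le_total (u s₁) (u s₀ + η) with hc | hc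
    · refine (q_le_of_short hB h hs (by linarith)).trans ?_
      gcongr
      · linarith
      · omega
    · obtain ⟨t, ht, hut⟩ := intermediate_value_Icc hs h.cont_u
        (show u s₀ + η ∈ Icc (u s₀) (u s₁) from ⟨by linarith, hc⟩)
      have a := q_le_of_short hB (h.sub le_rfl ht.2) ht.1 (by linarith)
      have b := ih t ht.2 (h.sub ht.1 le_rfl) (fun x hx => hd x ⟨ht.1.trans hx.1, hx.2⟩)
        (by push_cast at hu; linarith)
      calc q s₁ ≤ X ^ (7 * (n + 1)) * q t := b
        _ ≤ X ^ (7 * (n + 1)) * (X ^ 7 * q s₀) := by gcongr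
        _ = _ := by ring

/-- One passage of a geodesic of small angular momentum through the centre. -/
theorem passage (hB : Background U vI X RI G Gv R A A')
    (h : Ray U vI G Gv l (Icc s₀ s₁) σ u v p q) (hs : s₀ ≤ s₁) (hε : 0 < ε) (hl : l = ε * E)
    (hE : E = (p s₀ + q s₀) / 2) (hpq : q s₀ ≤ p s₀) (hRI : X ^ 40 * ε ≤ RI)
    (hR : X ^ 20 * ε ≤ R (u s₀, v s₀)) :
    p s₁ ≤ 5 * X ^ 4 * E ∧ q s₁ ≤ Real.exp (X ^ 60) * E ∧ ε ≤ X ^ 6 * R (u s₁, v s₁) ∧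
    ((u s₁ ≤ v s₀ - X ^ 10 * ε ∧ v s₁ ≤ v s₀ + ε ∧ v s₁ - v s₀ ≤ (u s₁ - u s₀) / 2 ∧
        E ≤ X ^ 3 * p s₁) ∨
      (v s₀ - X ^ 10 * ε ≤ u s₁ ∧ u s₁ ≤ v s₀ + X ^ 49 * ε ∧ E ≤ X ^ 32 * q s₁)) := by
  have h0 : s₀ ∈ Icc s₀ s₁ := left_mem_Icc.2 hs
  have h1 : s₁ ∈ Icc s₀ s₁ := right_mem_Icc.2 hs
  have hX := hB.X_large
  have hX0 : 0 < X := by linarith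
  have hp0 := h.p_pos _ h0
  have hq0 := h.q_pos _ h0
  have hE0 : 0 < E := by linarith
  have hpE : E ≤ p s₀ := by linarith
  have hp2 : p s₀ ≤ 2 * E := by linarith
  have hpt : ∀ t ∈ Icc s₀ s₁, p t ≤ 5 * X ^ 4 * E := fun t ht => by
    refine (p_mul_sq_le hB (h.sub le_rfl ht.2) ht.1).2.trans ?_
    calc 5 / 2 * X ^ 4 * p s₀ ≤ 5 / 2 * X ^ 4 * (2 * E) := by gcongr
      _ = _ := by ring
  have hRt : ∀ t ∈ Icc s₀ s₁, ε ≤ X ^ 6 * R (u t, v t) := fun t ht => by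
    refine R_lower hB (h.sub le_rfl ht.2) ht.1 hε hl hE0 hp2 ?_
    have hR0 := hB.R_pos (h.mem _ h0)
    have x1 : (1 : ℝ) ≤ X ^ 20 := one_le_pow₀ (by linarith)
    have x2 : (1 : ℝ) ≤ X ^ 6 := one_le_pow₀ (by linarith)
    nlinarith
  have hexp : 5 * X ^ 4 ≤ Real.exp (X ^ 60) := by
    calc 5 * X ^ 4 ≤ X * X ^ 4 := by gcongr; linarith
      _ = X ^ 5 := by ring
      _ ≤ X ^ 60 := pow_le_pow_right₀ (by linarith) (by norm_num)
      _ ≤ X ^ 60 + 1 := by linarith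
      _ ≤ _ := Real.add_one_le_exp _
  rcases le_total (u s₁) (v s₀ - X ^ 10 * ε) with hu | hu
  · obtain ⟨a, b, c, d⟩ := ingoing hB h hs hε hl hE0 hpE hu
    refine ⟨hpt _ h1, ?_, hRt _ h1, Or.inl ⟨hu, a, b, c⟩⟩
    refine d.trans ((hpt _ h1).trans ?_)
    gcongr
  · have hu0 : u s₀ ≤ v s₀ - X ^ 10 * ε := by
      have x1 := (hB.R_axis _ _ (h.mem _ h0)).2
      have x2 : X * (X ^ 10 * ε) ≤ X * (v s₀ - u s₀) := by
        calc X * (X ^ 10 * ε) = X ^ 11 * ε := by ring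
          _ ≤ X ^ 20 * ε := by
            gcongr
            · linarith
            · norm_num
          _ ≤ _ := hR.trans x1
      have := le_of_mul_le_mul_left x2 hX0
      linarith
    -- The ray is cut where the ingoing estimate ends; there `v - u ≤ 2 X¹⁰ε`, hence `R ≤ 2 X¹¹ε`,
    -- as the outgoing estimates require.
    obtain ⟨t, ht, hut⟩ := intermediate_value_Icc hs h.cont_u
        (show v s₀ - X ^ 10 * ε ∈ Icc (u s₀) (u s₁) from ⟨hu0, hu⟩)
    obtain ⟨a, b, c, d⟩ := ingoing hB (h.sub le_rfl ht.2) ht.1 hε hl hE0 hpE hut.le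
    have h2 := h.sub ht.1 le_rfl
    have hRt2 : R (u t, v t) ≤ 2 * X ^ 11 * ε := by
      have x1 := (hB.R_axis _ _ (h.mem _ ht)).2
      refine x1.trans ?_
      have x2 : (1 : ℝ) ≤ X ^ 10 := one_le_pow₀ (by linarith)
      calc X * (v t - u t) ≤ X * (X ^ 10 * ε + X ^ 10 * ε) := by
            gcongr
            nlinarith
        _ = _ := by ring
    have o1 := outgoing_q hB h2 ht.2 hε hl hE0 (hpt t ht) hRt2
    have o2 := outgoing_u hB h2 ht.2 hε hl hE0 (hpt t ht) hRt2 hRI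
    refine ⟨hpt _ h1, ?_, hRt _ h1, Or.inr ⟨hu, ?_, o1⟩⟩
    -- `R ≥ X⁻⁶ε` gives `v - u ≥ X⁻⁷ε = 2η`, and `u` moves by at most `2 X⁴⁸ε = 4 X⁵⁵η`.
    · set n := ⌈4 * X ^ 55⌉₊ with hn
      have hn1 : 4 * X ^ 55 ≤ n := Nat.le_ceil _
      have hn2 : (n : ℝ) < 4 * X ^ 55 + 1 := Nat.ceil_lt_add_one (by positivity)
      have hη : 0 < ε / (2 * X ^ 7) := by positivity
      have st := q_le_pow hB hη n t ht.2 h2 (fun x hx => by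
          have hx' : x ∈ Icc s₀ s₁ := ⟨ht.1.trans hx.1, hx.2⟩
          have x1 := (hB.R_axis _ _ (h.mem _ hx')).2
          have x2 := hRt x hx'
          have : 2 * (ε / (2 * X ^ 7)) = ε / X ^ 7 := by field_simp
          rw [this, div_le_iff₀ (by positivity)]
          calc ε ≤ X ^ 6 * R (u x, v x) := x2
            _ ≤ X ^ 6 * (X * (v x - u x)) := by gcongr
            _ = _ := by ring) (by
          refine o2.trans ?_
          calc 2 * X ^ 48 * ε = 4 * X ^ 55 * (ε / (2 * X ^ 7)) := by field_simp; ring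
            _ ≤ _ := by gcongr)
      have hqt : q t ≤ X ^ 5 * E := by
        refine d.trans ((hpt t ht).trans ?_)
        calc 5 * X ^ 4 * E ≤ X * X ^ 4 * E := by gcongr; linarith
          _ = _ := by ring
      calc q s₁ ≤ X ^ (7 * (n + 1)) * q t := st
        _ ≤ X ^ (7 * (n + 1)) * (X ^ 5 * E) := by gcongr
        _ = X ^ (7 * n + 12) * E := by ring
        _ ≤ Real.exp X ^ (7 * n + 12) * E := by
            gcongr
            linarith [Real.add_one_le_exp X]
        _ = Real.exp ((7 * n + 12) * X) * E := by
            rw [← Real.exp_nat_mul]; push_cast; rfl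
        _ ≤ Real.exp (X ^ 60) * E := by
            gcongr
            have y1 : (1 : ℝ) ≤ X ^ 55 := one_le_pow₀ (by linarith)
            calc (7 * n + 12) * X ≤ (X * X ^ 55) * X := by
                  gcongr
                  nlinarith
              _ = X ^ 57 := by ring
              _ ≤ X ^ 60 := pow_le_pow_right₀ (by linarith) (by norm_num)
    · have : 2 * X ^ 48 * ε ≤ X ^ 49 * ε := by
        calc 2 * X ^ 48 * ε ≤ X * X ^ 48 * ε := by gcongr; linarith
          _ = _ := by ring
      have : 0 < X ^ 10 * ε := by positivity
      linarith

end Ray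

/-- `F` has the partial derivatives `∂_u F = a`, `∂_v F = b` at `p` relative to `D`. -/
def HasPartials (D : Set (ℝ × ℝ)) (F : ℝ × ℝ → ℝ) (a b : ℝ) (p : ℝ × ℝ) : Prop :=
  HasFDerivWithinAt F
    (a • ContinuousLinearMap.fst ℝ ℝ ℝ + b • ContinuousLinearMap.snd ℝ ℝ ℝ) D p

/-! ### Rules for partial derivatives relative to a set -/

namespace HasPartials

variable {D D' : Set (ℝ × ℝ)} {F H : ℝ × ℝ → ℝ} {a b c d : ℝ} {p : ℝ × ℝ}

theorem of_hasFDerivWithinAt {L : ℝ × ℝ →L[ℝ] ℝ} (h : HasFDerivWithinAt F L D p) :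
    HasPartials D F (L (1, 0)) (L (0, 1)) p := by
  have : L = L (1, 0) • ContinuousLinearMap.fst ℝ ℝ ℝ +
      L (0, 1) • ContinuousLinearMap.snd ℝ ℝ ℝ := by
    ext <;> simp
  unfold HasPartials
  rwa [← this]

theorem of_apply_eq {L : ℝ × ℝ →L[ℝ] ℝ} (h : HasFDerivWithinAt F L D p) (ha : L (1, 0) = a)
    (hb : L (0, 1) = b) : HasPartials D F a b p :=
  ha ▸ hb ▸ of_hasFDerivWithinAt h

theorem of_differentiable (h : DifferentiableWithinAt ℝ F D p) :
    HasPartials D F (dU D F p) (dV D F p) p :=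
  of_hasFDerivWithinAt h.hasFDerivWithinAt

theorem congr_partials {a' b' : ℝ} (h : HasPartials D F a b p) (ha : a = a') (hb : b = b') :
    HasPartials D F a' b' p :=
  ha ▸ hb ▸ h

theorem dU_eq (h : HasPartials D F a b p) (hD : UniqueDiffWithinAt ℝ D p) : dU D F p = a := by
  rw [dU, HasFDerivWithinAt.fderivWithin h hD]; simp

theorem dV_eq (h : HasPartials D F a b p) (hD : UniqueDiffWithinAt ℝ D p) : dV D F p = b := by
  rw [dV, HasFDerivWithinAt.fderivWithin h hD]; simp

theorem mono (h : HasPartials D F a b p) (hD : D' ⊆ D) : HasPartials D' F a b p :=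
  HasFDerivWithinAt.mono h hD

theorem congr (h : HasPartials D F a b p) (hH : ∀ x ∈ D, H x = F x) (hp : p ∈ D) :
    HasPartials D H a b p :=
  HasFDerivWithinAt.congr h hH (hH p hp)

theorem add (h : HasPartials D F a b p) (h' : HasPartials D H c d p) :
    HasPartials D (fun x => F x + H x) (a + c) (b + d) p :=
  of_apply_eq (HasFDerivWithinAt.add h h') (by simp) (by simp)

theorem sub (h : HasPartials D F a b p) (h' : HasPartials D H c d p) :
    HasPartials D (fun x => F x - H x) (a - c) (b - d) p :=
  of_apply_eq (HasFDerivWithinAt.sub h h') (by simp) (by simp)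

theorem mul (h : HasPartials D F a b p) (h' : HasPartials D H c d p) :
    HasPartials D (fun x => F x * H x) (a * H p + F p * c) (b * H p + F p * d) p :=
  of_apply_eq (HasFDerivWithinAt.mul h h') (by simp [mul_comm, add_comm]) (by simp [mul_comm, add_comm])

theorem comp {φ : ℝ → ℝ} {m : ℝ} (hφ : HasDerivAt φ m (F p)) (h : HasPartials D F a b p) :
    HasPartials D (fun x => φ (F x)) (m * a) (m * b) p :=
  of_apply_eq (hφ.comp_hasFDerivWithinAt p h) (by simp) (by simp)

theorem const_mul (h : HasPartials D F a b p) (m : ℝ) :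
    HasPartials D (fun x => m * F x) (m * a) (m * b) p :=
  of_apply_eq (HasFDerivWithinAt.const_mul h m) (by simp) (by simp)

theorem const (m : ℝ) : HasPartials D (fun _ => m) 0 0 p :=
  of_apply_eq (hasFDerivWithinAt_const m p D) (by simp) (by simp)

theorem pow (h : HasPartials D F a b p) (n : ℕ) :
    HasPartials D (fun x => F x ^ n) (n * F p ^ (n - 1) * a) (n * F p ^ (n - 1) * b) p :=
  h.comp (hasDerivAt_pow n _)

theorem inv (h : HasPartials D F a b p) (h0 : F p ≠ 0) :
    HasPartials D (fun x => (F x)⁻¹) (-(F p ^ 2)⁻¹ * a) (-(F p ^ 2)⁻¹ * b) p :=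
  h.comp (hasDerivAt_inv h0)

theorem log (h : HasPartials D F a b p) (h0 : F p ≠ 0) :
    HasPartials D (fun x => Real.log (F x)) ((F p)⁻¹ * a) ((F p)⁻¹ * b) p :=
  h.comp (Real.hasDerivAt_log h0)

theorem slice_v {u v : ℝ} (h : HasPartials D F a b (u, v)) {s : Set ℝ} (hs : ∀ y ∈ s, (u, y) ∈ D) :
    HasDerivWithinAt (fun y => F (u, y)) b s v := by
  have h1 : HasDerivWithinAt (fun y : ℝ => ((u, y) : ℝ × ℝ)) (0, 1) s v :=
    (hasDerivWithinAt_const v s u).prodMk (hasDerivWithinAt_id v s)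
  have h2 := HasFDerivWithinAt.comp_hasDerivWithinAt (f := fun y : ℝ => ((u, y) : ℝ × ℝ)) v h h1 hs
  have e : (a • ContinuousLinearMap.fst ℝ ℝ ℝ + b • ContinuousLinearMap.snd ℝ ℝ ℝ) (0, 1) = b := by
    simp
  rw [e] at h2
  exact h2

theorem slice_u {u v : ℝ} (h : HasPartials D F a b (u, v)) {s : Set ℝ} (hs : ∀ y ∈ s, (y, v) ∈ D) :
    HasDerivWithinAt (fun y => F (y, v)) a s u := by
  have h1 : HasDerivWithinAt (fun y : ℝ => ((y, v) : ℝ × ℝ)) (1, 0) s u :=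
    (hasDerivWithinAt_id u s).prodMk (hasDerivWithinAt_const u s v)
  have h2 := HasFDerivWithinAt.comp_hasDerivWithinAt (f := fun y : ℝ => ((y, v) : ℝ × ℝ)) u h h1 hs
  have e : (a • ContinuousLinearMap.fst ℝ ℝ ℝ + b • ContinuousLinearMap.snd ℝ ℝ ℝ) (1, 0) = a := by
    simp
  rw [e] at h2
  exact h2

end HasPartials

/-! ### Calculus on convex domains -/

section Convex

variable {D : Set (ℝ × ℝ)} {F : ℝ × ℝ → ℝ}

theorem contDiffOn_fderivWithin_apply (hD : UniqueDiffOn ℝ D) (hF : ContDiffOn ℝ ∞ F D)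
    (e : ℝ × ℝ) : ContDiffOn ℝ ∞ (fun p => fderivWithin ℝ F D p e) D :=
  (hF.fderivWithin hD (by simp)).clm_apply contDiffOn_const

theorem contDiffOn_dU (hD : UniqueDiffOn ℝ D) (hF : ContDiffOn ℝ ∞ F D) :
    ContDiffOn ℝ ∞ (dU D F) D := contDiffOn_fderivWithin_apply hD hF _

theorem contDiffOn_dV (hD : UniqueDiffOn ℝ D) (hF : ContDiffOn ℝ ∞ F D) :
    ContDiffOn ℝ ∞ (dV D F) D := contDiffOn_fderivWithin_apply hD hF _

theorem hasPartials_of_contDiffOn (hF : ContDiffOn ℝ ∞ F D) {p : ℝ × ℝ} (hp : p ∈ D) :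
    HasPartials D F (dU D F p) (dV D F p) p :=
  .of_differentiable (hF.differentiableOn (by simp) p hp)

/-- Symmetry of the second derivative persists at boundary points, since a convex set with interior
lies in the closure of its interior. -/
theorem dV_dU_comm (hc : Convex ℝ D) (hi : (interior D).Nonempty) (hF : ContDiffOn ℝ ∞ F D)
    {p : ℝ × ℝ} (hp : p ∈ D) : dV D (dU D F) p = dU D (dV D F) p := by
  have hD := uniqueDiffOn_convex hc hi
  have hcl : p ∈ closure (interior D) := by
    rw [hc.closure_interior_eq_closure_of_nonempty_interior hi]
    exact subset_closure hp
  have hsym := (hF p hp).isSymmSndFDerivWithinAt (by simpa using ENat.LEInfty.out) hD hcl hp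
  have hd : DifferentiableWithinAt ℝ (fderivWithin ℝ F D) D p :=
    (hF.fderivWithin (m := ∞) hD (by simp)).differentiableOn (by simp) p hp
  have key : ∀ e e' : ℝ × ℝ, fderivWithin ℝ (fun q => fderivWithin ℝ F D q e) D p e' =
      fderivWithin ℝ (fderivWithin ℝ F D) D p e' e := fun e e' => by
    rw [fderivWithin_clm_apply (hD p hp) hd (differentiableWithinAt_const e)]
    simp
  exact (key (1, 0) (0, 1)).trans ((hsym.eq _ _).trans (key (0, 1) (1, 0)).symm)

end Convex

/-! ### The domain, its axis and conformal infinity -/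

section Domains

variable {U vI : ℝ}

theorem mem_domInfinity {u v : ℝ} :
    (u, v) ∈ domInfinity U vI ↔ 0 ≤ u ∧ u < U ∧ u < v ∧ v ≤ u + vI := Iff.rfl

theorem dom_subset_domInfinity : dom U vI ⊆ domInfinity U vI :=
  fun _ hp => ⟨hp.1, hp.2.1, hp.2.2.1, hp.2.2.2.le⟩

theorem dom_subset_domAxis : dom U vI ⊆ domAxis U vI :=
  fun _ hp => ⟨hp.1, hp.2.1, hp.2.2.1.le, hp.2.2.2⟩

theorem interior_dom_nonempty (hU : 0 < U) (hv : 0 < vI) : (interior (dom U vI)).Nonempty := by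
  refine ⟨(U / 2, U / 2 + vI / 2), mem_interior.2
    ⟨{p | 0 < p.1 ∧ p.1 < U ∧ p.1 < p.2 ∧ p.2 < p.1 + vI},
      fun p hp => ⟨hp.1.le, hp.2.1, hp.2.2.1, hp.2.2.2⟩, ?_, ?_⟩⟩
  · exact (isOpen_lt continuous_const continuous_fst).inter
      ((isOpen_lt continuous_fst continuous_const).inter
        ((isOpen_lt continuous_fst continuous_snd).inter
          (isOpen_lt continuous_snd (continuous_fst.add continuous_const))))
  · exact ⟨by simp only; linarith, by simp only; linarith, by simp only; linarith,
      by simp only; linarith⟩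

theorem convex_dom : Convex ℝ (dom U vI) := by
  rintro ⟨u, v⟩ h ⟨u', v'⟩ h' a b ha hb hab
  rw [mem_dom] at h h'
  have e : a • (u, v) + b • (u', v') = (a * u + b * u', a * v + b * v') := rfl
  obtain rfl : b = 1 - a := by linarith
  rw [e, mem_dom]
  have key : ∀ x y : ℝ, 0 < x → 0 < y → 0 < a * x + (1 - a) * y := fun x y hx hy => by
    rcases ha.eq_or_lt with rfl | h0
    · linarith
    · nlinarith [mul_pos h0 hx]
  have k1 := key (U - u) (U - u') (by linarith) (by linarith)
  have k2 := key (v - u) (v' - u') (by linarith) (by linarith)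
  have k3 := key (u + vI - v) (u' + vI - v') (by linarith) (by linarith)
  have k4 := mul_nonneg ha h.1
  have k5 := mul_nonneg hb h'.1
  exact ⟨by linarith, by linarith, by linarith, by linarith⟩

theorem convex_domInfinity : Convex ℝ (domInfinity U vI) := by
  rintro ⟨u, v⟩ h ⟨u', v'⟩ h' a b ha hb hab
  rw [mem_domInfinity] at h h'
  have e : a • (u, v) + b • (u', v') = (a * u + b * u', a * v + b * v') := rfl
  obtain rfl : b = 1 - a := by linarith
  rw [e, mem_domInfinity]
  have key : ∀ x y : ℝ, 0 < x → 0 < y → 0 < a * x + (1 - a) * y := fun x y hx hy => by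
    rcases ha.eq_or_lt with rfl | h0
    · linarith
    · nlinarith [mul_pos h0 hx]
  have k1 := key (U - u) (U - u') (by linarith) (by linarith)
  have k2 := key (v - u) (v' - u') (by linarith) (by linarith)
  have k3 := mul_nonneg ha (show 0 ≤ u + vI - v by linarith)
  have k3' := mul_nonneg hb (show 0 ≤ u' + vI - v' by linarith)
  have k4 := mul_nonneg ha h.1
  have k5 := mul_nonneg hb h'.1
  exact ⟨by linarith, by linarith, by linarith, by linarith⟩

theorem interior_domInfinity_nonempty (hU : 0 < U) (hv : 0 < vI) :
    (interior (domInfinity U vI)).Nonempty :=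
  (interior_dom_nonempty hU hv).mono (interior_mono dom_subset_domInfinity)

theorem uniqueDiffOn_dom (hU : 0 < U) (hv : 0 < vI) : UniqueDiffOn ℝ (dom U vI) :=
  uniqueDiffOn_convex convex_dom (interior_dom_nonempty hU hv)

theorem uniqueDiffOn_domInfinity (hU : 0 < U) (hv : 0 < vI) : UniqueDiffOn ℝ (domInfinity U vI) :=
  uniqueDiffOn_convex convex_domInfinity (interior_domInfinity_nonempty hU hv)

theorem tendsto_infinity_slice {u : ℝ} (h0 : 0 ≤ u) (hU : u < U) (hv : 0 < vI) :
    Tendsto (fun y => ((u, y) : ℝ × ℝ)) (𝓝[<] (u + vI)) (𝓝[dom U vI] (u, u + vI)) := by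
  refine tendsto_nhdsWithin_iff.2 ⟨?_, ?_⟩
  · exact (Continuous.tendsto (by fun_prop) _).mono_left nhdsWithin_le_nhds
  · filter_upwards [Ioo_mem_nhdsLT (show u < u + vI by linarith)] with y hy
    exact ⟨h0, hU, hy.1, hy.2⟩

theorem tendsto_axis_slice {u : ℝ} (h0 : 0 ≤ u) (hU : u < U) (hv : 0 < vI) :
    Tendsto (fun y => ((u, y) : ℝ × ℝ)) (𝓝[>] u) (𝓝[dom U vI] (u, u)) := by
  refine tendsto_nhdsWithin_iff.2 ⟨?_, ?_⟩
  · exact (Continuous.tendsto (by fun_prop) _).mono_left nhdsWithin_le_nhds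
  · filter_upwards [Ioo_mem_nhdsGT (show u < u + vI by linarith)] with y hy
    exact ⟨h0, hU, hy.1, hy.2⟩

theorem domInfinity_subset_closure_dom (hv : 0 < vI) : domInfinity U vI ⊆ closure (dom U vI) := by
  rintro ⟨u, v⟩ h
  rw [mem_domInfinity] at h
  rcases h.2.2.2.lt_or_eq with hlt | rfl
  · exact subset_closure ⟨h.1, h.2.1, h.2.2.1, hlt⟩
  · rw [mem_closure_iff_nhdsWithin_neBot]
    exact (tendsto_infinity_slice h.1 h.2.1 hv).neBot

/-- A non-strict inequality between continuous functions extends to conformal infinity. -/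
theorem le_on_domInfinity (hv : 0 < vI) {f g : ℝ × ℝ → ℝ} (hf : ContinuousOn f (domInfinity U vI))
    (hg : ContinuousOn g (domInfinity U vI)) (h : ∀ p ∈ dom U vI, f p ≤ g p) :
    ∀ p ∈ domInfinity U vI, f p ≤ g p := fun p hp =>
  ((hf p hp).mono dom_subset_domInfinity).closure_le (domInfinity_subset_closure_dom hv hp)
    ((hg p hp).mono dom_subset_domInfinity) h

end Domains

/-! ### Controlled solutions -/

namespace Fields

/-- A smooth solution with uniformly controlled `∂_u r`, `∂_v r` and small renormalised mass. -/
structure IsControlled (S : Fields) (Λ U vI C₀ δ₀ : ℝ) : Prop where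
  neg : Λ < 0
  U_pos : 0 < U
  vI_pos : 0 < vI
  C_large : 100 < C₀
  δ_small : δ₀ ≤ 1 / 100
  sol : S.IsSmoothSolution Λ U vI
  bound : ∀ p ∈ dom U vI, 0 < dV (dom U vI) S.r p ∧ dU (dom U vI) S.r p < 0 ∧
        |Real.log (dV (dom U vI) S.r p / (1 - 1 / 3 * Λ * S.r p ^ 2))|
          + |Real.log (-dU (dom U vI) S.r p / (1 - 1 / 3 * Λ * S.r p ^ 2))| ≤ C₀
  mass : ∀ p ∈ dom U vI, 2 * S.renMass Λ (dom U vI) p / S.r p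
          + √(-Λ) * S.renMass Λ (dom U vI) p ≤ δ₀

variable {S : Fields} {Λ U vI C₀ δ₀ : ℝ} {p : ℝ × ℝ}

/-! ### Positivity of the energy-momentum tensor -/

theorem shell_nonneg (hS : S.IsSmoothSolution Λ U vI) (hp : p ∈ dom U vI) {pu l : ℝ}
    (hpu : 0 < pu) (hl : 0 < l) :
    0 ≤ S.shellPv p pu l ∧ 0 ≤ S.fbar (p, (pu, S.shellPv p pu l, l)) := by
  have hr := hS.r_pos p hp
  have hO := hS.Om2_pos p hp
  have h1 : 0 ≤ S.shellPv p pu l := by unfold shellPv; positivity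
  refine ⟨h1, hS.vlasov.nonneg p hp _ ⟨hpu.le, h1, hl.le⟩ ?_⟩
  simp only [OnShell, shellPv]
  field_simp

theorem Tuv_nonneg (hS : S.IsSmoothSolution Λ U vI) (hp : p ∈ dom U vI) : 0 ≤ S.Tuv p := by
  have hr := hS.r_pos p hp
  have hO := hS.Om2_pos p hp
  refine mul_nonneg (by positivity) (MeasureTheory.setIntegral_nonneg measurableSet_Ioi
    fun l hl => MeasureTheory.setIntegral_nonneg measurableSet_Ioi fun pu hpu => ?_)
  obtain ⟨h1, h2⟩ := shell_nonneg hS hp hpu hl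
  have h3 : 0 < pu := hpu
  have h4 : 0 < l := hl
  positivity

theorem Tvv_nonneg (hS : S.IsSmoothSolution Λ U vI) (hp : p ∈ dom U vI) : 0 ≤ S.Tvv p := by
  have hr := hS.r_pos p hp
  have hO := hS.Om2_pos p hp
  refine mul_nonneg (by positivity) (MeasureTheory.setIntegral_nonneg measurableSet_Ioi
    fun l hl => MeasureTheory.setIntegral_nonneg measurableSet_Ioi fun pu hpu => ?_)
  obtain ⟨h1, h2⟩ := shell_nonneg hS hp hpu hl
  have h3 : 0 < pu := hpu
  have h4 : 0 < l := hl
  positivity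

namespace IsControlled

theorem uniqueDiff (h : S.IsControlled Λ U vI C₀ δ₀) : UniqueDiffOn ℝ (dom U vI) :=
  uniqueDiffOn_dom h.U_pos h.vI_pos

theorem r_smooth (h : S.IsControlled Λ U vI C₀ δ₀) : ContDiffOn ℝ ∞ S.r (dom U vI) :=
  h.sol.axis.r_smooth.mono dom_subset_domAxis

theorem Om2_smooth (h : S.IsControlled Λ U vI C₀ δ₀) : ContDiffOn ℝ ∞ S.Om2 (dom U vI) :=
  h.sol.axis.Om2_smooth.mono dom_subset_domAxis

theorem log_Om2_smooth (h : S.IsControlled Λ U vI C₀ δ₀) :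
    ContDiffOn ℝ ∞ (fun x => Real.log (S.Om2 x)) (dom U vI) :=
  h.Om2_smooth.log fun p hp => (h.sol.Om2_pos p hp).ne'

theorem partials_r (h : S.IsControlled Λ U vI C₀ δ₀) (hp : p ∈ dom U vI) :
    HasPartials (dom U vI) S.r (dU (dom U vI) S.r p) (dV (dom U vI) S.r p) p :=
  hasPartials_of_contDiffOn h.r_smooth hp

theorem partials_dV_r (h : S.IsControlled Λ U vI C₀ δ₀) (hp : p ∈ dom U vI) :
    HasPartials (dom U vI) (dV (dom U vI) S.r) (dU (dom U vI) (dV (dom U vI) S.r) p)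
      (dV (dom U vI) (dV (dom U vI) S.r) p) p :=
  hasPartials_of_contDiffOn (contDiffOn_dV h.uniqueDiff h.r_smooth) hp

theorem partials_dU_r (h : S.IsControlled Λ U vI C₀ δ₀) (hp : p ∈ dom U vI) :
    HasPartials (dom U vI) (dU (dom U vI) S.r) (dU (dom U vI) (dU (dom U vI) S.r) p)
      (dU (dom U vI) (dV (dom U vI) S.r) p) p := by
  rw [← dV_dU_comm convex_dom (interior_dom_nonempty h.U_pos h.vI_pos) h.r_smooth hp]
  exact hasPartials_of_contDiffOn (contDiffOn_dU h.uniqueDiff h.r_smooth) hp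

/-- The wave equation for `r`. -/
theorem wave_r (h : S.IsControlled Λ U vI C₀ δ₀) (hp : p ∈ dom U vI) :
    2 * (dU (dom U vI) S.r p * dV (dom U vI) S.r p
        + S.r p * dU (dom U vI) (dV (dom U vI) S.r) p) =
      -(1 / 2) * (1 - Λ * S.r p ^ 2) * S.Om2 p + 8 * Real.pi * S.r p ^ 2 * S.Tuv p := by
  rw [← h.sol.einstein.wave_r p hp]
  have e : ∀ x ∈ dom U vI, dV (dom U vI) (fun x => S.r x ^ 2) x =
      2 * (S.r x * dV (dom U vI) S.r x) := fun x hx => by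
    rw [((h.partials_r hx).pow 2).dV_eq (h.uniqueDiff x hx)]
    push_cast; ring
  exact ((((h.partials_r hp).mul (h.partials_dV_r hp)).const_mul 2).congr e hp).dU_eq
    (h.uniqueDiff p hp) |>.symm

/-- The derivative `∂_v log (Ω² / r²)`. -/
noncomputable def Gv (S : Fields) (U vI : ℝ) (p : ℝ × ℝ) : ℝ :=
  dV (dom U vI) (fun x => Real.log (S.Om2 x)) p - 2 * (dV (dom U vI) S.r p / S.r p)

theorem kappa_pos (h : S.IsControlled Λ U vI C₀ δ₀) (p : ℝ × ℝ) :
    1 ≤ 1 - 1 / 3 * Λ * S.r p ^ 2 := by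
  have := h.neg
  nlinarith [sq_nonneg (S.r p)]

theorem four_mul_dU_dV (h : S.IsControlled Λ U vI C₀ δ₀) (hp : p ∈ dom U vI) :
    -(4 * (dU (dom U vI) S.r p * dV (dom U vI) S.r p)) =
      S.Om2 p * (1 - 1 / 3 * Λ * S.r p ^ 2 - 2 * S.renMass Λ (dom U vI) p / S.r p) := by
  have hr := h.sol.r_pos p hp
  have hO := h.sol.Om2_pos p hp
  simp only [renMass, hawkingMass]
  field_simp
  ring

/-- The central identity: combining the two wave equations, the terms in `Λ` are absorbed by the
renormalised mass. The `u`-derivative is non-positive as soon as `6 m̃/r ≤ 1` and `T_uv ≥ 0`; the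
`v`-derivative plays no role. -/
theorem partials_Gv (h : S.IsControlled Λ U vI C₀ δ₀) (hp : p ∈ dom U vI) :
    ∃ b, HasPartials (dom U vI) (Gv S U vI)
      (-(S.Om2 p / (2 * S.r p ^ 2) * (1 - 3 * (2 * S.renMass Λ (dom U vI) p / S.r p)))
        - 24 * Real.pi * S.Tuv p) b p := by
  have hr := h.sol.r_pos p hp
  have hO := h.sol.Om2_pos p hp
  have h1 : HasPartials (dom U vI) _ _ _ p :=
    hasPartials_of_contDiffOn (contDiffOn_dV h.uniqueDiff h.log_Om2_smooth) hp
  have h2 := ((h.partials_dV_r hp).mul ((h.partials_r hp).inv hr.ne')).const_mul 2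
  refine ⟨_, ((h1.sub h2).congr (H := Gv S U vI) (fun x _ => by rw [Gv, div_eq_mul_inv])
    hp).congr_partials ?_ rfl⟩
  rw [h.sol.einstein.wave_Om2 p hp, TAB]
  have w := h.wave_r hp
  have w' : dU (dom U vI) (dV (dom U vI) S.r) p =
      (-(1 / 2) * (1 - Λ * S.r p ^ 2) * S.Om2 p + 8 * Real.pi * S.r p ^ 2 * S.Tuv p
        - 2 * (dU (dom U vI) S.r p * dV (dom U vI) S.r p)) / (2 * S.r p) := by
    field_simp; linarith
  rw [w']
  simp only [renMass, hawkingMass]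
  field_simp
  ring

/-! ### Positivity of the mass -/

theorem partials_renMass (h : S.IsControlled Λ U vI C₀ δ₀) (hp : p ∈ dom U vI) :
    ∃ a, HasPartials (dom U vI) (S.renMass Λ (dom U vI)) a
      (8 * Real.pi * S.r p ^ 2 * (S.Om2 p)⁻¹ *
        (S.Tuv p * dV (dom U vI) S.r p - S.Tvv p * dU (dom U vI) S.r p)) p := by
  have hr := h.sol.r_pos p hp
  have hO := h.sol.Om2_pos p hp
  have hα : HasPartials (dom U vI) (fun x => (S.Om2 x)⁻¹ * dV (dom U vI) S.r x)
      (dU (dom U vI) (fun x => (S.Om2 x)⁻¹ * dV (dom U vI) S.r x) p)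
      (-(4 * Real.pi) * S.r p * S.Tvv p * (S.Om2 p)⁻¹) p := by
    rw [← h.sol.einstein.constraint_v p hp]
    exact hasPartials_of_contDiffOn ((h.Om2_smooth.inv fun x hx => (h.sol.Om2_pos x hx).ne').mul
      (contDiffOn_dV h.uniqueDiff h.r_smooth)) hp
  have h1 := (((h.partials_r hp).const_mul (1 / 2)).add
    ((((h.partials_r hp).mul (h.partials_dU_r hp)).mul hα).const_mul 2)).sub
    (((h.partials_r hp).pow 3).const_mul (Λ / 6))
  refine ⟨_, (h1.congr (H := S.renMass Λ (dom U vI)) (fun x _ => ?_) hp).congr_partials rfl ?_⟩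
  · simp only [renMass, hawkingMass]
    ring
  · have w := h.wave_r hp
    have w' : dU (dom U vI) (dV (dom U vI) S.r) p =
        (-(1 / 2) * (1 - Λ * S.r p ^ 2) * S.Om2 p + 8 * Real.pi * S.r p ^ 2 * S.Tuv p
          - 2 * (dU (dom U vI) S.r p * dV (dom U vI) S.r p)) / (2 * S.r p) := by
      field_simp; linarith
    rw [w']
    push_cast
    field_simp
    ring

/-- The bounds on `∂_v r` and `∂_u r` in exponential form. -/
theorem dV_bounds (h : S.IsControlled Λ U vI C₀ δ₀) (hp : p ∈ dom U vI) :
    (1 - 1 / 3 * Λ * S.r p ^ 2) / Real.exp C₀ ≤ dV (dom U vI) S.r p ∧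
    dV (dom U vI) S.r p ≤ Real.exp C₀ * (1 - 1 / 3 * Λ * S.r p ^ 2) ∧
    (1 - 1 / 3 * Λ * S.r p ^ 2) / Real.exp C₀ ≤ -dU (dom U vI) S.r p ∧
    -dU (dom U vI) S.r p ≤ Real.exp C₀ * (1 - 1 / 3 * Λ * S.r p ^ 2) ∧
    (1 - 1 / 3 * Λ * S.r p ^ 2) ^ 2 / Real.exp C₀ ≤
      -(dU (dom U vI) S.r p * dV (dom U vI) S.r p) ∧
    -(dU (dom U vI) S.r p * dV (dom U vI) S.r p) ≤
      Real.exp C₀ * (1 - 1 / 3 * Λ * S.r p ^ 2) ^ 2 := by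
  obtain ⟨hv, hu, hb⟩ := h.bound p hp
  have hκ : 0 < 1 - 1 / 3 * Λ * S.r p ^ 2 := by linarith [h.kappa_pos p]
  set κ := 1 - 1 / 3 * Λ * S.r p ^ 2
  set y := dV (dom U vI) S.r p
  set x := -dU (dom U vI) S.r p with hx
  have hx0 : 0 < x := by linarith
  have ha : 0 < y / κ := by positivity
  have hb0 : 0 < x / κ := by positivity
  have key : ∀ z w : ℝ, 0 < z → 0 < w → |Real.log (z / w)| ≤ C₀ →
      w / Real.exp C₀ ≤ z ∧ z ≤ Real.exp C₀ * w := fun z w hz hw hzw => by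
    have h0 : 0 < z / w := by positivity
    obtain ⟨l1, l2⟩ := abs_le.1 hzw
    rw [Real.log_le_iff_le_exp h0, div_le_iff₀ hw] at l2
    rw [Real.le_log_iff_exp_le h0, le_div_iff₀ hw, Real.exp_neg] at l1
    exact ⟨by rw [div_eq_inv_mul]; exact l1, l2⟩
  have n1 := abs_nonneg (Real.log (y / κ))
  have n2 := abs_nonneg (Real.log (x / κ))
  have k1 := key y κ hv hκ (by linarith)
  have k2 := key x κ hx0 hκ (by linarith)
  have k3 := key (x * y) (κ ^ 2) (by positivity) (by positivity) (by
    have : x * y / κ ^ 2 = (y / κ) * (x / κ) := by field_simp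
    rw [this, Real.log_mul ha.ne' hb0.ne']
    exact (abs_add_le _ _).trans hb)
  have e : -(dU (dom U vI) S.r p * y) = x * y := by rw [hx]; ring
  rw [e]
  exact ⟨k1.1, k1.2, k2.1, k2.2, k3.1, k3.2⟩

/-- The mass increases in `v` because `T_uv, T_vv ≥ 0` and `∂_u r < 0 < ∂_v r`, and near the axis it
is bounded below by a quantity tending to zero with `r`. -/
theorem renMass_nonneg (h : S.IsControlled Λ U vI C₀ δ₀) (hp : p ∈ dom U vI) :
    0 ≤ S.renMass Λ (dom U vI) p := by
  obtain ⟨u, v⟩ := p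
  have hd := mem_dom.1 hp
  set X := Real.exp C₀
  have hmono : ∀ y ∈ Ioo u v, S.renMass Λ (dom U vI) (u, y) ≤ S.renMass Λ (dom U vI) (u, v) :=
    fun y hy => by
    have hm : ∀ x ∈ Icc y v, (u, x) ∈ dom U vI := fun x hx =>
      ⟨hd.1, hd.2.1, hy.1.trans_le hx.1, lt_of_le_of_lt hx.2 hd.2.2.2⟩
    refine monotoneOn_Icc_of_hasDerivWithinAt
      (f := fun x => S.renMass Λ (dom U vI) (u, x))
      (fun x hx => (h.partials_renMass (hm x hx)).choose_spec.slice_v hm) (fun x hx => ?_)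
      (left_mem_Icc.2 hy.2.le) (right_mem_Icc.2 hy.2.le) hy.2.le
    have hr := h.sol.r_pos _ (hm x hx)
    have hO := h.sol.Om2_pos _ (hm x hx)
    have t1 := Tuv_nonneg h.sol (hm x hx)
    have t2 := Tvv_nonneg h.sol (hm x hx)
    obtain ⟨b1, b2, -⟩ := h.bound _ (hm x hx)
    have : 0 ≤ S.Tuv (u, x) * dV (dom U vI) S.r (u, x)
        - S.Tvv (u, x) * dU (dom U vI) S.r (u, x) := by
      have := mul_nonneg t1 b1.le
      have := mul_nonneg t2 (neg_nonneg.2 b2.le)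
      linarith
    positivity
  have hax : (u, u) ∈ domAxis U vI := ⟨hd.1, hd.2.1, le_rfl, by simpa using h.vI_pos⟩
  have hr0 := h.sol.axis.r_axis _ hax rfl
  have hO0 := h.sol.axis.Om2_axis _ hax rfl
  have hlim : Tendsto (fun y => S.r (u, y) / 2 *
      (1 - 4 * (S.Om2 (u, y))⁻¹ * (X * (1 - 1 / 3 * Λ * S.r (u, y) ^ 2) ^ 2)))
      (𝓝[>] u) (𝓝 0) := by
    have t := (tendsto_axis_slice hd.1 hd.2.1 h.vI_pos).mono_right
      (nhdsWithin_mono _ dom_subset_domAxis)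
    have c1 : Tendsto (fun y => S.r (u, y)) (𝓝[>] u) (𝓝 (S.r (u, u))) :=
      (h.sol.axis.r_smooth.continuousOn _ hax).tendsto.comp t
    have c2 : Tendsto (fun y => S.Om2 (u, y)) (𝓝[>] u) (𝓝 (S.Om2 (u, u))) :=
      (h.sol.axis.Om2_smooth.continuousOn _ hax).tendsto.comp t
    have c3 := (c1.div_const 2).mul (((c2.inv₀ hO0.ne').const_mul 4).mul
      (((((c1.pow 2).const_mul (1 / 3 * Λ)).const_sub 1).pow 2).const_mul X) |>.const_sub 1)
    simpa [hr0] using c3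
  refine le_of_tendsto hlim ?_
  filter_upwards [Ioo_mem_nhdsGT hd.2.2.1] with y hy
  have hm : (u, y) ∈ dom U vI := ⟨hd.1, hd.2.1, hy.1, hy.2.trans hd.2.2.2⟩
  refine le_trans ?_ (hmono y hy)
  have hr := h.sol.r_pos _ hm
  have hO := h.sol.Om2_pos _ hm
  obtain ⟨-, -, -, -, -, b⟩ := h.dV_bounds hm
  have hΛ := h.neg
  simp only [renMass, hawkingMass]
  have e1 : 0 ≤ -(Λ / 6 * S.r (u, y) ^ 3) := by
    have : 0 < S.r (u, y) ^ 3 := by positivity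
    nlinarith
  have e2 : S.r (u, y) / 2 *
      (1 - 4 * (S.Om2 (u, y))⁻¹ * (X * (1 - 1 / 3 * Λ * S.r (u, y) ^ 2) ^ 2)) ≤
      S.r (u, y) / 2 * (1 + 4 * (S.Om2 (u, y))⁻¹ * dU (dom U vI) S.r (u, y)
        * dV (dom U vI) S.r (u, y)) := by
    refine mul_le_mul_of_nonneg_left ?_ (by positivity)
    have := mul_le_mul_of_nonneg_left b (show 0 ≤ 4 * (S.Om2 (u, y))⁻¹ by positivity)
    linarith
  linarith

/-- Positivity of the mass lets the one-sided bound on the sum control each summand. -/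
theorem mass_ratio (h : S.IsControlled Λ U vI C₀ δ₀) (hp : p ∈ dom U vI) :
    0 ≤ 2 * S.renMass Λ (dom U vI) p / S.r p ∧ 2 * S.renMass Λ (dom U vI) p / S.r p ≤ 1 / 100 ∧
    √(-Λ) * S.renMass Λ (dom U vI) p ≤ 1 := by
  have h0 := h.renMass_nonneg hp
  have hr := h.sol.r_pos p hp
  have h1 := h.mass p hp
  have h2 : 0 ≤ 2 * S.renMass Λ (dom U vI) p / S.r p := by positivity
  have h3 : 0 ≤ √(-Λ) * S.renMass Λ (dom U vI) p := by positivity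
  have := h.δ_small
  exact ⟨h2, by linarith, by linarith⟩

end IsControlled

end Fields

/-! ### The tortoise radius -/

/-- The function `R` of the area radius `x` with `dR/dx = 1 / (1 - Λ x² / 3)`, `R(0) = 0`. -/
noncomputable def tortoise (Λ x : ℝ) : ℝ := Real.arctan (√(-Λ / 3) * x) / √(-Λ / 3)

/-- With `θ = arctan (k x)` and `k² = -Λ/3`, one has `sin² θ (1 + k²x²) = k²x²`; the claim is `sin θ
≤ θ ≤ (π/2) sin θ`. -/
theorem tortoise_bounds {Λ x : ℝ} (hΛ : Λ < 0) (hx : 0 < x) :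
    x ^ 2 ≤ (1 - 1 / 3 * Λ * x ^ 2) * tortoise Λ x ^ 2 ∧
    (1 - 1 / 3 * Λ * x ^ 2) * tortoise Λ x ^ 2 ≤ Real.pi ^ 2 / 4 * x ^ 2 := by
  have hk : 0 < √(-Λ / 3) := Real.sqrt_pos.2 (by linarith)
  have hk2 : √(-Λ / 3) ^ 2 = -Λ / 3 := Real.sq_sqrt (by linarith)
  set k := √(-Λ / 3) with hkd
  have hθ0 : 0 < Real.arctan (k * x) := Real.arctan_pos.2 (by positivity)
  have hθ1 := Real.arctan_lt_pi_div_two (k * x)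
  have hs := Real.sin_arctan (k * x)
  have hs1 := (Real.sin_lt hθ0).le
  have hs2 := Real.mul_le_sin hθ0.le hθ1.le
  have hs0 : 0 ≤ Real.sin (Real.arctan (k * x)) := le_trans (by positivity) hs2
  have hκ : 1 - 1 / 3 * Λ * x ^ 2 = 1 + (k * x) ^ 2 := by rw [mul_pow, hk2]; ring
  have hsq : Real.sin (Real.arctan (k * x)) ^ 2 * (1 + (k * x) ^ 2) = (k * x) ^ 2 := by
    rw [hs, div_pow, Real.sq_sqrt (by positivity)]
    field_simp
  rw [hκ, tortoise, ← hkd]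
  set θ := Real.arctan (k * x)
  have e : (1 + (k * x) ^ 2) * (θ / k) ^ 2 = θ ^ 2 * (1 + (k * x) ^ 2) / k ^ 2 := by
    field_simp
  rw [e]
  constructor
  · rw [le_div_iff₀ (by positivity)]
    calc x ^ 2 * k ^ 2 = (k * x) ^ 2 := by ring
      _ = Real.sin θ ^ 2 * (1 + (k * x) ^ 2) := hsq.symm
      _ ≤ θ ^ 2 * (1 + (k * x) ^ 2) := by gcongr
  · rw [div_le_iff₀ (by positivity)]
    have h3 : θ ≤ Real.pi / 2 * Real.sin θ := by
      have hpi := Real.pi_pos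
      calc θ = Real.pi / 2 * (2 / Real.pi * θ) := by field_simp
        _ ≤ _ := by gcongr
    calc θ ^ 2 * (1 + (k * x) ^ 2) ≤ (Real.pi / 2 * Real.sin θ) ^ 2 * (1 + (k * x) ^ 2) := by gcongr
      _ = Real.pi ^ 2 / 4 * (Real.sin θ ^ 2 * (1 + (k * x) ^ 2)) := by ring
      _ = _ := by rw [hsq]; ring

theorem tortoise_le {Λ x : ℝ} (hΛ : Λ < 0) (hx : 0 < x) : tortoise Λ x ≤ x := by
  have hk : 0 < √(-Λ / 3) := Real.sqrt_pos.2 (by linarith)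
  rw [tortoise, div_le_iff₀ hk, mul_comm x]
  have h0 : 0 < Real.arctan (√(-Λ / 3) * x) := Real.arctan_pos.2 (by positivity)
  have := Real.le_tan h0.le (Real.arctan_lt_pi_div_two _)
  rwa [Real.tan_arctan] at this

theorem hasDerivAt_tortoise {Λ x : ℝ} (hΛ : Λ < 0) :
    HasDerivAt (tortoise Λ) (1 / (1 - 1 / 3 * Λ * x ^ 2)) x := by
  have hk : 0 < √(-Λ / 3) := Real.sqrt_pos.2 (by linarith)
  have hk2 : √(-Λ / 3) ^ 2 = -Λ / 3 := Real.sq_sqrt (by linarith)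
  have h1 : HasDerivAt (fun y : ℝ => √(-Λ / 3) * y) (√(-Λ / 3) * 1) x :=
    (hasDerivAt_id x).const_mul _
  have h2 := (h1.arctan).div_const √(-Λ / 3)
  have e : 1 / (1 + (√(-Λ / 3) * x) ^ 2) * (√(-Λ / 3) * 1) / √(-Λ / 3) =
      1 / (1 - 1 / 3 * Λ * x ^ 2) := by
    have : 1 + (√(-Λ / 3) * x) ^ 2 = 1 - 1 / 3 * Λ * x ^ 2 := by rw [mul_pow, hk2]; ring
    rw [this, mul_one, div_mul_eq_mul_div, one_mul, div_right_comm, div_self hk.ne']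
  rw [e] at h2
  exact h2

/-! ### Metric bounds: the tortoise radius and the conformal factor -/

namespace Fields.IsControlled

variable {S : Fields} {Λ U vI C₀ δ₀ : ℝ} {p : ℝ × ℝ}

/-- This lets one extra factor `X` absorb most of the numerical constants. -/
theorem exp_large (h : S.IsControlled Λ U vI C₀ δ₀) : 1000 ≤ Real.exp C₀ := by
  have h1 := h.C_large
  have h2 : Real.exp 1 ^ 10 ≤ Real.exp C₀ := by
    rw [← Real.exp_nat_mul]
    exact Real.exp_le_exp.2 (by norm_num; linarith)
  have h3 : (2 : ℝ) ^ 10 ≤ Real.exp 1 ^ 10 := by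
    gcongr
    linarith [Real.add_one_le_exp (1 : ℝ)]
  have h4 : (1000 : ℝ) ≤ 2 ^ 10 := by norm_num
  linarith

theorem partials_tortoise (h : S.IsControlled Λ U vI C₀ δ₀) (hp : p ∈ dom U vI) :
    HasPartials (dom U vI) (fun x => tortoise Λ (S.r x))
      (dU (dom U vI) S.r p / (1 - 1 / 3 * Λ * S.r p ^ 2))
      (dV (dom U vI) S.r p / (1 - 1 / 3 * Λ * S.r p ^ 2)) p :=
  ((h.partials_r hp).comp (hasDerivAt_tortoise h.neg)).congr_partials (by ring) (by ring)

/-- The assumed bounds on `∂_v r/(1 - Λr²/3)` are bounds on `∂_v R`; this is why `R` is the right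
radius. -/
theorem tortoise_sub_v (h : S.IsControlled Λ U vI C₀ δ₀) {u v v' : ℝ} (hm : (u, v) ∈ dom U vI)
    (hm' : (u, v') ∈ dom U vI) (hv : v ≤ v') :
    (v' - v) / Real.exp C₀ ≤ tortoise Λ (S.r (u, v')) - tortoise Λ (S.r (u, v)) ∧
    tortoise Λ (S.r (u, v')) - tortoise Λ (S.r (u, v)) ≤ Real.exp C₀ * (v' - v) := by
  have hd := mem_dom.1 hm
  have hd' := mem_dom.1 hm'
  have hI : ∀ x ∈ Icc v v', (u, x) ∈ dom U vI := fun x hx =>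
    ⟨hd.1, hd.2.1, lt_of_lt_of_le hd.2.2.1 hx.1, lt_of_le_of_lt hx.2 hd'.2.2.2⟩
  have hX := Real.exp_pos C₀
  have hder := fun x (hx : x ∈ Icc v v') => (h.partials_tortoise (hI x hx)).slice_v hI
  have m1 := monotoneOn_Icc_of_hasDerivWithinAt
    (f := fun x => tortoise Λ (S.r (u, x)) - x / Real.exp C₀)
    (fun x hx => (hder x hx).sub ((hasDerivWithinAt_id x _).div_const _)) (fun x hx => by
      have hκ := h.kappa_pos (u, x)
      have := (h.dV_bounds (hI x hx)).1
      rw [sub_nonneg, le_div_iff₀ (by linarith)]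
      calc _ = (1 - 1 / 3 * Λ * S.r (u, x) ^ 2) / Real.exp C₀ := by ring
        _ ≤ _ := this) (left_mem_Icc.2 hv) (right_mem_Icc.2 hv) hv
  have m2 := antitoneOn_Icc_of_hasDerivWithinAt
    (f := fun x => tortoise Λ (S.r (u, x)) - Real.exp C₀ * x)
    (fun x hx => (hder x hx).sub ((hasDerivWithinAt_id x _).const_mul _)) (fun x hx => by
      have hκ := h.kappa_pos (u, x)
      have := (h.dV_bounds (hI x hx)).2.1
      rw [sub_nonpos, div_le_iff₀ (by linarith), mul_one]
      exact this) (left_mem_Icc.2 hv) (right_mem_Icc.2 hv) hv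
  simp only at m1 m2
  rw [sub_div]
  exact ⟨by linarith, by linarith⟩

theorem tortoise_sub_u (h : S.IsControlled Λ U vI C₀ δ₀) {u u' v : ℝ} (hm : (u, v) ∈ dom U vI)
    (hm' : (u', v) ∈ dom U vI) (hv : u ≤ u') :
    (u' - u) / Real.exp C₀ ≤ tortoise Λ (S.r (u, v)) - tortoise Λ (S.r (u', v)) ∧
    tortoise Λ (S.r (u, v)) - tortoise Λ (S.r (u', v)) ≤ Real.exp C₀ * (u' - u) := by
  have hd := mem_dom.1 hm
  have hd' := mem_dom.1 hm'
  have hI : ∀ x ∈ Icc u u', (x, v) ∈ dom U vI := fun x hx =>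
    ⟨hd.1.trans hx.1, lt_of_le_of_lt hx.2 hd'.2.1, lt_of_le_of_lt hx.2 hd'.2.2.1,
      by have := hx.1; simp only; linarith⟩
  have hX := Real.exp_pos C₀
  have hder := fun x (hx : x ∈ Icc u u') => (h.partials_tortoise (hI x hx)).slice_u hI
  have m1 := antitoneOn_Icc_of_hasDerivWithinAt
    (f := fun x => tortoise Λ (S.r (x, v)) + x / Real.exp C₀)
    (fun x hx => (hder x hx).add ((hasDerivWithinAt_id x _).div_const _)) (fun x hx => by
      have hκ := h.kappa_pos (x, v)
      have := (h.dV_bounds (hI x hx)).2.2.1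
      rw [← le_neg_iff_add_nonpos_right, div_le_iff₀ (by linarith)]
      have e : -(1 / Real.exp C₀) * (1 - 1 / 3 * Λ * S.r (x, v) ^ 2) =
        -((1 - 1 / 3 * Λ * S.r (x, v) ^ 2) / Real.exp C₀) := by ring
      rw [e]
      linarith) (left_mem_Icc.2 hv) (right_mem_Icc.2 hv) hv
  have m2 := monotoneOn_Icc_of_hasDerivWithinAt
    (f := fun x => tortoise Λ (S.r (x, v)) + Real.exp C₀ * x)
    (fun x hx => (hder x hx).add ((hasDerivWithinAt_id x _).const_mul _)) (fun x hx => by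
      have hκ := h.kappa_pos (x, v)
      have := (h.dV_bounds (hI x hx)).2.2.2.1
      rw [← neg_le_iff_add_nonneg, le_div_iff₀ (by linarith), mul_one]
      linarith) (left_mem_Icc.2 hv) (right_mem_Icc.2 hv) hv
  simp only at m1 m2
  rw [sub_div]
  exact ⟨by linarith, by linarith⟩

theorem tortoise_axis (h : S.IsControlled Λ U vI C₀ δ₀) {u v : ℝ} (hm : (u, v) ∈ dom U vI) :
    (v - u) / Real.exp C₀ ≤ tortoise Λ (S.r (u, v)) ∧
    tortoise Λ (S.r (u, v)) ≤ Real.exp C₀ * (v - u) := by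
  have hd := mem_dom.1 hm
  have hax : (u, u) ∈ domAxis U vI := ⟨hd.1, hd.2.1, le_rfl, by simpa using h.vI_pos⟩
  have hr0 := h.sol.axis.r_axis _ hax rfl
  have t := (tendsto_axis_slice hd.1 hd.2.1 h.vI_pos).mono_right
      (nhdsWithin_mono _ dom_subset_domAxis)
  have c1 : Tendsto (fun y => S.r (u, y)) (𝓝[>] u) (𝓝 (S.r (u, u))) :=
    (h.sol.axis.r_smooth.continuousOn _ hax).tendsto.comp t
  have c2 : Tendsto (fun y => tortoise Λ (S.r (u, y))) (𝓝[>] u) (𝓝 0) := by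
    have := (hasDerivAt_tortoise (x := S.r (u, u)) h.neg).continuousAt.tendsto.comp c1
    rw [hr0] at this
    simpa [tortoise, Function.comp_def] using this
  have c3 : Tendsto (fun y : ℝ => y) (𝓝[>] u) (𝓝 u) := tendsto_id.mono_left nhdsWithin_le_nhds
  have ev : ∀ᶠ y in 𝓝[>] u, y ∈ Ioo u v := Ioo_mem_nhdsGT hd.2.2.1
  have hm' : ∀ y ∈ Ioo u v, (u, y) ∈ dom U vI := fun y hy =>
    ⟨hd.1, hd.2.1, hy.1, hy.2.trans hd.2.2.2⟩
  constructor
  · have := le_of_tendsto_of_tendsto ((c3.const_sub v).div_const (Real.exp C₀))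
      (c2.const_sub (tortoise Λ (S.r (u, v))))
      (ev.mono fun y hy => (h.tortoise_sub_v (hm' y hy) hm hy.2.le).1)
    simpa using this
  · have := le_of_tendsto_of_tendsto (c2.const_sub (tortoise Λ (S.r (u, v))))
      ((c3.const_sub v).const_mul (Real.exp C₀))
      (ev.mono fun y hy => (h.tortoise_sub_v (hm' y hy) hm hy.2.le).2)
    simpa using this

/-- `r → ∞` at infinity, so `R` tends to `RI = π/(2k)` with `k² = -Λ/3`, and the Lipschitz bounds
pass to the limit. -/
theorem tortoise_infinity (h : S.IsControlled Λ U vI C₀ δ₀) {u v : ℝ} (hm : (u, v) ∈ dom U vI) :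
    (u + vI - v) / Real.exp C₀ ≤ Real.pi / 2 / √(-Λ / 3) - tortoise Λ (S.r (u, v)) ∧
    Real.pi / 2 / √(-Λ / 3) - tortoise Λ (S.r (u, v)) ≤ Real.exp C₀ * (u + vI - v) := by
  have hd := mem_dom.1 hm
  have hk : 0 < √(-Λ / 3) := Real.sqrt_pos.2 (by linarith [h.neg])
  obtain ⟨w, hw, hwr, hw0⟩ := h.sol.infinity.inv_r
  have hI : (u, u + vI) ∈ domInfinity U vI := ⟨hd.1, hd.2.1, by simpa using h.vI_pos, le_rfl⟩
  have t := tendsto_infinity_slice hd.1 hd.2.1 h.vI_pos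
  have c1 : Tendsto (fun y => S.r (u, y)) (𝓝[<] (u + vI)) atTop := by
    have a : Tendsto (fun y => w (u, y)) (𝓝[<] (u + vI)) (𝓝 0) := by
      have := (hw.continuousOn _ hI).tendsto.comp
        (t.mono_right (nhdsWithin_mono _ dom_subset_domInfinity))
      rwa [hw0 _ hI rfl] at this
    have b : Tendsto (fun y => (S.r (u, y))⁻¹) (𝓝[<] (u + vI)) (𝓝[>] 0) := by
      refine tendsto_nhdsWithin_iff.2 ⟨a.congr' ?_, ?_⟩
      · filter_upwards [t.eventually self_mem_nhdsWithin] with y hy using hwr _ hy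
      · filter_upwards [t.eventually self_mem_nhdsWithin] with y hy
        exact inv_pos.2 (h.sol.r_pos _ hy)
    refine b.inv_tendsto_nhdsGT_zero.congr fun y => ?_
    simp
  have c2 : Tendsto (fun y => tortoise Λ (S.r (u, y))) (𝓝[<] (u + vI))
      (𝓝 (Real.pi / 2 / √(-Λ / 3))) :=
    ((Real.tendsto_arctan_atTop.mono_right nhdsWithin_le_nhds).comp
      (c1.const_mul_atTop hk)).div_const _
  have c3 : Tendsto (fun y : ℝ => y) (𝓝[<] (u + vI)) (𝓝 (u + vI)) :=
    tendsto_id.mono_left nhdsWithin_le_nhds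
  have ev : ∀ᶠ y in 𝓝[<] (u + vI), y ∈ Ioo v (u + vI) := Ioo_mem_nhdsLT hd.2.2.2
  have hm' : ∀ y ∈ Ioo v (u + vI), (u, y) ∈ dom U vI := fun y hy =>
    ⟨hd.1, hd.2.1, hd.2.2.1.trans hy.1, hy.2⟩
  constructor
  · exact le_of_tendsto_of_tendsto ((c3.sub_const v).div_const (Real.exp C₀))
      (c2.sub_const (tortoise Λ (S.r (u, v))))
      (ev.mono fun y hy => (h.tortoise_sub_v hm (hm' y hy) hy.1.le).1)
  · exact le_of_tendsto_of_tendsto (c2.sub_const (tortoise Λ (S.r (u, v))))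
      ((c3.sub_const v).const_mul (Real.exp C₀))
      (ev.mono fun y hy => (h.tortoise_sub_v hm (hm' y hy) hy.1.le).2)

/-! ### The conformal factor -/

/-- From `-4 ∂_u r ∂_v r = Ω² (κ - μ)` with `κ = 1 - Λr²/3 ≥ 1` and `0 ≤ μ = 2m̃/r ≤ 1/100`. The sum
of the two logarithms is bounded by `C₀`, so the product `∂_u r ∂_v r` costs only one factor `X`. -/
theorem conformal_bounds (h : S.IsControlled Λ U vI C₀ δ₀) (hp : p ∈ dom U vI) :
    4 / Real.exp C₀ * (1 - 1 / 3 * Λ * S.r p ^ 2) ≤ S.Om2 p ∧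
    S.Om2 p ≤ 400 / 99 * Real.exp C₀ * (1 - 1 / 3 * Λ * S.r p ^ 2) := by
  have hO := h.sol.Om2_pos p hp
  have hκ := h.kappa_pos p
  have e := h.four_mul_dU_dV hp
  obtain ⟨m1, m2, -⟩ := h.mass_ratio hp
  obtain ⟨-, -, -, -, b1, b2⟩ := h.dV_bounds hp
  have hX := Real.exp_pos C₀
  set κ := 1 - 1 / 3 * Λ * S.r p ^ 2
  set μ := 2 * S.renMass Λ (dom U vI) p / S.r p
  have hκ0 : 0 < κ := by linarith
  constructor
  · have : 4 / Real.exp C₀ * κ * κ ≤ S.Om2 p * κ := by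
      calc 4 / Real.exp C₀ * κ * κ = 4 * (κ ^ 2 / Real.exp C₀) := by ring
        _ ≤ 4 * -(dU (dom U vI) S.r p * dV (dom U vI) S.r p) := by gcongr
        _ = S.Om2 p * (κ - μ) := by rw [← e]; ring
        _ ≤ S.Om2 p * κ := by gcongr; linarith
    exact le_of_mul_le_mul_right this hκ0
  · have : S.Om2 p * κ ≤ 400 / 99 * Real.exp C₀ * κ * κ := by
      have x1 : S.Om2 p * (99 / 100 * κ) ≤ S.Om2 p * (κ - μ) := by gcongr; linarith
      rw [← e] at x1
      nlinarith
    exact le_of_mul_le_mul_right this hκ0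

theorem exp_log_conformal (h : S.IsControlled Λ U vI C₀ δ₀) (hp : p ∈ dom U vI) :
    Real.exp (Real.log (S.Om2 p / S.r p ^ 2)) = S.Om2 p / S.r p ^ 2 := by
  have hO := h.sol.Om2_pos p hp
  have hr := h.sol.r_pos p hp
  exact Real.exp_log (by positivity)

theorem conformal_tortoise (h : S.IsControlled Λ U vI C₀ δ₀) (hp : p ∈ dom U vI) :
    4 / Real.exp C₀ ≤ Real.exp (Real.log (S.Om2 p / S.r p ^ 2)) * tortoise Λ (S.r p) ^ 2 ∧
    Real.exp (Real.log (S.Om2 p / S.r p ^ 2)) * tortoise Λ (S.r p) ^ 2 ≤ 10 * Real.exp C₀ := by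
  rw [h.exp_log_conformal hp]
  have hr := h.sol.r_pos p hp
  obtain ⟨a1, a2⟩ := h.conformal_bounds hp
  obtain ⟨b1, b2⟩ := tortoise_bounds h.neg hr
  have hX := Real.exp_pos C₀
  set R := tortoise Λ (S.r p)
  set κ := 1 - 1 / 3 * Λ * S.r p ^ 2
  have e : S.Om2 p / S.r p ^ 2 * R ^ 2 = S.Om2 p * R ^ 2 / S.r p ^ 2 := by ring
  rw [e]
  constructor
  · rw [le_div_iff₀ (by positivity)]
    calc 4 / Real.exp C₀ * S.r p ^ 2 ≤ 4 / Real.exp C₀ * (κ * R ^ 2) := by gcongr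
      _ = 4 / Real.exp C₀ * κ * R ^ 2 := by ring
      _ ≤ _ := by gcongr
  · rw [div_le_iff₀ (by positivity)]
    have hpi : Real.pi ^ 2 ≤ 9.9 := by
      have h1 := Real.pi_lt_d4
      have h2 := Real.pi_pos
      nlinarith
    calc S.Om2 p * R ^ 2 ≤ 400 / 99 * Real.exp C₀ * κ * R ^ 2 := by gcongr
      _ = 400 / 99 * Real.exp C₀ * (κ * R ^ 2) := by ring
      _ ≤ 400 / 99 * Real.exp C₀ * (Real.pi ^ 2 / 4 * S.r p ^ 2) := by gcongr
      _ ≤ 400 / 99 * Real.exp C₀ * (9.9 / 4 * S.r p ^ 2) := by gcongr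
      _ = _ := by ring

theorem partials_log_conformal (h : S.IsControlled Λ U vI C₀ δ₀) (hp : p ∈ dom U vI) :
    ∃ a, HasPartials (dom U vI) (fun x => Real.log (S.Om2 x / S.r x ^ 2)) a (Gv S U vI p) p := by
  have hr := h.sol.r_pos p hp
  have h1 : HasPartials (dom U vI) _ _ _ p := hasPartials_of_contDiffOn h.log_Om2_smooth hp
  have h2 := ((h.partials_r hp).log hr.ne').const_mul 2
  refine ⟨_, ((h1.sub h2).congr (fun x hx => ?_) hp).congr_partials rfl ?_⟩
  · have hO := h.sol.Om2_pos x hx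
    have hr := h.sol.r_pos x hx
    rw [Real.log_div hO.ne' (by positivity), Real.log_pow]
    push_cast; ring
  · rw [Gv]; ring

end Fields.IsControlled

namespace Fields.IsControlled

variable {S : Fields} {Λ U vI C₀ δ₀ : ℝ} {p : ℝ × ℝ} {w₁ w₂ : ℝ × ℝ → ℝ}

/-! ### Behaviour at conformal infinity -/

theorem uniqueDiff_infinity (h : S.IsControlled Λ U vI C₀ δ₀) :
    UniqueDiffOn ℝ (domInfinity U vI) :=
  uniqueDiffOn_domInfinity h.U_pos h.vI_pos

/-- Identifies, inside `dom`, derivatives of extensions to infinity with those computed from `r` and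
`Ω²`; inequalities then pass to infinity by continuity. -/
theorem derivs_infinity_eq (h : S.IsControlled Λ U vI C₀ δ₀) {F : ℝ × ℝ → ℝ} {a b : ℝ}
    (hF : ContDiffOn ℝ ∞ F (domInfinity U vI)) (hp : p ∈ dom U vI)
    (hab : HasPartials (dom U vI) F a b p) :
    dU (domInfinity U vI) F p = a ∧ dV (domInfinity U vI) F p = b := by
  have h1 := (hasPartials_of_contDiffOn hF (dom_subset_domInfinity hp)).mono dom_subset_domInfinity
  have hD := h.uniqueDiff p hp
  exact ⟨(h1.dU_eq hD).symm.trans (hab.dU_eq hD), (h1.dV_eq hD).symm.trans (hab.dV_eq hD)⟩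

theorem derivs_inv_r (h : S.IsControlled Λ U vI C₀ δ₀)
    (hw : ContDiffOn ℝ ∞ w₁ (domInfinity U vI)) (hwr : ∀ p ∈ dom U vI, w₁ p = (S.r p)⁻¹)
    (hp : p ∈ dom U vI) :
    dU (domInfinity U vI) w₁ p = -(S.r p ^ 2)⁻¹ * dU (dom U vI) S.r p ∧
    dV (domInfinity U vI) w₁ p = -(S.r p ^ 2)⁻¹ * dV (dom U vI) S.r p :=
  h.derivs_infinity_eq hw hp
    (((h.partials_r hp).inv (h.sol.r_pos p hp).ne').congr hwr hp)

/-- The mixed derivative of `1 / r` is non-positive. -/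
theorem dU_dV_inv_r_nonpos (h : S.IsControlled Λ U vI C₀ δ₀)
    (hw : ContDiffOn ℝ ∞ w₁ (domInfinity U vI)) (hwr : ∀ p ∈ dom U vI, w₁ p = (S.r p)⁻¹) :
    ∀ p ∈ domInfinity U vI, dU (domInfinity U vI) (dV (domInfinity U vI) w₁) p ≤ 0 := by
  have hD := h.uniqueDiff_infinity
  refine le_on_domInfinity h.vI_pos
    (contDiffOn_dU hD (contDiffOn_dV hD hw)).continuousOn continuousOn_const fun p hp => ?_
  have hr := h.sol.r_pos p hp
  have hO := h.sol.Om2_pos p hp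
  have h1 := (((h.partials_r hp).pow 2).inv (pow_pos hr 2).ne').const_mul (-1) |>.mul
    (h.partials_dV_r hp)
  have h2 := h1.congr (H := dV (domInfinity U vI) w₁) (fun x hx => by
    rw [(h.derivs_inv_r hw hwr hx).2]; ring) hp
  rw [(h.derivs_infinity_eq (contDiffOn_dV hD hw) hp h2).1]
  have w := h.wave_r hp
  have e := h.four_mul_dU_dV hp
  obtain ⟨m1, m2, -⟩ := h.mass_ratio hp
  have t := Tuv_nonneg h.sol hp
  set a := dU (dom U vI) S.r p
  set b := dV (dom U vI) S.r p
  set c := dU (dom U vI) (dV (dom U vI) S.r) p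
  set μ := 2 * S.renMass Λ (dom U vI) p / S.r p
  -- The wave equation gives `2(r ∂_u∂_v r - 2 ∂_u r ∂_v r) = Ω² (1 - 3μ/2) + 8π r² T_uv`.
  have key : 2 * (a * b) ≤ S.r p * c := by
    have x1 : 0 ≤ 8 * Real.pi * S.r p ^ 2 * S.Tuv p := by positivity
    have x2 : 0 ≤ S.Om2 p * (1 - 3 / 2 * μ) := mul_nonneg hO.le (by linarith)
    nlinarith
  have e2 : -1 * (-((S.r p ^ 2) ^ 2)⁻¹ * ((2 : ℕ) * S.r p ^ (2 - 1) * a)) * b +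
      -1 * (S.r p ^ 2)⁻¹ * c = (2 * (a * b) - S.r p * c) / S.r p ^ 3 := by
    field_simp
    push_cast
    ring
  rw [e2]
  exact div_nonpos_of_nonpos_of_nonneg (by linarith) (by positivity)

/-- Division of the bounds on `∂_u r`, `∂_v r` by `r²` makes them regular up to infinity, because
`(1 - Λr²/3)/r² = (1/r)² - Λ/3`. -/
theorem inv_r_bounds (h : S.IsControlled Λ U vI C₀ δ₀)
    (hw : ContDiffOn ℝ ∞ w₁ (domInfinity U vI)) (hwr : ∀ p ∈ dom U vI, w₁ p = (S.r p)⁻¹) :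
    ∀ p ∈ domInfinity U vI,
      (w₁ p ^ 2 + -Λ / 3) / Real.exp C₀ ≤ dU (domInfinity U vI) w₁ p ∧
      (w₁ p ^ 2 + -Λ / 3) / Real.exp C₀ ≤ -dV (domInfinity U vI) w₁ p ∧
      -dV (domInfinity U vI) w₁ p ≤ Real.exp C₀ * (w₁ p ^ 2 + -Λ / 3) := by
  have hD := h.uniqueDiff_infinity
  have c0 : ContinuousOn (fun p => w₁ p ^ 2 + -Λ / 3) (domInfinity U vI) :=
    (hw.continuousOn.pow 2).add continuousOn_const
  have c1 := (contDiffOn_dU hD hw).continuousOn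
  have c2 := (contDiffOn_dV hD hw).continuousOn.neg
  have key : ∀ p ∈ dom U vI, w₁ p ^ 2 + -Λ / 3 =
      (S.r p ^ 2)⁻¹ * (1 - 1 / 3 * Λ * S.r p ^ 2) := fun p hp => by
    have hr := h.sol.r_pos p hp
    rw [hwr p hp]
    field_simp
    ring
  refine fun p hp => ⟨le_on_domInfinity h.vI_pos (c0.div_const _) c1 (fun p hp => ?_) p hp,
    le_on_domInfinity h.vI_pos (c0.div_const _) c2 (fun p hp => ?_) p hp,
    le_on_domInfinity h.vI_pos c2 (c0.const_mul _) (fun p hp => ?_) p hp⟩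
  all_goals
    obtain ⟨b1, b2, b3, b4, -⟩ := h.dV_bounds hp
    obtain ⟨d1, d2⟩ := h.derivs_inv_r hw hwr hp
    have hr := h.sol.r_pos p hp
    have hi : 0 < (S.r p ^ 2)⁻¹ := by positivity
  · rw [key p hp, d1, mul_div_assoc, neg_mul, ← mul_neg]
    gcongr
  · simp only [Pi.neg_apply]
    rw [key p hp, d2, mul_div_assoc, neg_mul, neg_neg]
    gcongr
  · simp only [Pi.neg_apply]
    rw [key p hp, d2, neg_mul, neg_neg, mul_left_comm]
    gcongr

theorem conformal_pos (h : S.IsControlled Λ U vI C₀ δ₀)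
    (hw₂ : ContDiffOn ℝ ∞ w₂ (domInfinity U vI))
    (hwO : ∀ p ∈ dom U vI, w₂ p = S.Om2 p / S.r p ^ 2)
    (hw0 : ∀ p ∈ domInfinity U vI, p.2 = p.1 + vI → w₂ p ≠ 0) :
    ∀ p ∈ domInfinity U vI, 0 < w₂ p := by
  have hpos : ∀ p ∈ dom U vI, 0 < w₂ p := fun p hp => by
    have hr := h.sol.r_pos p hp
    have hO := h.sol.Om2_pos p hp
    rw [hwO p hp]
    positivity
  intro p hp
  rcases hp.2.2.2.lt_or_eq with hlt | heq
  · exact hpos p ⟨hp.1, hp.2.1, hp.2.2.1, hlt⟩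
  · exact lt_of_le_of_ne (le_on_domInfinity h.vI_pos continuousOn_const hw₂.continuousOn
      (fun p hp => (hpos p hp).le) p hp) (hw0 p hp heq).symm

/-- The mass aspect `2 m̃ / r³`, in terms of `1/r` and `Ω²/r²`, vanishes to third order at
conformal infinity. -/
theorem massAspect_bounds (h : S.IsControlled Λ U vI C₀ δ₀)
    (hw : ContDiffOn ℝ ∞ w₁ (domInfinity U vI)) (hwr : ∀ p ∈ dom U vI, w₁ p = (S.r p)⁻¹)
    (hw₂ : ContDiffOn ℝ ∞ w₂ (domInfinity U vI))
    (hwO : ∀ p ∈ dom U vI, w₂ p = S.Om2 p / S.r p ^ 2)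
    (hw0 : ∀ p ∈ domInfinity U vI, p.2 = p.1 + vI → w₂ p ≠ 0) :
    ∀ p ∈ domInfinity U vI,
      |w₁ p ^ 2 + -Λ / 3 +
        4 * (dU (domInfinity U vI) w₁ p * dV (domInfinity U vI) w₁ p * (w₂ p)⁻¹)| ≤
      2 / √(-Λ) * |w₁ p| ^ 3 := by
  have hD := h.uniqueDiff_infinity
  have hpos := h.conformal_pos hw₂ hwO hw0
  have c0 : ContinuousOn (fun p => w₁ p ^ 2 + -Λ / 3) (domInfinity U vI) :=
    (hw.continuousOn.pow 2).add continuousOn_const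
  have c1 := (contDiffOn_dU hD hw).continuousOn
  have c2 := (contDiffOn_dV hD hw).continuousOn
  have c3 := hw₂.continuousOn.inv₀ (fun p hp => (hpos p hp).ne')
  refine le_on_domInfinity h.vI_pos ((c0.add (((c1.mul c2).mul c3).const_mul 4)).abs)
    ((hw.continuousOn.abs.pow 3).const_mul _) fun p hp => ?_
  have hr := h.sol.r_pos p hp
  have hO := h.sol.Om2_pos p hp
  obtain ⟨d1, d2⟩ := h.derivs_inv_r hw hwr hp
  have m0 := h.renMass_nonneg hp
  have m3 := (h.mass_ratio hp).2.2
  have hΛ : 0 < √(-Λ) := Real.sqrt_pos.2 (by linarith [h.neg])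
  have e : w₁ p ^ 2 + -Λ / 3 +
      4 * (dU (domInfinity U vI) w₁ p * dV (domInfinity U vI) w₁ p * (w₂ p)⁻¹) =
      2 * S.renMass Λ (dom U vI) p * (S.r p)⁻¹ ^ 3 := by
    rw [d1, d2, hwr p hp, hwO p hp]
    simp only [renMass, hawkingMass]
    field_simp
    ring
  have hi : 0 < (S.r p)⁻¹ := inv_pos.2 hr
  rw [e, hwr p hp, abs_of_pos hi, abs_of_nonneg (by positivity)]
  have : S.renMass Λ (dom U vI) p ≤ 1 / √(-Λ) := by
    rw [le_div_iff₀ hΛ]; linarith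
  calc 2 * S.renMass Λ (dom U vI) p * (S.r p)⁻¹ ^ 3 ≤ 2 * (1 / √(-Λ)) * (S.r p)⁻¹ ^ 3 := by gcongr
    _ = _ := by ring

/-- At conformal infinity, `∂_v log (Ω²/r²)` is bounded by the derivative of `log (-∂_v (1/r))`
along conformal infinity. -/
theorem dV_conformal_le (h : S.IsControlled Λ U vI C₀ δ₀)
    (hw : ContDiffOn ℝ ∞ w₁ (domInfinity U vI)) (hwr : ∀ p ∈ dom U vI, w₁ p = (S.r p)⁻¹)
    (hwz : ∀ p ∈ domInfinity U vI, p.2 = p.1 + vI → w₁ p = 0)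
    (hw₂ : ContDiffOn ℝ ∞ w₂ (domInfinity U vI))
    (hwO : ∀ p ∈ dom U vI, w₂ p = S.Om2 p / S.r p ^ 2)
    (hw0 : ∀ p ∈ domInfinity U vI, p.2 = p.1 + vI → w₂ p ≠ 0)
    (hp : p ∈ domInfinity U vI) (hpI : p.2 = p.1 + vI) :
    dV (domInfinity U vI) (fun x => Real.log (w₂ x)) p ≤
      (dU (domInfinity U vI) (dV (domInfinity U vI) w₁) p +
        dV (domInfinity U vI) (dV (domInfinity U vI) w₁) p) / dV (domInfinity U vI) w₁ p := by
  have hD := h.uniqueDiff_infinity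
  have hpos := h.conformal_pos hw₂ hwO hw0 p hp
  have hX := Real.exp_pos C₀
  have hΛ := h.neg
  have hz := hwz p hp hpI
  obtain ⟨b1, b2, -⟩ := h.inv_r_bounds hw hwr p hp
  have hneg := h.dU_dV_inv_r_nonpos hw hwr p hp
  have hsym := dV_dU_comm convex_domInfinity
    (interior_domInfinity_nonempty h.U_pos h.vI_pos) hw hp
  have q1 := hasPartials_of_contDiffOn hw hp
  have q2 := hasPartials_of_contDiffOn (contDiffOn_dU hD hw) hp
  have q3 := hasPartials_of_contDiffOn (contDiffOn_dV hD hw) hp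
  have q4 := hasPartials_of_contDiffOn hw₂ hp
  have q5 := ((q1.pow 2).add (HasPartials.const (-Λ / 3))).add
    (((q2.mul q3).mul (q4.inv hpos.ne')).const_mul 4)
  -- Third-order vanishing implies zero derivative on infinity; equating it with the derivative of
  -- the explicit expression yields the relation between `∂_v w₂` and the second derivatives of
  -- `1/r`.
  have hO : (fun x => w₁ x ^ 2 + -Λ / 3 +
      4 * (dU (domInfinity U vI) w₁ x * dV (domInfinity U vI) w₁ x * (w₂ x)⁻¹))
      =O[𝓝[domInfinity U vI] p] fun x => ‖x - p‖ ^ 3 := by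
    have o1 : w₁ =O[𝓝[domInfinity U vI] p] fun x => ‖x - p‖ := by
      have := (hw.differentiableOn (by simp) p hp).isBigO_sub
      simp only [hz, sub_zero] at this
      exact this.norm_right
    refine Asymptotics.IsBigO.trans (g := fun x => w₁ x ^ 3) ?_ (o1.pow 3)
    refine Asymptotics.IsBigO.of_bound (2 / √(-Λ)) ?_
    filter_upwards [self_mem_nhdsWithin] with x hx
    rw [Real.norm_eq_abs, Real.norm_eq_abs, abs_pow]
    exact h.massAspect_bounds hw hwr hw₂ hwO hw0 x hx
  have q6 := HasPartials.of_hasFDerivWithinAt (hO.hasFDerivWithinAt (𝕜 := ℝ) hp (by norm_num))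
  have q7 := (q5.dV_eq (hD p hp)).symm.trans (q6.dV_eq (hD p hp))
  rw [(q4.log hpos.ne').dV_eq (hD p hp)]
  simp only [hz, zero_apply] at q7
  rw [hsym] at q7
  rw [hz] at b1 b2
  have hL : 0 < (0 ^ 2 + -Λ / 3) / Real.exp C₀ := by
    have : 0 < (0 ^ 2 + -Λ / 3) := by linarith
    positivity
  set x := dU (domInfinity U vI) w₁ p
  set y := dV (domInfinity U vI) w₁ p
  set c := dU (domInfinity U vI) (dV (domInfinity U vI) w₁) p
  set d := dV (domInfinity U vI) (dV (domInfinity U vI) w₁) p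
  set e := dV (domInfinity U vI) w₂ p
  set w := w₂ p
  have hx : 0 < x := by linarith
  have hy : y < 0 := by linarith
  have k1 : x * y * e = (c * y + x * d) * w := by
    have := hpos.ne'
    field_simp at q7
    simp only [show (2 - 1 : ℕ) = 1 from rfl] at q7
    ring_nf at q7 ⊢
    linarith
  have k2 : w⁻¹ * e = c / x + d / y := by
    have h1 := hpos.ne'
    have h2 := hx.ne'
    have h3 := hy.ne
    field_simp
    linarith
  rw [k2, add_div]
  -- In `∂_v log (Ω²/r²) = c/x + d/y` the first term is non-positive; replacing it by `c/y ≥ 0`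
  -- produces the tangential derivative `(c + d)/y` of `log (-y)`, which has a bounded primitive.
  have k3 : c / x ≤ 0 := div_nonpos_of_nonpos_of_nonneg hneg hx.le
  have k4 : 0 ≤ c / y := div_nonneg_of_nonpos hneg hy.le
  linarith

/-- The monotonicity in `u` extends to a first point on infinity: the sign of the derivative is
needed only in the interior of the segment. With both points inside it is the monotonicity itself.
-/
theorem Gv_le_infinity (h : S.IsControlled Λ U vI C₀ δ₀)
    (hw₂ : ContDiffOn ℝ ∞ w₂ (domInfinity U vI))
    (hwO : ∀ p ∈ dom U vI, w₂ p = S.Om2 p / S.r p ^ 2)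
    (hw0 : ∀ p ∈ domInfinity U vI, p.2 = p.1 + vI → w₂ p ≠ 0) {u u' v : ℝ}
    (hm : (u, v) ∈ domInfinity U vI) (hm' : (u', v) ∈ dom U vI) (hu : u ≤ u') :
    Gv S U vI (u', v) ≤ dV (domInfinity U vI) (fun x => Real.log (w₂ x)) (u, v) := by
  have hD := h.uniqueDiff_infinity
  have hpos := h.conformal_pos hw₂ hwO hw0
  have hL : ContDiffOn ℝ ∞ (fun x => Real.log (w₂ x)) (domInfinity U vI) :=
    hw₂.log fun p hp => (hpos p hp).ne'
  have heq : ∀ p ∈ dom U vI, dV (domInfinity U vI) (fun x => Real.log (w₂ x)) p = Gv S U vI p :=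
    fun p hp => by
    obtain ⟨a, ha⟩ := h.partials_log_conformal hp
    exact (h.derivs_infinity_eq hL hp (ha.congr (fun x hx => by rw [hwO x hx]) hp)).2
  rw [← heq _ hm']
  have hd := mem_domInfinity.1 hm
  have hd' := mem_dom.1 hm'
  have hI : ∀ x ∈ Icc u u', (x, v) ∈ domInfinity U vI := fun x hx =>
    ⟨hd.1.trans hx.1, lt_of_le_of_lt hx.2 hd'.2.1, lt_of_le_of_lt hx.2 hd'.2.2.1,
      by have := hx.1; simp only; linarith⟩
  have hI' : ∀ x ∈ Ioo u u', (x, v) ∈ dom U vI := fun x hx =>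
    ⟨hd.1.trans hx.1.le, hx.2.trans hd'.2.1, hx.2.trans hd'.2.2.1,
      by have := hx.1; simp only; linarith⟩
  have key : AntitoneOn (fun x => dV (domInfinity U vI) (fun x => Real.log (w₂ x)) (x, v))
      (Icc u u') := by
    refine antitoneOn_of_hasDerivWithinAt_nonpos (convex_Icc u u')
      (f' := fun x => -(S.Om2 (x, v) / (2 * S.r (x, v) ^ 2) *
        (1 - 3 * (2 * S.renMass Λ (dom U vI) (x, v) / S.r (x, v))))
        - 24 * Real.pi * S.Tuv (x, v)) ?_ ?_ ?_
    · exact (contDiffOn_dV hD hL).continuousOn.comp (by fun_prop) hI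
    · rw [interior_Icc]
      intro x hx
      obtain ⟨b, hb⟩ := h.partials_Gv (hI' x hx)
      exact (hb.congr heq (hI' x hx)).slice_u hI'
    · rw [interior_Icc]
      intro x hx
      have hr := h.sol.r_pos _ (hI' x hx)
      have hO := h.sol.Om2_pos _ (hI' x hx)
      obtain ⟨m1, m2, -⟩ := h.mass_ratio (hI' x hx)
      have t := Tuv_nonneg h.sol (hI' x hx)
      have x1 : 0 ≤ S.Om2 (x, v) / (2 * S.r (x, v) ^ 2) *
        (1 - 3 * (2 * S.renMass Λ (dom U vI) (x, v) / S.r (x, v))) :=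
        mul_nonneg (by positivity) (by linarith)
      have x2 : 0 ≤ 24 * Real.pi * S.Tuv (x, v) := by positivity
      linarith
  exact key (left_mem_Icc.2 hu) (right_mem_Icc.2 hu) hu

/-- Controlled solutions provide the background needed for the geodesic estimates. -/
theorem exists_background (h : S.IsControlled Λ U vI C₀ δ₀) : ∃ A A' : ℝ → ℝ,
    Background U vI (Real.exp C₀) (Real.pi / 2 / √(-Λ / 3))
      (fun x => Real.log (S.Om2 x / S.r x ^ 2)) (Gv S U vI) (fun x => tortoise Λ (S.r x)) A A' := by
  obtain ⟨w₁, hw, hwr, hwz⟩ := h.sol.infinity.inv_r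
  obtain ⟨w₂, hw₂, hwO, hw0⟩ := h.sol.infinity.conformal
  have hD := h.uniqueDiff_infinity
  have hv0 := h.vI_pos
  have hk : 0 < √(-Λ / 3) := Real.sqrt_pos.2 (by linarith [h.neg])
  have hmI : ∀ v ∈ Ico vI (U + vI), (v - vI, v) ∈ domInfinity U vI := fun v hv =>
    ⟨by simp only; linarith [hv.1], by simp only; linarith [hv.2], by simp only; linarith,
      by simp only; linarith⟩
  have hbd : ∀ v ∈ Ico vI (U + vI),
      0 < -dV (domInfinity U vI) w₁ (v - vI, v) ∧
      -Λ / 3 / Real.exp C₀ ≤ -dV (domInfinity U vI) w₁ (v - vI, v) ∧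
      -dV (domInfinity U vI) w₁ (v - vI, v) ≤ Real.exp C₀ * (-Λ / 3) := fun v hv => by
    obtain ⟨-, b2, b3⟩ := h.inv_r_bounds hw hwr _ (hmI v hv)
    rw [hwz _ (hmI v hv) (by simp)] at b2 b3
    have : 0 < -Λ / 3 / Real.exp C₀ := div_pos (by linarith [h.neg]) (Real.exp_pos _)
    rw [zero_pow two_ne_zero, zero_add] at b2 b3
    exact ⟨by linarith, b2, b3⟩
  -- `A` is `log (-∂_v (1/r))` on infinity, parametrised by `v`. Its argument lies between
  -- `(-Λ/3)/X` and `X (-Λ/3)`, which gives the oscillation factor `X ^ 2`.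
  refine ⟨fun v => Real.log (-dV (domInfinity U vI) w₁ (v - vI, v)),
    fun v => (dU (domInfinity U vI) (dV (domInfinity U vI) w₁) (v - vI, v) +
        dV (domInfinity U vI) (dV (domInfinity U vI) w₁) (v - vI, v)) /
        dV (domInfinity U vI) w₁ (v - vI, v), ?_⟩
  refine
    { X_large := h.exp_large
      RI_pos := by have := Real.pi_pos; positivity
      hasDeriv := fun u v hp => ?_
      anti := fun u u' v hm hm' hu => ?_
      hasDeriv_A := fun v hv1 hv2 => ?_
      le_A := fun u v hp hv => ?_
      A_osc := fun v v' h1 h2 h3 h4 => ?_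
      R_cont := fun p hp => HasFDerivWithinAt.continuousWithinAt (h.partials_tortoise hp)
      R_v := fun u v v' => h.tortoise_sub_v
      R_u := fun u u' v => h.tortoise_sub_u
      R_axis := fun u v => h.tortoise_axis
      R_inf := fun u v => h.tortoise_infinity
      lower := fun p hp => (h.conformal_tortoise hp).1
      upper := fun p hp => (h.conformal_tortoise hp).2 }
  · have hd := mem_dom.1 hp
    obtain ⟨a, ha⟩ := h.partials_log_conformal hp
    exact (ha.slice_v (s := Ioo u (u + vI)) fun y hy => ⟨hd.1, hd.2.1, hy.1, hy.2⟩).hasDerivAt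
      (Ioo_mem_nhds hd.2.2.1 hd.2.2.2)
  · have a := h.Gv_le_infinity hw₂ hwO hw0 (dom_subset_domInfinity hm) hm' hu
    obtain ⟨c, hc⟩ := h.partials_log_conformal hm
    have hpos := h.conformal_pos hw₂ hwO hw0
    have hL : ContDiffOn ℝ ∞ (fun x => Real.log (w₂ x)) (domInfinity U vI) :=
      hw₂.log fun p hp => (hpos p hp).ne'
    rwa [(h.derivs_infinity_eq hL hm (hc.congr (fun x hx => by rw [hwO x hx]) hm)).2] at a
  · have hv : v ∈ Ico vI (U + vI) := ⟨hv1, hv2⟩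
    have q3 := (hasPartials_of_contDiffOn (contDiffOn_dV hD hw) (hmI v hv)).const_mul (-1)
    have c1 : HasDerivWithinAt (fun y : ℝ => ((y - vI, y) : ℝ × ℝ)) (1, 1) (Ico vI (U + vI)) v :=
      ((hasDerivWithinAt_id v _).sub_const vI).prodMk (hasDerivWithinAt_id v _)
    have c2 := HasFDerivWithinAt.comp_hasDerivWithinAt
      (f := fun y : ℝ => ((y - vI, y) : ℝ × ℝ)) v q3 c1 hmI
    have c3 := c2.log (by simp only [Function.comp_apply]; linarith [(hbd v hv).1])
    have hne : dV (domInfinity U vI) w₁ (v - vI, v) ≠ 0 := (neg_pos.1 (hbd v hv).1).ne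
    refine (c3.congr_deriv ?_).congr_of_mem (fun x _ => ?_) hv
    · simp
      field_simp
      ring
    · simp
  · have hd := mem_dom.1 hp
    have hv' : v ∈ Ico vI (U + vI) := ⟨hv, by linarith⟩
    exact (h.Gv_le_infinity hw₂ hwO hw0 (hmI v hv') hp (by linarith)).trans
      (h.dV_conformal_le hw hwr hwz hw₂ hwO hw0 (hmI v hv') (by simp))
  · obtain ⟨p1, a1, a2⟩ := hbd v ⟨h1, h2⟩
    obtain ⟨p1', a1', a2'⟩ := hbd v' ⟨h3, h4⟩
    have hX := Real.exp_pos C₀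
    rw [Real.exp_sub, Real.exp_log p1, Real.exp_log p1', div_le_iff₀ p1']
    rw [div_le_iff₀ hX] at a1'
    nlinarith

end Fields.IsControlled

/-- The position `(u, v)`, the rescaled momenta `(p, q)` and the radius `R` are those of a geodesic
which started on the cone `v = v₀` with energy `E`, and which is either still ingoing or already
outgoing. -/
structure Tracked (X l E v₀ vI u v p q R : ℝ) : Prop where
  p_le : p ≤ Real.exp (X ^ 60) * E
  q_le : q ≤ Real.exp (X ^ 60) * E
  R_ge : l / E ≤ X ^ 6 * R
  v_ge : v₀ ≤ v
  dich : (u ≤ v₀ - X ^ 10 * (l / E) ∧ v ≤ v₀ + l / E ∧ v - v₀ ≤ (u - (v₀ - vI)) / 2 ∧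
      E ≤ X ^ 3 * p) ∨
    (v₀ - X ^ 10 * (l / E) ≤ u ∧ u ≤ v₀ + X ^ 49 * (l / E) ∧ E ≤ X ^ 32 * q)

/-! ### State of a ray relative to its incoming cone -/

namespace Tracked

variable {X l E v₀ vI u v p q R : ℝ}

/-- All inequalities are closed. The alternative might change along the filter, so an ultrafilter is
used to fix one side of it. -/
theorem of_tendsto {ι : Type*} {f : Filter ι} [f.NeBot] {E' v' : ι → ℝ}
    (hE : Tendsto E' f (𝓝 E)) (hE0 : 0 < E) (hv : Tendsto v' f (𝓝 v₀))
    (h : ∀ᶠ i in f, Tracked X l (E' i) (v' i) vI u v p q R) :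
    Tracked X l E v₀ vI u v p q R := by
  have hE := hE.mono_left (Ultrafilter.of_le f)
  have hv := hv.mono_left (Ultrafilter.of_le f)
  have h := h.filter_mono (Ultrafilter.of_le f)
  have hl : Tendsto (fun i => l / E' i) (Ultrafilter.of f) (𝓝 (l / E)) :=
    tendsto_const_nhds.div hE hE0.ne'
  refine ⟨le_of_tendsto_of_tendsto tendsto_const_nhds (hE.const_mul _) (h.mono fun i hi => hi.p_le),
    le_of_tendsto_of_tendsto tendsto_const_nhds (hE.const_mul _) (h.mono fun i hi => hi.q_le),
    le_of_tendsto hl (h.mono fun i hi => hi.R_ge),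
    le_of_tendsto hv (h.mono fun i hi => hi.v_ge), ?_⟩
  rcases Ultrafilter.eventually_or.1 (h.mono fun i hi => hi.dich) with h' | h'
  · exact Or.inl ⟨le_of_tendsto_of_tendsto tendsto_const_nhds (hv.sub (hl.const_mul _))
        (h'.mono fun i hi => hi.1),
      le_of_tendsto_of_tendsto tendsto_const_nhds (hv.add hl) (h'.mono fun i hi => hi.2.1),
      le_of_tendsto_of_tendsto (hv.const_sub v) (((hv.sub_const vI).const_sub u).div_const 2)
        (h'.mono fun i hi => hi.2.2.1),
      le_of_tendsto hE (h'.mono fun i hi => hi.2.2.2)⟩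
  · exact Or.inr ⟨le_of_tendsto (hv.sub (hl.const_mul _)) (h'.mono fun i hi => hi.1),
      le_of_tendsto_of_tendsto tendsto_const_nhds (hv.add (hl.const_mul _))
        (h'.mono fun i hi => hi.2.1),
      le_of_tendsto hE (h'.mono fun i hi => hi.2.2)⟩

theorem le_energy (h : Tracked X l E v₀ vI u v p q R) (hX : 1000 ≤ X) (hp : 0 < p) (hq : 0 < q) :
    E ≤ X ^ 33 * ((p + q) / 2) := by
  have key : ∀ n : ℕ, n ≤ 32 → ∀ x y : ℝ, 0 < x → 0 < y → E ≤ X ^ n * x →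
      E ≤ X ^ 33 * ((x + y) / 2) := fun n hn x y hx hy hE => by
    calc E ≤ X ^ n * x := hE
      _ ≤ X ^ 32 * x := by
        gcongr
        linarith
      _ ≤ X ^ 32 * (X * ((x + y) / 2)) := by
        gcongr
        nlinarith
      _ = _ := by ring
  rcases h.dich with ⟨-, -, -, h1⟩ | ⟨-, -, h1⟩
  · exact key 3 (by norm_num) p q hp hq h1
  · rw [add_comm]
    exact key 32 le_rfl q p hq hp h1

theorem energy_le (h : Tracked X l E v₀ vI u v p q R) : (p + q) / 2 ≤ Real.exp (X ^ 60) * E := by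
  linarith [h.p_le, h.q_le]

end Tracked

/-- A lower bound for one of the momenta where the radius is not too large. -/
theorem le_exp_mul_of_radius_le {X l ε E p q R : ℝ} {m : ℕ} (hX : 1000 ≤ X) (hm : 1 ≤ m)
    (hε : 0 < ε) (hE : 0 < E) (hl : l = ε * E) (hp : 0 < p) (hR0 : 0 < R)
    (hpq : 4 * l ^ 2 ≤ X * (p * q * R ^ 2)) (hq : q ≤ Real.exp (m * X ^ 60) * E)
    (hR : R ≤ X ^ (302 * m) * ε) : E ≤ Real.exp (m * X ^ 61) * p := by
  have hX0 : 0 < X := by linarith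
  have hm' : (1 : ℝ) ≤ m := by exact_mod_cast hm
  have h1 : E * (4 * ε ^ 2 * E) ≤ X ^ (604 * m + 1) * Real.exp (m * X ^ 60) * p * (ε ^ 2 * E) := by
    calc E * (4 * ε ^ 2 * E) = 4 * l ^ 2 := by rw [hl]; ring
      _ ≤ X * (p * q * R ^ 2) := hpq
      _ ≤ X * (p * (Real.exp (m * X ^ 60) * E) * (X ^ (302 * m) * ε) ^ 2) := by gcongr
      _ = _ := by ring
  have h2 : E ≤ X ^ (604 * m + 1) * Real.exp (m * X ^ 60) * p := by
    have : E * (ε ^ 2 * E) ≤ X ^ (604 * m + 1) * Real.exp (m * X ^ 60) * p * (ε ^ 2 * E) := by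
      refine le_trans ?_ h1
      have : 0 < E * (ε ^ 2 * E) := by positivity
      linarith
    exact le_of_mul_le_mul_right this (by positivity)
  refine h2.trans ?_
  gcongr
  calc X ^ (604 * m + 1) * Real.exp (m * X ^ 60)
      ≤ Real.exp X ^ (604 * m + 1) * Real.exp (m * X ^ 60) := by
        gcongr
        linarith [Real.add_one_le_exp X]
    _ = Real.exp ((604 * m + 1) * X + m * X ^ 60) := by
        rw [← Real.exp_nat_mul, ← Real.exp_add]
        push_cast
        rfl
    _ ≤ _ := by
        gcongr
        have y1 : X ≤ X ^ 60 := le_self_pow₀ (by linarith) (by norm_num)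
        calc (604 * m + 1) * X + m * X ^ 60 ≤ (605 * m) * X ^ 60 + m * X ^ 60 := by
              gcongr
              linarith
          _ = m * (606 * X ^ 60) := by ring
          _ ≤ m * (X * X ^ 60) := by gcongr; linarith
          _ = _ := by ring

/-- A lower bound for one momentum bounds the ratio of the momenta. -/
theorem ratio_le_of_le_mul {X l ε E p q ρ : ℝ} {m : ℕ} (hX : 1000 ≤ X) (hm : 1 ≤ m)
    (hE : 0 < E) (hl : l = ε * E) (hp : 0 < p) (hρ : 0 ≤ ρ) (hpq : p * q ≤ 5 * X * l ^ 2 * ρ)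
    (h : E ≤ Real.exp (m * X ^ 61) * p) :
    q / p ≤ Real.exp (m * X ^ 62) * ε ^ 2 * ρ := by
  have hX0 : 0 < X := by linarith
  have hm' : (1 : ℝ) ≤ m := by exact_mod_cast hm
  rw [div_le_iff₀ hp]
  have h1 : q * p ≤ Real.exp (m * X ^ 62) * ε ^ 2 * ρ * p * p := by
    calc q * p = p * q := mul_comm _ _
      _ ≤ 5 * X * l ^ 2 * ρ := hpq
      _ = 5 * X * ε ^ 2 * ρ * E ^ 2 := by rw [hl]; ring
      _ ≤ 5 * X * ε ^ 2 * ρ * (Real.exp (m * X ^ 61) * p) ^ 2 := by gcongr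
      _ = (5 * X) * Real.exp (m * X ^ 61) ^ 2 * (ε ^ 2 * ρ * p * p) := by ring
      _ ≤ Real.exp (m * X ^ 62) * (ε ^ 2 * ρ * p * p) := by
          gcongr
          rw [← Real.exp_nat_mul]
          calc 5 * X * Real.exp ((2 : ℕ) * (m * X ^ 61))
              ≤ Real.exp (5 * X) * Real.exp ((2 : ℕ) * (m * X ^ 61)) := by
                gcongr
                linarith [Real.add_one_le_exp (5 * X)]
            _ = Real.exp (5 * X + 2 * (m * X ^ 61)) := by
                rw [← Real.exp_add]
                push_cast
                rfl
            _ ≤ _ := by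
                gcongr
                have y1 : X ≤ X ^ 61 := le_self_pow₀ (by linarith) (by norm_num)
                have y2 : 0 < X ^ 61 := by positivity
                calc 5 * X + 2 * (m * X ^ 61) ≤ 5 * (m * X ^ 61) + 2 * (m * X ^ 61) := by
                      gcongr
                      nlinarith
                  _ = 7 * (m * X ^ 61) := by ring
                  _ ≤ X * (m * X ^ 61) := by gcongr; linarith
                  _ = _ := by ring
      _ = _ := by ring
  exact le_of_mul_le_mul_right h1 hp

/-! ### Transfer to geodesics of a controlled solution -/

namespace Fields.IsControlled

variable {S : Fields} {Λ U vI C₀ δ₀ l : ℝ} {J : Set ℝ} {γ : PhaseCurve}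

theorem ray (h : S.IsControlled Λ U vI C₀ δ₀) (hg : IsNullGeodesic S U vI l J γ) (hl : 0 < l) :
    Ray U vI (fun x => Real.log (S.Om2 x / S.r x ^ 2)) (Gv S U vI) l J
      (fun s => (S.Om2 (γ.pt s))⁻¹) γ.u γ.v (fun s => S.Om2 (γ.pt s) * γ.pu s)
      (fun s => S.Om2 (γ.pt s) * γ.pv s) := by
  have hO : ∀ s ∈ J, 0 < S.Om2 (γ.pt s) := fun s hs => h.sol.Om2_pos _ (hg.mem s hs)
  have hr : ∀ s ∈ J, 0 < S.r (γ.pt s) := fun s hs => h.sol.r_pos _ (hg.mem s hs)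
  have hne : ∀ s ∈ J, 0 < S.Om2 (γ.pt s) * γ.pu s * γ.pv s := fun s hs => by
    have := hr s hs
    rw [hg.null s hs]
    positivity
  refine ⟨hl, hg.mem, fun s hs => inv_pos.2 (hO s hs), fun s hs => mul_pos (hO s hs) ?_,
    fun s hs => mul_pos (hO s hs) ?_, fun s hs => ?_, fun s hs => ?_, fun s hs => ?_,
    fun s hs => ?_⟩
  · refine lt_of_le_of_ne (hg.future_u s hs) fun h0 => ?_
    have := hne s hs
    rw [← h0] at this
    simp at this
  · refine lt_of_le_of_ne (hg.future_v s hs) fun h0 => ?_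
    have := hne s hs
    rw [← h0] at this
    simp at this
  · rw [inv_mul_cancel_left₀ (hO s hs).ne']
    exact hg.deriv_u s hs
  · rw [inv_mul_cancel_left₀ (hO s hs).ne']
    exact hg.deriv_v s hs
  · refine (hg.motion_u s hs).congr_deriv ?_
    rw [inv_mul_cancel_left₀ (hO s hs).ne', ← hg.null s hs]
    simp only [Gv, PhaseCurve.pt]
    ring
  · have e := h.exp_log_conformal (hg.mem s hs)
    simp only [PhaseCurve.pt] at e ⊢
    rw [e]
    have := hg.null s hs
    simp only [PhaseCurve.pt] at this
    calc S.Om2 (γ.u s, γ.v s) * γ.pu s * (S.Om2 (γ.u s, γ.v s) * γ.pv s)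
        = S.Om2 (γ.u s, γ.v s) * (S.Om2 (γ.u s, γ.v s) * γ.pu s * γ.pv s) := by ring
      _ = _ := by rw [this]; ring

/-- Upper bound for the product of the rescaled momenta. -/
theorem mul_momenta_le (h : S.IsControlled Λ U vI C₀ δ₀) (hg : IsNullGeodesic S U vI l J γ)
    {s : ℝ} (hs : s ∈ J) :
    S.Om2 (γ.pt s) * γ.pu s * (S.Om2 (γ.pt s) * γ.pv s) ≤
      5 * Real.exp C₀ * l ^ 2 * ((1 - 1 / 3 * Λ * S.r (γ.pt s) ^ 2) / S.r (γ.pt s) ^ 2) := by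
  have hr := h.sol.r_pos _ (hg.mem s hs)
  have hκ := h.kappa_pos (γ.pt s)
  have hX := Real.exp_pos C₀
  calc _ = S.Om2 (γ.pt s) * (S.Om2 (γ.pt s) * γ.pu s * γ.pv s) := by ring
    _ = S.Om2 (γ.pt s) * (l ^ 2 / S.r (γ.pt s) ^ 2) := by rw [hg.null s hs]
    _ ≤ 400 / 99 * Real.exp C₀ * (1 - 1 / 3 * Λ * S.r (γ.pt s) ^ 2) *
        (l ^ 2 / S.r (γ.pt s) ^ 2) := by
        gcongr
        exact (h.conformal_bounds (hg.mem s hs)).2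
    _ ≤ 5 * Real.exp C₀ * (1 - 1 / 3 * Λ * S.r (γ.pt s) ^ 2) * (l ^ 2 / S.r (γ.pt s) ^ 2) := by
        gcongr
        norm_num
    _ = _ := by ring

theorem tracked (h : S.IsControlled Λ U vI C₀ δ₀) (hg : IsNullGeodesic S U vI l J γ) (hl : 0 < l)
    (hJ : J.OrdConnected) {s₀ s : ℝ} (hs₀ : s₀ ∈ J) (hs : s ∈ J) (hss : s₀ ≤ s)
    (hpq : γ.pv s₀ ≤ γ.pu s₀)
    (hRI : Real.exp C₀ ^ 40 * (l / energy S γ s₀) ≤ Real.pi / 2 / √(-Λ / 3))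
    (hR : Real.exp C₀ ^ 20 * (l / energy S γ s₀) ≤ tortoise Λ (S.r (γ.pt s₀))) :
    Tracked (Real.exp C₀) l (energy S γ s₀) (γ.v s₀) vI (γ.u s) (γ.v s)
      (S.Om2 (γ.pt s) * γ.pu s) (S.Om2 (γ.pt s) * γ.pv s) (tortoise Λ (S.r (γ.pt s))) := by
  obtain ⟨A, A', hB⟩ := h.exists_background
  have hray := (h.ray hg hl).mono (hJ.out hs₀ hs)
  have h0 : s₀ ∈ Icc s₀ s := left_mem_Icc.2 hss
  have hE : 0 < energy S γ s₀ := by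
    have := hray.p_pos _ h0
    have := hray.q_pos _ h0
    simp only [energy]
    linarith
  have hX := h.exp_large
  have hO := h.sol.Om2_pos _ (hg.mem s₀ hs₀)
  have hexp : 5 * Real.exp C₀ ^ 4 ≤ Real.exp (Real.exp C₀ ^ 60) := by
    calc 5 * Real.exp C₀ ^ 4 ≤ Real.exp C₀ * Real.exp C₀ ^ 4 := by gcongr; linarith
      _ = Real.exp C₀ ^ 5 := by ring
      _ ≤ Real.exp C₀ ^ 60 := pow_le_pow_right₀ (by linarith) (by norm_num)
      _ ≤ Real.exp C₀ ^ 60 + 1 := by linarith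
      _ ≤ _ := Real.add_one_le_exp _
  obtain ⟨a, b, c, d⟩ := Ray.passage (ε := l / energy S γ s₀) (E := energy S γ s₀) hB hray hss
    (by positivity) (by field_simp) (by simp only [energy]; ring) (by gcongr) hRI hR
  refine ⟨a.trans (by gcongr), b, c, hray.mono_v h0 (right_mem_Icc.2 hss) hss, ?_⟩
  rcases d with ⟨d1, d2, d3, d4⟩ | d
  -- The starting point has `u s₀ > v s₀ - vI`. Weakening to `v s₀ - vI` removes `u s₀` from the
  -- conclusion, which then survives limits of starting points.
  · refine Or.inl ⟨d1, d2, d3.trans ?_, d4⟩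
    have := (mem_dom.1 (hg.mem s₀ hs₀)).2.2.2
    linarith
  · exact Or.inr d

theorem momenta_radius (h : S.IsControlled Λ U vI C₀ δ₀) (hg : IsNullGeodesic S U vI l J γ)
    (hl : 0 < l) {s : ℝ} (hs : s ∈ J) :
    0 < S.Om2 (γ.pt s) * γ.pu s ∧ 0 < S.Om2 (γ.pt s) * γ.pv s ∧
    0 < tortoise Λ (S.r (γ.pt s)) ∧ tortoise Λ (S.r (γ.pt s)) ≤ S.r (γ.pt s) ∧
    tortoise Λ (S.r (γ.pt s)) ≤ Real.exp C₀ * (γ.v s - γ.u s) ∧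
    4 * l ^ 2 ≤ Real.exp C₀ * (S.Om2 (γ.pt s) * γ.pu s * (S.Om2 (γ.pt s) * γ.pv s) *
      tortoise Λ (S.r (γ.pt s)) ^ 2) ∧
    S.Om2 (γ.pt s) * γ.pu s * (S.Om2 (γ.pt s) * γ.pv s) * tortoise Λ (S.r (γ.pt s)) ^ 2 ≤
      10 * Real.exp C₀ * l ^ 2 := by
  obtain ⟨A, A', hB⟩ := h.exists_background
  have hray := h.ray hg hl
  obtain ⟨q1, q2⟩ := Ray.q_bounds hB hray hs
  exact ⟨hray.p_pos s hs, hray.q_pos s hs, hB.R_pos (hg.mem s hs),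
    tortoise_le h.neg (h.sol.r_pos _ (hg.mem s hs)), (h.tortoise_axis (hg.mem s hs)).2, q1, q2⟩

theorem radius_infinity_ge (h : S.IsControlled Λ U vI C₀ δ₀) {Y ε : ℝ} (hε : 0 < ε)
    (hY : ε * √(-Λ) ≤ Y⁻¹) (hY0 : 0 < Y) : Y * ε ≤ Real.pi / 2 / √(-Λ / 3) := by
  have hΛ := h.neg
  have hs : 0 < √(-Λ / 3) := Real.sqrt_pos.2 (by linarith)
  have hs2 : √(-Λ / 3) ≤ √(-Λ) := Real.sqrt_le_sqrt (by linarith)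
  rw [le_div_iff₀ hs]
  have : Y * ε * √(-Λ / 3) ≤ Y * Y⁻¹ := by
    calc Y * ε * √(-Λ / 3) ≤ Y * ε * √(-Λ) := by gcongr
      _ = Y * (ε * √(-Λ)) := by ring
      _ ≤ _ := by gcongr
  rw [mul_inv_cancel₀ hY0.ne'] at this
  have := Real.pi_gt_three
  linarith

/-- `R` saturates at large `r`, so a lower bound on `r` alone is not enough; `Y ε √(-Λ) ≤ 1` keeps
`Y ε` below the saturation scale. -/
theorem tortoise_ge (h : S.IsControlled Λ U vI C₀ δ₀) {Y ε r : ℝ} (hε : 0 < ε)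
    (hY : ε * √(-Λ) ≤ Y⁻¹) (hY0 : 0 < Y) (hr : Y * ε ≤ r) (hR : 0 < tortoise Λ r) :
    Y * ε ≤ 2 * tortoise Λ r := by
  have hΛ := h.neg
  have hy : 0 < Y * ε := by positivity
  have hr0 : 0 < r := by linarith
  have b := (tortoise_bounds hΛ hr0).1
  have hsq : √(-Λ) ^ 2 = -Λ := Real.sq_sqrt (by linarith)
  have h1 : (Y * ε) ^ 2 * -Λ ≤ 1 := by
    have : Y * ε * √(-Λ) ≤ 1 := by
      calc Y * ε * √(-Λ) = Y * (ε * √(-Λ)) := by ring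
        _ ≤ Y * Y⁻¹ := by gcongr
        _ = 1 := mul_inv_cancel₀ hY0.ne'
    calc (Y * ε) ^ 2 * -Λ = (Y * ε * √(-Λ)) ^ 2 := by rw [mul_pow _ (√(-Λ)), hsq]
      _ ≤ 1 := pow_le_one₀ (by positivity) this
  have h2 : (Y * ε) ^ 2 ≤ r ^ 2 := by gcongr
  have hκ : 0 < 1 - 1 / 3 * Λ * r ^ 2 := by nlinarith [sq_nonneg r]
  have h3 : (Y * ε) ^ 2 * (1 - 1 / 3 * Λ * r ^ 2) ≤ (2 * tortoise Λ r) ^ 2 *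
      (1 - 1 / 3 * Λ * r ^ 2) := by
    have : (Y * ε) ^ 2 * -Λ * r ^ 2 ≤ 1 * r ^ 2 := by gcongr
    nlinarith
  exact (sq_le_sq₀ hy.le (by positivity)).1 (le_of_mul_le_mul_right h3 hκ)

end Fields.IsControlled

theorem ordConnected_initInterval (a : EReal) : (initInterval a).OrdConnected :=
  ⟨fun _ hx _ hy _ hz => ⟨hx.1.trans hz.1, lt_of_le_of_lt (EReal.coe_le_coe_iff.2 hz.2) hy.2⟩⟩

theorem zero_mem_initInterval {a : EReal} (ha : 0 < a) : (0 : ℝ) ∈ initInterval a :=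
  ⟨le_rfl, by simpa using ha⟩

/-! ### Momentum ratios and one passage -/

namespace Fields.IsControlled

variable {S : Fields} {Λ U vI C₀ δ₀ l : ℝ} {J : Set ℝ} {γ : PhaseCurve}

theorem energy_pos (h : S.IsControlled Λ U vI C₀ δ₀) (hg : IsNullGeodesic S U vI l J γ)
    (hl : 0 < l) {s : ℝ} (hs : s ∈ J) : 0 < energy S γ s := by
  obtain ⟨hp, hq, -⟩ := h.momenta_radius hg hl hs
  simp only [energy]
  linarith

/-- The ratio of the momenta, in terms of a lower bound for one of them. -/
theorem ratio_v_le (h : S.IsControlled Λ U vI C₀ δ₀) (hg : IsNullGeodesic S U vI l J γ)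
    (hl : 0 < l) {s E : ℝ} {m : ℕ} (hs : s ∈ J) (hm : 1 ≤ m) (hE : 0 < E)
    (hp : E ≤ Real.exp (m * Real.exp C₀ ^ 61) * (S.Om2 (γ.pt s) * γ.pu s)) :
    γ.pv s / γ.pu s ≤ Real.exp (m * Real.exp C₀ ^ 62) * (l ^ 2 / E ^ 2) *
      ((1 - 1 / 3 * Λ * S.r (γ.pt s) ^ 2) / S.r (γ.pt s) ^ 2) := by
  have hO := h.sol.Om2_pos _ (hg.mem s hs)
  have hκ := h.kappa_pos (γ.pt s)
  rw [← mul_div_mul_left _ _ hO.ne', ← div_pow]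
  exact ratio_le_of_le_mul h.exp_large hm hE (by field_simp) (h.momenta_radius hg hl hs).1
    (by positivity) (h.mul_momenta_le hg hs) hp

theorem ratio_u_le (h : S.IsControlled Λ U vI C₀ δ₀) (hg : IsNullGeodesic S U vI l J γ)
    (hl : 0 < l) {s E : ℝ} {m : ℕ} (hs : s ∈ J) (hm : 1 ≤ m) (hE : 0 < E)
    (hq : E ≤ Real.exp (m * Real.exp C₀ ^ 61) * (S.Om2 (γ.pt s) * γ.pv s)) :
    γ.pu s / γ.pv s ≤ Real.exp (m * Real.exp C₀ ^ 62) * (l ^ 2 / E ^ 2) *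
      ((1 - 1 / 3 * Λ * S.r (γ.pt s) ^ 2) / S.r (γ.pt s) ^ 2) := by
  have hO := h.sol.Om2_pos _ (hg.mem s hs)
  have hκ := h.kappa_pos (γ.pt s)
  rw [← mul_div_mul_left _ _ hO.ne', ← div_pow]
  refine ratio_le_of_le_mul h.exp_large hm hE (by field_simp) (h.momenta_radius hg hl hs).2.1
    (by positivity) ?_ hq
  rw [mul_comm]
  exact h.mul_momenta_le hg hs

/-- A polynomial bound is weaker than the exponential one. -/
theorem le_exp_mul_of_le_pow (h : S.IsControlled Λ U vI C₀ δ₀) {E p : ℝ} {m k : ℕ} (hm : 1 ≤ m)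
    (hk : k ≤ 70 * m) (hp : 0 < p) (hE : E ≤ Real.exp C₀ ^ k * p) :
    E ≤ Real.exp (m * Real.exp C₀ ^ 61) * p := by
  have hX := h.exp_large
  refine hE.trans ?_
  gcongr
  have hm' : (1 : ℝ) ≤ m := by exact_mod_cast hm
  calc Real.exp C₀ ^ k ≤ Real.exp (Real.exp C₀) ^ k := by
        gcongr
        linarith [Real.add_one_le_exp C₀]
    _ = Real.exp (k * Real.exp C₀) := by rw [Real.exp_nat_mul]
    _ ≤ _ := by
        refine Real.exp_le_exp.2 ?_
        have hk' : (k : ℝ) ≤ 70 * m := by exact_mod_cast hk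
        calc (k : ℝ) * Real.exp C₀ ≤ (70 * m) * Real.exp C₀ := by gcongr
          _ = m * (70 * Real.exp C₀) := by ring
          _ ≤ m * (Real.exp C₀ * Real.exp C₀) := by gcongr; linarith
          _ = m * Real.exp C₀ ^ 2 := by ring
          _ ≤ _ := by
            gcongr
            · linarith
            · norm_num

theorem le_exp_mul_pu (h : S.IsControlled Λ U vI C₀ δ₀) (hg : IsNullGeodesic S U vI l J γ)
    (hl : 0 < l) {s E : ℝ} {m : ℕ} (hs : s ∈ J) (hm : 1 ≤ m) (hE : 0 < E)
    (hq : S.Om2 (γ.pt s) * γ.pv s ≤ Real.exp (m * Real.exp C₀ ^ 60) * E)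
    (hd : Real.exp C₀ * (γ.v s - γ.u s) ≤ Real.exp C₀ ^ (302 * m) * (l / E)) :
    E ≤ Real.exp (m * Real.exp C₀ ^ 61) * (S.Om2 (γ.pt s) * γ.pu s) := by
  obtain ⟨y1, y2, y3, y4, y5, y6, y7⟩ := h.momenta_radius hg hl hs
  exact le_exp_mul_of_radius_le h.exp_large hm (by positivity) hE (by field_simp) y1 y3 y6 hq
    (y5.trans hd)

theorem le_exp_mul_pv (h : S.IsControlled Λ U vI C₀ δ₀) (hg : IsNullGeodesic S U vI l J γ)
    (hl : 0 < l) {s E : ℝ} {m : ℕ} (hs : s ∈ J) (hm : 1 ≤ m) (hE : 0 < E)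
    (hp : S.Om2 (γ.pt s) * γ.pu s ≤ Real.exp (m * Real.exp C₀ ^ 60) * E)
    (hd : Real.exp C₀ * (γ.v s - γ.u s) ≤ Real.exp C₀ ^ (302 * m) * (l / E)) :
    E ≤ Real.exp (m * Real.exp C₀ ^ 61) * (S.Om2 (γ.pt s) * γ.pv s) := by
  obtain ⟨y1, y2, y3, y4, y5, y6, y7⟩ := h.momenta_radius hg hl hs
  refine le_exp_mul_of_radius_le h.exp_large hm (by positivity) hE (by field_simp) y2 y3 ?_ hp
    (y5.trans hd)
  rwa [mul_comm (S.Om2 (γ.pt s) * γ.pv s)]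

/-- The positivity hidden in the smallness assumption on the angular momentum. -/
theorem _root_.EinsteinVlasov.IsNullGeodesic.pos_of_small (hg : IsNullGeodesic S U vI l J γ)
    {s : ℝ} (hs : 0 < l / energy S γ s * √(-Λ)) : 0 < l :=
  hg.l_nonneg.lt_of_ne fun h0 => by simp [← h0] at hs

/-- A geodesic through a point far from the axis, relative to its impact parameter, is tracked. -/
theorem tracked_of_small (h : S.IsControlled Λ U vI C₀ δ₀) (hg : IsNullGeodesic S U vI l J γ)
    (hl : 0 < l) (hJ : J.OrdConnected) {s₀ s : ℝ} (hs₀ : s₀ ∈ J) (hs : s ∈ J) (hss : s₀ ≤ s)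
    (hpq : γ.pv s₀ ≤ γ.pu s₀) (hε : l / energy S γ s₀ * √(-Λ) ≤ (Real.exp C₀ ^ 50)⁻¹)
    (hr : Real.exp C₀ ^ 50 * (l / energy S γ s₀) ≤ S.r (γ.pt s₀)) :
    Tracked (Real.exp C₀) l (energy S γ s₀) (γ.v s₀) vI (γ.u s) (γ.v s)
      (S.Om2 (γ.pt s) * γ.pu s) (S.Om2 (γ.pt s) * γ.pv s) (tortoise Λ (S.r (γ.pt s))) := by
  have hX := h.exp_large
  have hE := h.energy_pos hg hl hs₀
  have hε0 : 0 < l / energy S γ s₀ := by positivity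
  refine h.tracked hg hl hJ hs₀ hs hss hpq ?_ ?_
  · refine le_trans ?_ (h.radius_infinity_ge hε0 hε (by positivity))
    gcongr
    · linarith
    · norm_num
  · have := h.tortoise_ge hε0 hε (by positivity) hr (h.momenta_radius hg hl hs₀).2.2.1
    have h2 : 2 * Real.exp C₀ ^ 20 ≤ Real.exp C₀ ^ 50 := by
      calc 2 * Real.exp C₀ ^ 20 ≤ Real.exp C₀ * Real.exp C₀ ^ 20 := by gcongr; linarith
        _ = Real.exp C₀ ^ 21 := by ring
        _ ≤ _ := pow_le_pow_right₀ (by linarith) (by norm_num)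
    have : 2 * Real.exp C₀ ^ 20 * (l / energy S γ s₀) ≤
      Real.exp C₀ ^ 50 * (l / energy S γ s₀) := by gcongr
    linarith

/-- One passage of a geodesic, from the initial point through the centre to infinity. -/
theorem one_passage (h : S.IsControlled Λ U vI C₀ δ₀) {a : EReal} {E₀ u₀ v₀ : ℝ} (ha : 0 < a)
    (hg : IsNullGeodesic S U vI l (initInterval a) γ) (hpq : γ.pv 0 < γ.pu 0)
    (hE₀ : E₀ = energy S γ 0) (hl0 : 0 < l / E₀ * √(-Λ))
    (hl1 : l / E₀ * √(-Λ) ≤ Real.exp (-50 * C₀))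
    (hr : Real.exp (50 * C₀) * (l / E₀) ≤ S.r (γ.pt 0)) (h0 : (u₀, v₀) = γ.pt 0) :
    (∀ s ∈ initInterval a,
      γ.pt s ∈ {p | Real.exp (-6 * C₀) * (l / E₀) ≤ S.r p} ∩
        (rectIn u₀ v₀ (Real.exp (150 * C₀) * (l / E₀)) ∪
          rectOut v₀ vI (Real.exp (150 * C₀) * (l / E₀))) ∩ dom U vI) ∧
    (∀ s ∈ initInterval a,
      Real.exp (-100 * C₀) * E₀ ≤ energy S γ s ∧
      energy S γ s ≤ Real.exp (Real.exp (200 * C₀)) * E₀) ∧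
    (∀ sc : EReal,
      sc = sSup ((fun s : ℝ => (s : EReal)) ''
        {s : ℝ | 0 < s ∧ (s : EReal) < a ∧ γ.u s + γ.v s ≤ 2 * v₀}) →
      (∀ s : ℝ, 0 ≤ s → (s : EReal) < sc →
        γ.pv s / γ.pu s ≤ Real.exp (Real.exp (200 * C₀)) * (l ^ 2 / E₀ ^ 2) *
          ((1 - 1 / 3 * Λ * S.r (γ.pt s) ^ 2) / S.r (γ.pt s) ^ 2)) ∧
      (∀ s : ℝ, sc < (s : EReal) → (s : EReal) < a →
        γ.pu s / γ.pv s ≤ Real.exp (Real.exp (200 * C₀)) * (l ^ 2 / E₀ ^ 2) *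
          ((1 - 1 / 3 * Λ * S.r (γ.pt s) ^ 2) / S.r (γ.pt s) ^ 2))) := by
  have hl : 0 < l := hg.pos_of_small (hE₀ ▸ hl0)
  have hJ := ordConnected_initInterval a
  have hz := zero_mem_initInterval ha
  have hE : 0 < E₀ := hE₀ ▸ h.energy_pos hg hl hz
  obtain ⟨rfl, rfl⟩ : u₀ = γ.u 0 ∧ v₀ = γ.v 0 := Prod.mk.inj h0
  have e50 : Real.exp (50 * C₀) = Real.exp C₀ ^ 50 := by rw [← Real.exp_nat_mul]; norm_num
  have e150 : Real.exp (150 * C₀) = Real.exp C₀ ^ 150 := by rw [← Real.exp_nat_mul]; norm_num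
  have e200 : Real.exp (200 * C₀) = Real.exp C₀ ^ 200 := by rw [← Real.exp_nat_mul]; norm_num
  have e50' : Real.exp (-50 * C₀) = (Real.exp C₀ ^ 50)⁻¹ := by
    rw [← e50, ← Real.exp_neg]; congr 1; ring
  have e6' : Real.exp (-6 * C₀) = (Real.exp C₀ ^ 6)⁻¹ := by
    rw [← Real.exp_nat_mul, ← Real.exp_neg]; congr 1; push_cast; ring
  have e100' : Real.exp (-100 * C₀) = (Real.exp C₀ ^ 100)⁻¹ := by
    rw [← Real.exp_nat_mul, ← Real.exp_neg]; congr 1; push_cast; ring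
  rw [e50'] at hl1
  rw [e50] at hr
  rw [e150, e200, e6', e100']
  have hX := h.exp_large
  have T : ∀ s ∈ initInterval a, Tracked (Real.exp C₀) l E₀ (γ.v 0) vI (γ.u s) (γ.v s)
      (S.Om2 (γ.pt s) * γ.pu s) (S.Om2 (γ.pt s) * γ.pv s) (tortoise Λ (S.r (γ.pt s))) := by
    intro s hs
    subst hE₀
    exact h.tracked_of_small hg hl hJ hz hs hs.1 hpq.le hl1 hr
  have hray := h.ray hg hl
  have mono : ∀ s ∈ initInterval a, ∀ t ∈ initInterval a, s ≤ t →
      γ.u s ≤ γ.u t ∧ γ.v s ≤ γ.v t := fun s hs t ht hst =>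
    ⟨(hray.mono (hJ.out hs ht)).mono_u (left_mem_Icc.2 hst) (right_mem_Icc.2 hst) hst,
      (hray.mono (hJ.out hs ht)).mono_v (left_mem_Icc.2 hst) (right_mem_Icc.2 hst) hst⟩
  have hε : 0 < l / E₀ := by positivity
  set X := Real.exp C₀ with hXdef
  have hX1 : 1 ≤ X := by linarith
  have w1 : l / E₀ ≤ X ^ 150 * (l / E₀) := le_mul_of_one_le_left hε.le (one_le_pow₀ hX1)
  have w2 : X ^ 49 * (l / E₀) ≤ X ^ 150 * (l / E₀) := by
    gcongr
    norm_num
  have w3 : X ^ 10 * (l / E₀) ≤ X ^ 150 * (l / E₀) := by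
    gcongr
    norm_num
  have w4 : 0 ≤ X ^ 10 * (l / E₀) := by positivity
  have E1 : Real.exp ((1 : ℕ) * X ^ 62) ≤ Real.exp (X ^ 200) := by
    simp only [Nat.cast_one, one_mul]
    gcongr
    norm_num
  have weaken : ∀ s : ℝ, Real.exp ((1 : ℕ) * X ^ 62) * (l ^ 2 / E₀ ^ 2) *
      ((1 - 1 / 3 * Λ * S.r (γ.pt s) ^ 2) / S.r (γ.pt s) ^ 2) ≤
      Real.exp (X ^ 200) * (l ^ 2 / E₀ ^ 2) *
      ((1 - 1 / 3 * Λ * S.r (γ.pt s) ^ 2) / S.r (γ.pt s) ^ 2) := fun s => by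
    have hκ := h.kappa_pos (γ.pt s)
    gcongr
  refine ⟨fun s hs => ⟨⟨?_, ?_⟩, hg.mem s hs⟩, fun s hs => ⟨?_, ?_⟩, fun sc hsc => ⟨?_, ?_⟩⟩
  · obtain ⟨-, -, -, y4, -⟩ := h.momenta_radius hg hl hs
    have := (T s hs).R_ge
    change (X ^ 6)⁻¹ * (l / E₀) ≤ S.r (γ.pt s)
    rw [inv_mul_le_iff₀ (by positivity)]
    exact this.trans (by gcongr)
  · have hu := (mono 0 hz s hs hs.1).1
    have hv := (T s hs).v_ge
    have hd := mem_dom.1 (hg.mem s hs)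
    rcases (T s hs).dich with ⟨d1, d2, -⟩ | ⟨d1, d2, -⟩
    · exact Or.inl ⟨⟨hu, by dsimp only [PhaseCurve.pt]; linarith⟩,
        ⟨by dsimp only [PhaseCurve.pt]; linarith, by dsimp only [PhaseCurve.pt]; linarith⟩⟩
    · exact Or.inr ⟨⟨by dsimp only [PhaseCurve.pt]; linarith,
        by dsimp only [PhaseCurve.pt]; linarith⟩,
        ⟨by dsimp only [PhaseCurve.pt]; linarith, by dsimp only [PhaseCurve.pt]; linarith⟩⟩
  · obtain ⟨y1, y2, -⟩ := h.momenta_radius hg hl hs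
    rw [inv_mul_le_iff₀ (by positivity)]
    refine ((T s hs).le_energy hX y1 y2).trans ?_
    have : (S.Om2 (γ.pt s) * γ.pu s + S.Om2 (γ.pt s) * γ.pv s) / 2 = energy S γ s := by
      simp only [energy]; ring
    rw [this]
    have := h.energy_pos hg hl hs
    gcongr
    norm_num
  · have : (S.Om2 (γ.pt s) * γ.pu s + S.Om2 (γ.pt s) * γ.pv s) / 2 = energy S γ s := by
      simp only [energy]; ring
    rw [← this]
    refine (T s hs).energy_le.trans ?_
    gcongr
    norm_num
  · intro s hs0 hsc'
    rw [hsc] at hsc'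
    obtain ⟨_, ⟨t, ⟨ht0, hta, htv⟩, rfl⟩, hst⟩ := lt_sSup_iff.1 hsc'
    have hst : s < t := EReal.coe_lt_coe_iff.1 hst
    have hs : s ∈ initInterval a := ⟨hs0, lt_trans (EReal.coe_lt_coe_iff.2 hst) hta⟩
    obtain ⟨m1, m2⟩ := mono s hs t ⟨ht0.le, hta⟩ hst.le
    refine (h.ratio_v_le hg hl hs le_rfl hE ?_).trans (weaken s)
    rcases (T s hs).dich with ⟨-, -, -, d⟩ | ⟨d, -, -⟩
    · exact h.le_exp_mul_of_le_pow le_rfl (by norm_num) (h.momenta_radius hg hl hs).1 d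
    -- Already past the cut but still `u + v ≤ 2 v₀`: then `v - u ≤ 2 X¹⁰ε`, so `R` is small, and
    -- the upper bound for `q` bounds `p` below.
    · refine h.le_exp_mul_pu hg hl hs le_rfl hE (by simpa using (T s hs).q_le) ?_
      calc X * (γ.v s - γ.u s) ≤ X * (2 * (X ^ 10 * (l / E₀))) := by
            gcongr
            linarith
        _ ≤ X * (X * (X ^ 10 * (l / E₀))) := by gcongr; linarith
        _ = X ^ 12 * (l / E₀) := by ring
        _ ≤ _ := by
          gcongr
          norm_num
  · intro s hsc' hsa
    -- At parameter `0` one has `u + v < 2 v₀`, so small positive parameters belong to the set and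
    -- its supremum in `EReal` is positive, not `⊥`.
    have hs0 : 0 < s := by
      have hc : ContinuousWithinAt (fun t => γ.u t + γ.v t) (initInterval a) 0 :=
        (hg.deriv_u 0 hz).continuousWithinAt.add (hg.deriv_v 0 hz).continuousWithinAt
      by_contra hs0
      push Not at hs0
      have hlt : γ.u 0 + γ.v 0 < 2 * γ.v 0 := by
        have := (mem_dom.1 (hg.mem 0 hz)).2.2.1
        linarith
      obtain ⟨b, hb0, hba⟩ := EReal.lt_iff_exists_real_btwn.1 ha
      have hb0 : 0 < b := EReal.coe_lt_coe_iff.1 (by simpa using hb0)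
      have hsub : Ioo 0 b ⊆ initInterval a := fun x hx =>
        ⟨hx.1.le, lt_trans (EReal.coe_lt_coe_iff.2 hx.2) hba⟩
      have hc' := (hc.mono hsub).eventually (gt_mem_nhds hlt)
      rw [nhdsWithin_Ioo_eq_nhdsGT hb0] at hc'
      obtain ⟨t, ht, ht1⟩ := (hc'.and (Ioo_mem_nhdsGT hb0)).exists
      have : (t : EReal) ≤ sc := by
        rw [hsc]
        exact le_sSup ⟨t, ⟨ht1.1, (hsub ht1).2, ht.le⟩, rfl⟩
      have := EReal.coe_lt_coe_iff.1 (this.trans_lt hsc')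
      linarith [ht1.1]
    have hs : s ∈ initInterval a := ⟨hs0.le, hsa⟩
    have hgt : 2 * γ.v 0 < γ.u s + γ.v s := by
      by_contra hn
      push Not at hn
      refine absurd hsc' (not_lt.2 ?_)
      rw [hsc]
      exact le_sSup ⟨s, ⟨hs0, hsa, hn⟩, rfl⟩
    refine (h.ratio_u_le hg hl hs le_rfl hE ?_).trans (weaken s)
    rcases (T s hs).dich with ⟨d1, d2, -⟩ | ⟨-, -, d⟩
    -- The ingoing alternative would give `u + v ≤ 2 v₀ + ε - X¹⁰ε`, contradicting `u + v > 2 v₀`.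
    · have : X ^ 10 * (l / E₀) ≤ l / E₀ := by linarith
      have h2 : X * (l / E₀) ≤ X ^ 10 * (l / E₀) := by
        gcongr
        exact le_self_pow₀ hX1 (by norm_num)
      nlinarith
    · exact h.le_exp_mul_of_le_pow le_rfl (by norm_num) (h.momenta_radius hg hl hs).2.1 d

end Fields.IsControlled

/-! ### Reflection off conformal infinity -/

namespace Fields.IsControlled

variable {S : Fields} {Λ U vI C₀ δ₀ l : ℝ} {J J' : Set ℝ} {γ γ' : PhaseCurve}

theorem tendsto_tortoise (h : S.IsControlled Λ U vI C₀ δ₀) {f : Filter ℝ} {u₁ : ℝ}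
    (hm : ∀ᶠ s in f, γ.pt s ∈ dom U vI) (hu : Tendsto γ.u f (𝓝 u₁))
    (hv : Tendsto γ.v f (𝓝 (u₁ + vI))) :
    Tendsto (fun s => tortoise Λ (S.r (γ.pt s))) f (𝓝 (Real.pi / 2 / √(-Λ / 3))) := by
  have t : Tendsto (fun s => Real.pi / 2 / √(-Λ / 3) - Real.exp C₀ * (γ.u s + vI - γ.v s)) f
      (𝓝 (Real.pi / 2 / √(-Λ / 3))) := by
    have := (((hu.add_const vI).sub hv).const_mul (Real.exp C₀)).const_sub (Real.pi / 2 / √(-Λ / 3))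
    simpa using this
  refine tendsto_of_tendsto_of_tendsto_of_le_of_le' t tendsto_const_nhds
    (hm.mono fun s hs => ?_) (hm.mono fun s hs => ?_)
  · have := (h.tortoise_infinity (u := γ.u s) (v := γ.v s) hs).2
    simp only [PhaseCurve.pt]
    linarith
  · have h1 := (h.tortoise_infinity (u := γ.u s) (v := γ.v s) hs).1
    have h2 := (mem_dom.1 hs).2.2.2
    have : 0 ≤ (γ.u s + vI - γ.v s) / Real.exp C₀ :=
      div_nonneg (by linarith) (Real.exp_pos _).le
    simp only [PhaseCurve.pt]
    linarith

/-- Tracking is inherited by the reflection off infinity. -/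
theorem tracked_reflection (h : S.IsControlled Λ U vI C₀ δ₀) (hg : IsNullGeodesic S U vI l J γ)
    (hg' : IsNullGeodesic S U vI l J' γ') (hl : 0 < l) (hJ : J.OrdConnected)
    (hJ' : J'.OrdConnected) (hrefl : IsReflection S U vI J γ J' γ') {E w : ℝ} (hE : 0 < E)
    (hRI : Real.exp C₀ ^ 80 * (l / E) ≤ Real.pi / 2 / √(-Λ / 3))
    (hT : ∀ s ∈ J, Tracked (Real.exp C₀) l E w vI (γ.u s) (γ.v s)
      (S.Om2 (γ.pt s) * γ.pu s) (S.Om2 (γ.pt s) * γ.pv s) (tortoise Λ (S.r (γ.pt s))))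
    (hw : ∀ s ∈ J, w - vI < γ.u s) :
    ∃ E' w' : ℝ, 0 < E' ∧ E ≤ Real.exp C₀ ^ 33 * E' ∧ E' ≤ Real.exp (Real.exp C₀ ^ 60) * E ∧
      |w' - (w + vI)| ≤ Real.exp C₀ ^ 49 * (l / E) ∧ w' - vI < U ∧
      ∀ s ∈ J', w' - vI < γ'.u s ∧ Tracked (Real.exp C₀) l E' w' vI (γ'.u s) (γ'.v s)
        (S.Om2 (γ'.pt s) * γ'.pu s) (S.Om2 (γ'.pt s) * γ'.pv s)
        (tortoise Λ (S.r (γ'.pt s))) := by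
  obtain ⟨hJt, hJb, u₁, P, Q, -, huU, tu, tv, tP, tQ, tu', tv', tP', tQ'⟩ := hrefl
  have hX := h.exp_large
  have hray := h.ray hg hl
  have hray' := h.ray hg' hl
  have tR := h.tendsto_tortoise (mem_of_superset hJt hg.mem) tu tv
  have tR' := h.tendsto_tortoise (mem_of_superset hJb hg'.mem) tu' tv'
  have hpi : 0 < Real.pi / 2 / √(-Λ / 3) := by
    have := Real.sqrt_pos.2 (show 0 < -Λ / 3 by linarith [h.neg])
    positivity
  set X := Real.exp C₀ with hXdef
  set RI := Real.pi / 2 / √(-Λ / 3) with hRIdef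
  have hX0 : 0 < X := by linarith
  have hX1 : 1 ≤ X := by linarith
  have tE : Tendsto (fun s => (S.Om2 (γ.pt s) * γ.pu s + S.Om2 (γ.pt s) * γ.pv s) / 2) atTop
      (𝓝 ((P + Q) / 2)) := (tP.add tQ).div_const 2
  have b1 : E ≤ X ^ 33 * ((P + Q) / 2) :=
    ge_of_tendsto (tE.const_mul _) (mem_of_superset hJt fun s hs => by
      obtain ⟨y1, y2, -⟩ := h.momenta_radius hg hl hs
      exact (hT s hs).le_energy hX y1 y2)
  have b2 : (P + Q) / 2 ≤ Real.exp (X ^ 60) * E :=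
    le_of_tendsto tE (mem_of_superset hJt fun s hs => (hT s hs).energy_le)
  have hE' : 0 < (P + Q) / 2 := by
    by_contra hn
    have : X ^ 33 * ((P + Q) / 2) ≤ 0 := mul_nonpos_of_nonneg_of_nonpos (by positivity)
      (not_lt.1 hn)
    linarith
  have hwu : w - vI < u₁ := by
    obtain ⟨t, ht⟩ := (atTop_neBot (α := ℝ)).nonempty_of_mem hJt
    refine (hw t ht).trans_le (ge_of_tendsto tu ?_)
    filter_upwards [hJt, eventually_ge_atTop t] with s hs hts
    exact (hray.mono (hJ.out ht hs)).mono_u (left_mem_Icc.2 hts) (right_mem_Icc.2 hts) hts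
  -- A ray reaching infinity is eventually outgoing: `v - w - (u - (w - vI))/2` is non-positive on
  -- an ingoing ray, but tends to `(u₁ - (w - vI))/2 > 0`.
  have out : ∀ᶠ s in atTop, w - X ^ 10 * (l / E) ≤ γ.u s ∧ γ.u s ≤ w + X ^ 49 * (l / E) ∧
      E ≤ X ^ 32 * (S.Om2 (γ.pt s) * γ.pv s) := by
    have t : Tendsto (fun s => γ.v s - w - (γ.u s - (w - vI)) / 2) atTop
        (𝓝 (u₁ + vI - w - (u₁ - (w - vI)) / 2)) :=
      (tv.sub_const w).sub ((tu.sub_const _).div_const 2)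
    filter_upwards [hJt, t.eventually (lt_mem_nhds (show 0 < _ by linarith))] with s hs hs'
    rcases (hT s hs).dich with ⟨-, -, d, -⟩ | d
    · linarith
    · exact d
  have c1 : w - X ^ 10 * (l / E) ≤ u₁ := ge_of_tendsto tu (out.mono fun s hs => hs.1)
  have c2 : u₁ ≤ w + X ^ 49 * (l / E) := le_of_tendsto tu (out.mono fun s hs => hs.2.1)
  have c3 : E ≤ X ^ 32 * Q := ge_of_tendsto (tQ.const_mul _) (out.mono fun s hs => hs.2.2)
  have c4 : P * Q * RI ^ 2 ≤ 10 * X * l ^ 2 :=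
    le_of_tendsto ((tP.mul tQ).mul (tR.pow 2)) (mem_of_superset hJt fun s hs =>
      (h.momenta_radius hg hl hs).2.2.2.2.2.2)
  have hQ : 0 < Q := by
    by_contra hn
    have : X ^ 32 * Q ≤ 0 := mul_nonpos_of_nonneg_of_nonpos (by positivity) (not_lt.1 hn)
    linarith
  -- Makes the reflected ray ingoing. Otherwise `(Q RI)² ≤ P Q RI² ≤ 10 X l²`, whereas `Q ≥ X⁻³²E`
  -- and `RI ≥ X⁸⁰ l/E` give `Q RI ≥ X⁴⁸ l`.
  have hPQ : P < Q := by
    by_contra! hn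
    have d1 : X ^ 48 * l ≤ Q * RI := by
      have : E * (X ^ 80 * (l / E)) ≤ X ^ 32 * Q * RI :=
        mul_le_mul c3 hRI (by positivity) (by positivity)
      have e : E * (X ^ 80 * (l / E)) = X ^ 32 * (X ^ 48 * l) := by field_simp
      rw [e, mul_assoc] at this
      exact le_of_mul_le_mul_left this (by positivity)
    have d2 : (X ^ 48 * l) ^ 2 ≤ 10 * X * l ^ 2 := by
      calc (X ^ 48 * l) ^ 2 ≤ (Q * RI) ^ 2 := by gcongr
        _ = Q * Q * RI ^ 2 := by ring
        _ ≤ P * Q * RI ^ 2 := by gcongr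
        _ ≤ _ := c4
    have d3 : X ^ 96 * l ^ 2 ≤ 10 * X * l ^ 2 := by
      calc X ^ 96 * l ^ 2 = (X ^ 48 * l) ^ 2 := by ring
        _ ≤ _ := d2
    have d4 : X ^ 96 ≤ 10 * X := le_of_mul_le_mul_right d3 (by positivity)
    have d5 : X ^ 2 ≤ X ^ 96 := pow_le_pow_right₀ hX1 (by norm_num)
    nlinarith
  refine ⟨(P + Q) / 2, u₁ + vI, hE', b1, b2, ?_, by linarith, fun s hs => ⟨?_, ?_⟩⟩
  · have : X ^ 10 * (l / E) ≤ X ^ 49 * (l / E) := by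
      gcongr
      norm_num
    rw [abs_le]
    constructor <;> linarith
  · obtain ⟨t, ht, hts⟩ := ((show ∀ᶠ t in atBot, t ∈ J' from hJb).and (eventually_lt_atBot s)).exists
    have lim : u₁ ≤ γ'.u t := by
      refine le_of_tendsto tu' ?_
      filter_upwards [hJb, eventually_le_atBot t] with x hx hxt
      exact (hray'.mono (hJ'.out hx ht)).mono_u (left_mem_Icc.2 hxt) (right_mem_Icc.2 hxt) hxt
    have := (hray'.mono (hJ'.out ht hs)).strictMono_u (left_mem_Icc.2 hts.le)
      (right_mem_Icc.2 hts.le) hts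
    linarith
  · have tE' : Tendsto (energy S γ') atBot (𝓝 ((P + Q) / 2)) := by
      have : Tendsto (energy S γ') atBot (𝓝 (1 / 2 * (Q + P))) := (tP'.add tQ').const_mul _
      convert this using 2
      ring
    have tε : Tendsto (fun t => l / energy S γ' t) atBot (𝓝 (l / ((P + Q) / 2))) :=
      tendsto_const_nhds.div tE' hE'.ne'
    have hε : l / ((P + Q) / 2) ≤ X ^ 33 * (l / E) := by
      calc l / ((P + Q) / 2) = X ^ 33 * (l / (X ^ 33 * ((P + Q) / 2))) := by field_simp
        _ ≤ _ := by gcongr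
    have hε0 : 0 < l / E := by positivity
    have e40 : X ^ 40 * (l / ((P + Q) / 2)) < RI := by
      calc X ^ 40 * (l / ((P + Q) / 2)) ≤ X ^ 40 * (X ^ 33 * (l / E)) := by gcongr
        _ = X ^ 73 * (l / E) := by ring
        _ < X ^ 80 * (l / E) := by
          gcongr
          · linarith
          · norm_num
        _ ≤ _ := hRI
    have e20 : X ^ 20 * (l / ((P + Q) / 2)) < RI := by
      refine lt_of_le_of_lt ?_ e40
      gcongr
      norm_num
    -- The reflected ray has no initial point in the domain. The passage estimate is applied from
    -- `t` to the fixed `s`, and `t → -∞`; strict inequalities at infinity ensure its hypotheses for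
    -- all early `t`.
    refine Tracked.of_tendsto tE' hE' tv' ?_
    filter_upwards [hJb, eventually_le_atBot s, tQ'.eventually_lt tP' hPQ,
      (tε.const_mul (X ^ 40)).eventually (gt_mem_nhds e40),
      (tε.const_mul (X ^ 20)).eventually_lt tR' e20] with t ht hts hpq h40 h20
    have hO := h.sol.Om2_pos _ (hg'.mem t ht)
    exact h.tracked hg' hl hJ' ht hs hts (lt_of_mul_lt_mul_left hpq hO.le).le h40.le h20.le

end Fields.IsControlled

theorem ordConnected_component (a b : ℕ → EReal) (n : ℕ) : (component a b n).OrdConnected := by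
  unfold component
  split_ifs
  · exact ordConnected_initInterval _
  · exact ⟨fun x hx y hy z hz => ⟨lt_of_lt_of_le hx.1 (EReal.coe_le_coe_iff.2 hz.1),
      lt_of_le_of_lt (EReal.coe_le_coe_iff.2 hz.2) hy.2⟩⟩

/-- The energy `E` and the cone `v = w` of the incoming part of the `n`-th component, compared with
the initial values. -/
structure IsStage (X l E₀ v₀ vI : ℝ) (n : ℕ) (E w : ℝ) : Prop where
  pos : 0 < E
  energy_ge : E₀ ≤ X ^ (33 * n) * E
  energy_le : E ≤ Real.exp (n * X ^ 60) * E₀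
  drift : |w - (v₀ + n * vI)| ≤ X ^ (50 + 33 * n) * (l / E₀)

/-! ### Iteration over the reflections -/

namespace IsStage

variable {X l E₀ v₀ vI E w : ℝ} {n : ℕ}

theorem impact_le (h : IsStage X l E₀ v₀ vI n E w) (hl : 0 < l) (hX : 0 < X) (hE₀ : 0 < E₀) :
    l / E ≤ X ^ (33 * n) * (l / E₀) := by
  have := h.pos
  calc l / E = X ^ (33 * n) * (l / (X ^ (33 * n) * E)) := by field_simp
    _ ≤ _ := by
      gcongr
      exact h.energy_ge

theorem impact_ge (h : IsStage X l E₀ v₀ vI n E w) (hl : 0 < l) (hE₀ : 0 < E₀) :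
    l / E₀ ≤ Real.exp (n * X ^ 60) * (l / E) := by
  have := h.pos
  calc l / E₀ = Real.exp (n * X ^ 60) * (l / (Real.exp (n * X ^ 60) * E₀)) := by field_simp
    _ ≤ _ := by
      gcongr
      exact h.energy_le

/-- The impact parameter `l/E` may grow by `X ^ 33` per reflection, so the drifts form a geometric
sum dominated by its last term. -/
theorem succ (h : IsStage X l E₀ v₀ vI n E w) {E' w' : ℝ} (hl : 0 < l) (hX : 1000 ≤ X)
    (hE₀ : 0 < E₀) (hE' : 0 < E') (h1 : E ≤ X ^ 33 * E') (h2 : E' ≤ Real.exp (X ^ 60) * E)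
    (h3 : |w' - (w + vI)| ≤ X ^ 49 * (l / E)) : IsStage X l E₀ v₀ vI (n + 1) E' w' := by
  have hX0 : 0 < X := by linarith
  refine ⟨hE', ?_, ?_, ?_⟩
  · calc E₀ ≤ X ^ (33 * n) * E := h.energy_ge
      _ ≤ X ^ (33 * n) * (X ^ 33 * E') := by gcongr
      _ = _ := by ring
  · calc E' ≤ Real.exp (X ^ 60) * E := h2
      _ ≤ Real.exp (X ^ 60) * (Real.exp (n * X ^ 60) * E₀) := by
        gcongr
        exact h.energy_le
      _ = _ := by
        rw [← mul_assoc, ← Real.exp_add]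
        push_cast
        ring_nf
  · have hε : 0 < l / E₀ := by positivity
    have e : w' - (v₀ + (n + 1 : ℕ) * vI) = (w' - (w + vI)) + (w - (v₀ + n * vI)) := by
      push_cast
      ring
    rw [e]
    calc _ ≤ |w' - (w + vI)| + |w - (v₀ + n * vI)| := abs_add_le _ _
      _ ≤ X ^ 49 * (X ^ (33 * n) * (l / E₀)) + X ^ (50 + 33 * n) * (l / E₀) := by
        gcongr
        · exact h3.trans (by gcongr; exact h.impact_le hl hX0 hE₀)
        · exact h.drift
      _ = X ^ (49 + 33 * n) * (l / E₀) + X ^ (50 + 33 * n) * (l / E₀) := by ring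
      _ ≤ X ^ (82 + 33 * n) * (l / E₀) + X ^ (82 + 33 * n) * (l / E₀) := by
        gcongr <;> linarith
      _ = 2 * (X ^ (82 + 33 * n) * (l / E₀)) := by ring
      _ ≤ X * (X ^ (82 + 33 * n) * (l / E₀)) := by gcongr; linarith
      _ = _ := by ring

end IsStage

namespace Fields.IsControlled

variable {S : Fields} {Λ U vI C₀ δ₀ l : ℝ} {J : Set ℝ} {γ : PhaseCurve}

/-- The axis and infinity bounds are added at the midpoint `(0, vI/2)`. This converts smallness
relative to `RI` into smallness relative to `vI`. -/
theorem radius_infinity_le (h : S.IsControlled Λ U vI C₀ δ₀) :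
    Real.pi / 2 / √(-Λ / 3) ≤ Real.exp C₀ * vI := by
  have hv := h.vI_pos
  have hm : ((0 : ℝ), vI / 2) ∈ dom U vI :=
    mem_dom.2 ⟨le_rfl, h.U_pos, by linarith, by linarith⟩
  have h1 := (h.tortoise_axis hm).2
  have h2 := (h.tortoise_infinity hm).2
  nlinarith

/-- All components of a reflected geodesic are tracked, and there are not too many of them. -/
theorem stages (h : S.IsControlled Λ U vI C₀ δ₀) {N : ℕ∞} {a b : ℕ → EReal} {E₀ v₀ : ℝ}
    {γ : ℕ → PhaseCurve} (hγ : IsMaximalReflected S U vI l N a b γ) (hl : 0 < l)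
    (hu0 : (γ 0).u 0 = 0) (hpq : (γ 0).pv 0 < (γ 0).pu 0) (hE₀ : E₀ = energy S (γ 0) 0)
    (hsmall : l / E₀ * √(-Λ) ≤ (Real.exp C₀ ^ (400 * (1 + ⌈U / vI⌉₊)))⁻¹)
    (hr : Real.exp C₀ ^ 50 * (l / E₀) ≤ S.r ((γ 0).pt 0)) (hv₀ : v₀ = (γ 0).v 0)
    (n : ℕ) (hn : (n : ℕ∞) ≤ N) :
    n ≤ ⌈U / vI⌉₊ + 1 ∧ ∃ E w : ℝ, IsStage (Real.exp C₀) l E₀ v₀ vI n E w ∧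
      ∀ s ∈ component a b n, w - vI < (γ n).u s ∧
        Tracked (Real.exp C₀) l E w vI ((γ n).u s) ((γ n).v s) (S.Om2 ((γ n).pt s) * (γ n).pu s)
          (S.Om2 ((γ n).pt s) * (γ n).pv s) (tortoise Λ (S.r ((γ n).pt s))) := by
  have hX := h.exp_large
  have hz : (0 : ℝ) ∈ component a b 0 := by
    rw [component, if_pos rfl]
    refine zero_mem_initInterval ?_
    rw [← hγ.a_zero]
    exact hγ.lt 0 bot_le
  have hg0 := hγ.geodesic 0 bot_le
  have hE : 0 < E₀ := hE₀ ▸ h.energy_pos hg0 hl hz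
  have hd0 := mem_dom.1 (hg0.mem 0 hz)
  have hε : 0 < l / E₀ := by positivity
  have hRI := h.radius_infinity_ge hε hsmall (by positivity)
  have hRI' := h.radius_infinity_le
  set X := Real.exp C₀ with hXdef
  have hX0 : 0 < X := by linarith
  have hX1 : 1 ≤ X := by linarith
  induction n with
  | zero =>
    refine ⟨Nat.zero_le _, E₀, v₀, ⟨hE, by simp, by simp, by simp; positivity⟩, fun s hs => ?_⟩
    have hs0 : 0 ≤ s := by
      rw [component, if_pos rfl] at hs
      exact hs.1
    refine ⟨?_, ?_⟩
    · have := (mem_dom.1 (hg0.mem s hs)).1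
      linarith [hd0.2.2.2]
    · rw [hE₀, hv₀]
      rw [hE₀] at hsmall hr
      refine h.tracked_of_small hg0 hl (ordConnected_component a b 0) hz hs hs0 hpq.le
        (hsmall.trans ?_) hr
      gcongr
      omega
  | succ n ih =>
    have hn' : (n : ℕ∞) ≤ N := le_trans (by exact_mod_cast n.le_succ) hn
    obtain ⟨hnM, E, w, hst, hT⟩ := ih hn'
    have hRE : X ^ 80 * (l / E) ≤ Real.pi / 2 / √(-Λ / 3) := by
      calc X ^ 80 * (l / E) ≤ X ^ 80 * (X ^ (33 * n) * (l / E₀)) := by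
            gcongr
            exact hst.impact_le hl hX0 hE
        _ = X ^ (80 + 33 * n) * (l / E₀) := by ring
        _ ≤ X ^ (400 * (1 + ⌈U / vI⌉₊)) * (l / E₀) := by
            gcongr
            omega
        _ ≤ _ := hRI
    obtain ⟨E', w', hE', e1, e2, e3, hwU, hT'⟩ := h.tracked_reflection (hγ.geodesic n hn')
      (hγ.geodesic (n + 1) hn) hl (ordConnected_component a b n) (ordConnected_component a b (n + 1))
      (hγ.reflection n hn) hst.pos hRE (fun s hs => (hT s hs).2) (fun s hs => (hT s hs).1)
    have hst' := hst.succ hl hX hE hE' e1 e2 e3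
    refine ⟨?_, E', w', hst', hT'⟩
    have hvI := h.vI_pos
    have hM : U ≤ ⌈U / vI⌉₊ * vI := (div_le_iff₀ hvI).1 (Nat.le_ceil _)
    have hdrift : X ^ (50 + 33 * (n + 1)) * (l / E₀) ≤ vI := by
      have : X * (X ^ (50 + 33 * (n + 1)) * (l / E₀)) ≤ X * vI := by
        calc X * (X ^ (50 + 33 * (n + 1)) * (l / E₀))
            = X ^ (84 + 33 * n) * (l / E₀) := by ring
          _ ≤ X ^ (400 * (1 + ⌈U / vI⌉₊)) * (l / E₀) := by
            gcongr
            omega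
          _ ≤ _ := hRI.trans hRI'
      exact le_of_mul_le_mul_left this hX0
    -- The drift is at most `vI`, so `w' ≥ v₀ + n vI` with `v₀ > 0`, while the reflection point has
    -- `w' - vI < U ≤ ⌈U/vI⌉ vI`. This bounds the number of reflections.
    have hlow := (abs_le.1 (hst'.drift.trans hdrift)).1
    push_cast at hlow
    have hv0 : 0 < v₀ := by linarith [hd0.2.2.1]
    by_contra! hcon
    have hcon' : ((⌈U / vI⌉₊ : ℝ) + 1) ≤ n := by exact_mod_cast (by omega : ⌈U / vI⌉₊ + 1 ≤ n)
    nlinarith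

set_option maxHeartbeats 1000000 in
/-- The successive passages of a geodesic reflected off infinity. -/
theorem successive_passages (h : S.IsControlled Λ U vI C₀ δ₀) {N : ℕ∞} {a b : ℕ → EReal}
    {E₀ v₀ : ℝ} {γ : ℕ → PhaseCurve} (hγ : IsMaximalReflected S U vI l N a b γ)
    (hu0 : (γ 0).u 0 = 0) (hpq : (γ 0).pv 0 < (γ 0).pu 0) (hE₀ : E₀ = energy S (γ 0) 0)
    (hl0 : 0 < l / E₀ * √(-Λ))
    (hl1 : l / E₀ * √(-Λ) ≤ Real.exp (-400 * (1 + (⌈U / vI⌉₊ : ℝ)) * C₀))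
    (hr : Real.exp (50 * C₀) * (l / E₀) ≤ S.r ((γ 0).pt 0)) (hv₀ : v₀ = (γ 0).v 0)
    (n : ℕ) (hn : (n : ℕ∞) ≤ N) (s : ℝ) (hs : s ∈ component a b n) :
    ((γ n).pt s ∈
      {p | Real.exp (-(Real.exp (400 * C₀) * (1 + U / vI))) * (l / E₀) ≤ S.r p} ∩
      (⋃ k ∈ Finset.range (⌈U / vI⌉₊ + 1),
        (rectInIter v₀ vI C₀ l E₀ k ∪ rectOutIter v₀ vI C₀ l E₀ k)) ∩ dom U vI) ∧
    (Real.exp (-300 * C₀ * (1 + U / vI)) * E₀ ≤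
        S.Om2 ((γ n).pt s) * ((γ n).pu s + (γ n).pv s) ∧
      S.Om2 ((γ n).pt s) * ((γ n).pu s + (γ n).pv s) ≤
        Real.exp (Real.exp (300 * C₀) * (1 + U / vI)) * E₀) ∧
    ((γ n).pt s ∈ rectInIter v₀ vI C₀ l E₀ n →
      (γ n).pv s / (γ n).pu s ≤
        Real.exp (Real.exp (300 * C₀) * (1 + U / vI)) * (l ^ 2 / E₀ ^ 2) *
        ((1 - 1 / 3 * Λ * S.r ((γ n).pt s) ^ 2) / S.r ((γ n).pt s) ^ 2)) ∧
    ((γ n).pt s ∈ rectOutIter v₀ vI C₀ l E₀ n →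
      (γ n).pu s / (γ n).pv s ≤
        Real.exp (Real.exp (300 * C₀) * (1 + U / vI)) * (l ^ 2 / E₀ ^ 2) *
        ((1 - 1 / 3 * Λ * S.r ((γ n).pt s) ^ 2) / S.r ((γ n).pt s) ^ 2)) := by
  have hz : (0 : ℝ) ∈ component a b 0 := by
    rw [component, if_pos rfl]
    refine zero_mem_initInterval ?_
    rw [← hγ.a_zero]
    exact hγ.lt 0 bot_le
  have hg0 := hγ.geodesic 0 bot_le
  have hg := hγ.geodesic n hn
  have hl : 0 < l := hg0.pos_of_small (hE₀ ▸ hl0)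
  have hE : 0 < E₀ := hE₀ ▸ h.energy_pos hg0 hl hz
  have hv0 : 0 < v₀ := by
    have := (mem_dom.1 (hg0.mem 0 hz)).2.2.1
    linarith
  have e50 : Real.exp (50 * C₀) = Real.exp C₀ ^ 50 := by rw [← Real.exp_nat_mul]; norm_num
  have e300 : Real.exp (300 * C₀) = Real.exp C₀ ^ 300 := by rw [← Real.exp_nat_mul]; norm_num
  have e400 : Real.exp (400 * C₀) = Real.exp C₀ ^ 400 := by rw [← Real.exp_nat_mul]; norm_num
  have eM : Real.exp (-400 * (1 + (⌈U / vI⌉₊ : ℝ)) * C₀) =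
      (Real.exp C₀ ^ (400 * (1 + ⌈U / vI⌉₊)))⁻¹ := by
    rw [← Real.exp_nat_mul, ← Real.exp_neg]; congr 1; push_cast; ring
  have eW : ∀ k : ℕ, width C₀ l E₀ k = Real.exp C₀ ^ (300 * (k + 1)) * (l / E₀) := fun k => by
    rw [width, ← Real.exp_nat_mul]; push_cast; rfl
  rw [eM] at hl1
  rw [e50] at hr
  rw [e300, e400]
  obtain ⟨hnM, E, w, hst, hT⟩ := h.stages hγ hl hu0 hpq hE₀ hl1 hr hv₀ n hn
  obtain ⟨hwu, T⟩ := hT s hs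
  obtain ⟨y1, y2, y3, y4, -⟩ := h.momenta_radius hg hl hs
  have hd := mem_dom.1 (hg.mem s hs)
  have hX := h.exp_large
  have hC := h.C_large
  have hvI := h.vI_pos
  have hU := h.U_pos
  have hM : U ≤ ⌈U / vI⌉₊ * vI := (div_le_iff₀ hvI).1 (Nat.le_ceil _)
  have hM' := Nat.ceil_lt_add_one (show 0 ≤ U / vI by positivity)
  have hZ0 : 0 < U / vI := by positivity
  have hnM' : (n : ℝ) ≤ ⌈U / vI⌉₊ + 1 := by exact_mod_cast hnM
  have hnZ : (n : ℝ) + 1 ≤ 3 * (1 + U / vI) := by linarith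
  have hnZ' : (n : ℝ) + 2 ≤ 4 * (1 + U / vI) := by linarith
  have hε : 0 < l / E₀ := by positivity
  have hE1 := hst.pos
  have i1 := hst.impact_le hl (Real.exp_pos C₀) hE
  have i2 := hst.impact_ge hl hE
  have hdr := abs_le.1 hst.drift
  have hX1 : 1 ≤ Real.exp C₀ := by linarith
  have hX0 := Real.exp_pos C₀
  have grow : ∀ {x : ℝ} {i j : ℕ}, x ≤ 4 * (1 + U / vI) → 0 ≤ x → i + 1 ≤ j →
      Real.exp (x * Real.exp C₀ ^ i) ≤ Real.exp (Real.exp C₀ ^ j * (1 + U / vI)) := by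
    intro x i j hx hx0 hij
    refine Real.exp_le_exp.2 ?_
    calc x * Real.exp C₀ ^ i ≤ 4 * (1 + U / vI) * Real.exp C₀ ^ i := by gcongr
      _ = 4 * Real.exp C₀ ^ i * (1 + U / vI) := by ring
      _ ≤ Real.exp C₀ * Real.exp C₀ ^ i * (1 + U / vI) := by gcongr; linarith
      _ = Real.exp C₀ ^ (i + 1) * (1 + U / vI) := by ring
      _ ≤ _ := by gcongr
  have exp_mul : ∀ k : ℕ, Real.exp (Real.exp C₀ ^ 60) * Real.exp (k * Real.exp C₀ ^ 60) =
      Real.exp ((k + 1 : ℕ) * Real.exp C₀ ^ 60) := fun k => by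
    rw [← Real.exp_add]; push_cast; ring_nf
  have pow_le_exp : ∀ k : ℕ, k ≤ 60 → Real.exp C₀ ^ k ≤ Real.exp (Real.exp C₀ ^ 60) :=
    fun k hk => by
      have := Real.add_one_le_exp (Real.exp C₀ ^ 60)
      have := pow_le_pow_right₀ hX1 hk
      linarith
  have hp : S.Om2 ((γ n).pt s) * (γ n).pu s ≤
      Real.exp ((n + 1 : ℕ) * Real.exp C₀ ^ 60) * E₀ := by
    refine T.p_le.trans ?_
    rw [← exp_mul, mul_assoc]
    gcongr
    exact hst.energy_le
  have hq : S.Om2 ((γ n).pt s) * (γ n).pv s ≤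
      Real.exp ((n + 1 : ℕ) * Real.exp C₀ ^ 60) * E₀ := by
    refine T.q_le.trans ?_
    rw [← exp_mul, mul_assoc]
    gcongr
    exact hst.energy_le
  have weaken : Real.exp ((n + 1 : ℕ) * Real.exp C₀ ^ 62) * (l ^ 2 / E₀ ^ 2) *
      ((1 - 1 / 3 * Λ * S.r ((γ n).pt s) ^ 2) / S.r ((γ n).pt s) ^ 2) ≤
      Real.exp (Real.exp C₀ ^ 300 * (1 + U / vI)) * (l ^ 2 / E₀ ^ 2) *
      ((1 - 1 / 3 * Λ * S.r ((γ n).pt s) ^ 2) / S.r ((γ n).pt s) ^ 2) := by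
    have hκ := h.kappa_pos ((γ n).pt s)
    gcongr ?_ * _ * _
    exact grow (by push_cast; linarith) (by positivity) (by norm_num)
  set X := Real.exp C₀ with hXdef
  have hW : ∀ k : ℕ, n ≤ k + 1 → X ^ (50 + 33 * n) * (l / E₀) ≤ width C₀ l E₀ k := fun k hk => by
    rw [eW]
    gcongr
    omega
  have hW2 : X ^ (50 + 33 * n) * (l / E₀) + X ^ 49 * (l / E) ≤ width C₀ l E₀ n := by
    rw [eW]
    calc X ^ (50 + 33 * n) * (l / E₀) + X ^ 49 * (l / E)
        ≤ X ^ (50 + 33 * n) * (l / E₀) + X ^ 50 * (X ^ (33 * n) * (l / E₀)) := by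
          gcongr
          norm_num
      _ = 2 * (X ^ (50 + 33 * n) * (l / E₀)) := by ring
      _ ≤ X * (X ^ (50 + 33 * n) * (l / E₀)) := by gcongr; linarith
      _ = X ^ (51 + 33 * n) * (l / E₀) := by ring
      _ ≤ _ := by
        gcongr
        omega
  have hε1 : l / E ≤ X ^ 49 * (l / E) := le_mul_of_one_le_left (by positivity) (one_le_pow₀ hX1)
  have hε2 : X ^ 10 * (l / E) ≤ X ^ 49 * (l / E) := by
    gcongr
    norm_num
  have hε3 : 0 < l / E := by positivity
  have close : ∀ {x : ℝ}, x ≤ 2 * width C₀ l E₀ n →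
      X * x ≤ X ^ (302 * (n + 1)) * (l / E₀) := fun {x} hx => by
    calc X * x ≤ X * (2 * width C₀ l E₀ n) := by gcongr
      _ = X * (2 * (X ^ (300 * (n + 1)) * (l / E₀))) := by rw [eW]
      _ ≤ X * (X * (X ^ (300 * (n + 1)) * (l / E₀))) := by gcongr; linarith
      _ = X ^ (2 + 300 * (n + 1)) * (l / E₀) := by ring
      _ ≤ _ := by
        gcongr
        omega
  refine ⟨⟨⟨?_, ?_⟩, hg.mem s hs⟩, ⟨?_, ?_⟩, fun hmem => ?_, fun hmem => ?_⟩
  · change Real.exp (-(X ^ 400 * (1 + U / vI))) * (l / E₀) ≤ S.r ((γ n).pt s)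
    rw [Real.exp_neg, inv_mul_le_iff₀ (Real.exp_pos _)]
    calc l / E₀ ≤ Real.exp (n * X ^ 60) * (l / E) := i2
      _ ≤ Real.exp (n * X ^ 60) * (X ^ 6 * S.r ((γ n).pt s)) := by
        gcongr
        exact T.R_ge.trans (by gcongr)
      _ = X ^ 6 * Real.exp (n * X ^ 60) * S.r ((γ n).pt s) := by ring
      _ ≤ _ := by
        have := h.sol.r_pos _ (hg.mem s hs)
        gcongr ?_ * _
        calc X ^ 6 * Real.exp (n * X ^ 60) ≤ Real.exp (X ^ 60) * Real.exp (n * X ^ 60) := by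
              gcongr
              exact pow_le_exp 6 (by norm_num)
          _ = _ := exp_mul n
          _ ≤ _ := grow (by push_cast; linarith) (by positivity) (by norm_num)
  · simp only [mem_iUnion]
    have tv := T.v_ge
    rcases Nat.lt_or_ge n (⌈U / vI⌉₊ + 1) with hlt | hge
    · refine ⟨n, Finset.mem_range.2 hlt, ?_⟩
      rcases T.dich with ⟨d1, d2, -⟩ | ⟨d1, d2, -⟩
      · refine Or.inl ⟨⟨?_, ?_⟩, ?_, ?_⟩ <;> dsimp only [PhaseCurve.pt] <;> linarith
      · refine Or.inr ⟨⟨?_, ?_⟩, ?_, ?_⟩ <;> dsimp only [PhaseCurve.pt] <;> linarith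
    -- One more component than rectangles can occur. It starts with `u` near `v₀ + ⌈U/vI⌉ vI` or
    -- later, and `u < U ≤ ⌈U/vI⌉ vI`, so it stays in the last outgoing rectangle.
    · obtain rfl : n = ⌈U / vI⌉₊ + 1 := le_antisymm hnM hge
      have := hW ⌈U / vI⌉₊ le_rfl
      refine ⟨⌈U / vI⌉₊, Finset.mem_range.2 (Nat.lt_succ_self _), Or.inr ?_⟩
      push_cast at hdr
      refine ⟨⟨?_, ?_⟩, ?_, ?_⟩ <;> dsimp only [PhaseCurve.pt] <;> linarith
  · have e : Real.exp (-300 * C₀ * (1 + U / vI)) = (Real.exp (300 * C₀ * (1 + U / vI)))⁻¹ := by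
      rw [← Real.exp_neg]; congr 1; ring
    rw [e, inv_mul_le_iff₀ (Real.exp_pos _), mul_add (S.Om2 _)]
    calc E₀ ≤ X ^ (33 * n) * E := hst.energy_ge
      _ ≤ X ^ (33 * n) * (X ^ 33 * ((S.Om2 ((γ n).pt s) * (γ n).pu s +
          S.Om2 ((γ n).pt s) * (γ n).pv s) / 2)) := by
        gcongr
        exact T.le_energy hX y1 y2
      _ ≤ X ^ (33 * n) * (X ^ 33 * (S.Om2 ((γ n).pt s) * (γ n).pu s +
          S.Om2 ((γ n).pt s) * (γ n).pv s)) := by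
        gcongr
        linarith
      _ = X ^ (33 * (n + 1)) * (S.Om2 ((γ n).pt s) * (γ n).pu s +
          S.Om2 ((γ n).pt s) * (γ n).pv s) := by ring
      _ ≤ _ := by
        gcongr
        rw [hXdef, ← Real.exp_nat_mul]
        refine Real.exp_le_exp.2 ?_
        push_cast
        have := mul_le_mul_of_nonneg_left hnZ (show 0 ≤ 33 * C₀ by linarith)
        have : 0 ≤ C₀ * (1 + U / vI) := by positivity
        linarith
  · rw [mul_add (S.Om2 _)]
    calc _ ≤ 2 * (Real.exp ((n + 1 : ℕ) * X ^ 60) * E₀) := by linarith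
      _ ≤ Real.exp (X ^ 60) * (Real.exp ((n + 1 : ℕ) * X ^ 60) * E₀) := by
        gcongr
        have := pow_le_exp 1 (by norm_num)
        rw [pow_one] at this
        linarith
      _ = Real.exp ((n + 2 : ℕ) * X ^ 60) * E₀ := by rw [← mul_assoc, exp_mul]
      _ ≤ _ := by
        gcongr ?_ * _
        exact grow (by push_cast; linarith) (by positivity) (by norm_num)
  · refine (h.ratio_v_le hg hl hs (Nat.succ_le_succ (Nat.zero_le n)) hE ?_).trans weaken
    rcases T.dich with ⟨-, -, -, d⟩ | ⟨d, -, -⟩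
    · refine h.le_exp_mul_of_le_pow (k := 33 * n + 3) (by omega) (by omega) y1 ?_
      calc E₀ ≤ X ^ (33 * n) * E := hst.energy_ge
        _ ≤ X ^ (33 * n) * (X ^ 3 * (S.Om2 ((γ n).pt s) * (γ n).pu s)) := by gcongr
        _ = _ := by ring
    -- An outgoing point inside the ingoing rectangle is within two widths of the axis, where an
    -- upper bound for `q` gives a lower bound for `p`. The other rectangle is symmetric.
    · refine h.le_exp_mul_pu hg hl hs (by omega) hE hq (close ?_)
      have := hmem.2.2
      dsimp only [PhaseCurve.pt] at this
      linarith
  · refine (h.ratio_u_le hg hl hs (Nat.succ_le_succ (Nat.zero_le n)) hE ?_).trans weaken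
    rcases T.dich with ⟨-, d, -⟩ | ⟨-, -, d⟩
    · refine h.le_exp_mul_pv hg hl hs (by omega) hE hp (close ?_)
      have := hmem.1.1
      dsimp only [PhaseCurve.pt] at this
      linarith
    · refine h.le_exp_mul_of_le_pow (k := 33 * n + 32) (by omega) (by omega) y2 ?_
      calc E₀ ≤ X ^ (33 * n) * E := hst.energy_ge
        _ ≤ X ^ (33 * n) * (X ^ 32 * (S.Om2 ((γ n).pt s) * (γ n).pv s)) := by gcongr
        _ = _ := by ring

end Fields.IsControlled

end EinsteinVlasov

open EinsteinVlasov in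
theorem mainTheorem2 :
    ∃ δ₁ : ℝ, 0 < δ₁ ∧ ∀ δ₀ : ℝ, 0 < δ₀ → δ₀ ≤ δ₁ →
    ∀ (Λ U vI C₀ : ℝ) (S : Fields), Λ < 0 → 0 < U → 0 < vI → 100 < C₀ →
      S.IsSmoothSolution Λ U vI →
      (∀ p ∈ dom U vI, 0 < dV (dom U vI) S.r p ∧ dU (dom U vI) S.r p < 0 ∧
        |Real.log (dV (dom U vI) S.r p / (1 - 1 / 3 * Λ * S.r p ^ 2))|
          + |Real.log (-dU (dom U vI) S.r p / (1 - 1 / 3 * Λ * S.r p ^ 2))| ≤ C₀) →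
      (∀ p ∈ dom U vI, 2 * S.renMass Λ (dom U vI) p / S.r p
          + √(-Λ) * S.renMass Λ (dom U vI) p ≤ δ₀) →
      -- one passage: from the initial point through the centre to infinity
      (∀ (a : EReal) (l E₀ u₀ v₀ : ℝ) (γ : PhaseCurve), 0 < a →
        IsNullGeodesic S U vI l (initInterval a) γ →
        FutureInextendible S U vI l (initInterval a) γ →
        γ.pv 0 < γ.pu 0 →
        E₀ = energy S γ 0 →
        0 < l / E₀ * √(-Λ) → l / E₀ * √(-Λ) ≤ Real.exp (-50 * C₀) →
        Real.exp (50 * C₀) * (l / E₀) ≤ S.r (γ.pt 0) →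
        (u₀, v₀) = γ.pt 0 →
        (∀ s ∈ initInterval a,
          γ.pt s ∈ {p | Real.exp (-6 * C₀) * (l / E₀) ≤ S.r p} ∩
            (rectIn u₀ v₀ (Real.exp (150 * C₀) * (l / E₀)) ∪
              rectOut v₀ vI (Real.exp (150 * C₀) * (l / E₀))) ∩ dom U vI) ∧
        (∀ s ∈ initInterval a,
          Real.exp (-100 * C₀) * E₀ ≤ energy S γ s ∧
          energy S γ s ≤ Real.exp (Real.exp (200 * C₀)) * E₀) ∧
        (∀ sc : EReal,
          sc = sSup ((fun s : ℝ => (s : EReal)) ''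
            {s : ℝ | 0 < s ∧ (s : EReal) < a ∧ γ.u s + γ.v s ≤ 2 * v₀}) →
          (∀ s : ℝ, 0 ≤ s → (s : EReal) < sc →
            γ.pv s / γ.pu s ≤ Real.exp (Real.exp (200 * C₀)) * (l ^ 2 / E₀ ^ 2) *
              ((1 - 1 / 3 * Λ * S.r (γ.pt s) ^ 2) / S.r (γ.pt s) ^ 2)) ∧
          (∀ s : ℝ, sc < (s : EReal) → (s : EReal) < a →
            γ.pu s / γ.pv s ≤ Real.exp (Real.exp (200 * C₀)) * (l ^ 2 / E₀ ^ 2) *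
              ((1 - 1 / 3 * Λ * S.r (γ.pt s) ^ 2) / S.r (γ.pt s) ^ 2)))) ∧
      -- successive passages, through reflections off infinity
      (∀ (N : ℕ∞) (a b : ℕ → EReal) (l E₀ v₀ : ℝ) (γ : ℕ → PhaseCurve),
        IsMaximalReflected S U vI l N a b γ →
        (γ 0).u 0 = 0 →
        (γ 0).pv 0 < (γ 0).pu 0 →
        E₀ = energy S (γ 0) 0 →
        0 < l / E₀ * √(-Λ) →
        l / E₀ * √(-Λ) ≤ Real.exp (-400 * (1 + (⌈U / vI⌉₊ : ℝ)) * C₀) →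
        Real.exp (50 * C₀) * (l / E₀) ≤ S.r ((γ 0).pt 0) →
        v₀ = (γ 0).v 0 →
        ∀ n : ℕ, (n : ℕ∞) ≤ N → ∀ s ∈ component a b n,
          ((γ n).pt s ∈
            {p | Real.exp (-(Real.exp (400 * C₀) * (1 + U / vI))) * (l / E₀) ≤ S.r p} ∩
            (⋃ k ∈ Finset.range (⌈U / vI⌉₊ + 1),
              (rectInIter v₀ vI C₀ l E₀ k ∪ rectOutIter v₀ vI C₀ l E₀ k)) ∩ dom U vI) ∧
          (Real.exp (-300 * C₀ * (1 + U / vI)) * E₀ ≤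
              S.Om2 ((γ n).pt s) * ((γ n).pu s + (γ n).pv s) ∧
            S.Om2 ((γ n).pt s) * ((γ n).pu s + (γ n).pv s) ≤
              Real.exp (Real.exp (300 * C₀) * (1 + U / vI)) * E₀) ∧
          ((γ n).pt s ∈ rectInIter v₀ vI C₀ l E₀ n →
            (γ n).pv s / (γ n).pu s ≤
              Real.exp (Real.exp (300 * C₀) * (1 + U / vI)) * (l ^ 2 / E₀ ^ 2) *
              ((1 - 1 / 3 * Λ * S.r ((γ n).pt s) ^ 2) / S.r ((γ n).pt s) ^ 2)) ∧
          ((γ n).pt s ∈ rectOutIter v₀ vI C₀ l E₀ n →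
            (γ n).pu s / (γ n).pv s ≤
              Real.exp (Real.exp (300 * C₀) * (1 + U / vI)) * (l ^ 2 / E₀ ^ 2) *
              ((1 - 1 / 3 * Λ * S.r ((γ n).pt s) ^ 2) / S.r ((γ n).pt s) ^ 2))) := by
  -- The value `1/100` makes `1 - 6m̃/r` positive and gives the factor `100/99` in the bound for
  -- `Ω²`.
  refine ⟨1 / 100, by norm_num, fun δ₀ _ hδ Λ U vI C₀ S hΛ hU hvI hC hS hb hm => ?_⟩
  have h : S.IsControlled Λ U vI C₀ δ₀ := ⟨hΛ, hU, hvI, hC, hδ, hS, hb, hm⟩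
  exact ⟨fun a l E₀ u₀ v₀ γ ha hg _ hpq hE hl0 hl1 hr h0 =>
      h.one_passage ha hg hpq hE hl0 hl1 hr h0,
    fun N a b l E₀ v₀ γ hγ hu0 hpq hE hl0 hl1 hr hv₀ =>
      h.successive_passages hγ hu0 hpq hE hl0 hl1 hr hv₀⟩
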